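/- Let $M$ be a compact smooth manifold of dimension $2n$, let $x\in C^\infty(M)$ have $0$ as a regular value, let $Z=x^{-1}(0)\neq\emptyset$ with inclusion $i:Z\hookrightarrow M$, and let $m=2k+1$ with $k\ge 0$. A $b^m$-symplectic form on $(M,Z,x)$ is a closed form $\omega=\alpha\wedge\frac{dx}{x^m}+\beta$ with smooth $\alpha\in\Omega^1(M)$, $\beta\in\Omega^2(M)$, which has maximal rank at every point as a form on the $b^m$-tangent bundle (whose fiber is $T_pM$ for $p\notin Z$ and $T_pZ\oplus\langle x^m\partial/\partial x\rangle$ for $p\in Z$). Let $\omega$ be such a form. (1) In a tubular neighborhood $U\cong Z\times(-\delta,\delta)$ of $Z$, in which $x$ is the normal coordinate and $\pi:U\to Z$ is the projection, $\omega$ has a Laurent series $$\omega=\Big(\sum_{j=0}^{2k}x^j\alpha_j\Big)\wedge\frac{dx}{x^{2k+1}}+\beta,\qquad \alpha_j=\pi^*\hat\alpha_j,$$ with smooth closed one-forms $\hat\alpha_j$ on $Z$ and a smooth two-form $\beta$ on $U$. (2) Let such a tubular neighborhood and Laurent series be given. Let $0<r<R$ and let $f\in C^\infty(\mathbb R)$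 be even, with $f'(t)>0$ for $t<0$, $f(t)=-t^2+2$ for $|t|\le r$, and, for $|t|>R$, $f(t)=-\log|t|$ if $k=0$ and $f(t)=\frac{1}{2k\,t^{2k}}$ if $k>0$. Put $f_\epsilon(t)=\epsilon^{-2k}f(t/\epsilon)$, and let $\omega_\epsilon$ be the two-form on $M$ which equals $$\omega_\epsilon=d(f_\epsilon\circ x)\wedge\Big(\sum_{j=0}^{2k}x^j\alpha_j\Big)+\beta$$ on $U$ and $\omega$ on $M\setminus U$. Then there is $\epsilon_0>0$ such that for all $0<\epsilon<\epsilon_0$: (a) $\omega_\epsilon$ is a folded symplectic form: it is smooth and closed, $\omega_\epsilon^n$ is transverse to the zero section of $\Lambda^{2n}T^*M$, and the restriction of $\omega_\epsilon^{n-1}$ to the hypersurface $\{\omega_\epsilon^n=0\}$ is nowhere zero; (b) $(i^*\omega_\epsilon)^{n-1}$ is nowhere zero on $Z$; (c) $\omega_\epsilon=\omega$ on $\{|x|\ge R\epsilon\}$, that is, outside the $R\epsilon$-neighborhood of $Z$ (the $\epsilon$-neighborhood if $R=1$). -/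

import Mathlib

open Set
open scoped Manifold ContDiff

noncomputable section

namespace BSymplectic

section LinearAlgebra

variable {V W : Type*} [AddCommGroup V] [Module ℝ V] [TopologicalSpace V]
  [AddCommGroup W] [Module ℝ W] [TopologicalSpace W]

/-- The `2n`-linear form `v ↦ ∏ j, w (v (j, 0), v (j, 1))`, whose `2n` arguments are indexed
by `Fin n × Fin 2`. -/
def tensorPow (n : ℕ) (w : V [⋀^Fin 2]→L[ℝ] ℝ) :
    ContinuousMultilinearMap ℝ (fun _ : Fin n × Fin 2 => V) ℝ where
  toFun v := ∏ j : Fin n, w (fun b => v (j, b))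
  map_update_add' := by
    intro _ v a u u'
    obtain ⟨j, b⟩ := a
    obtain rfl : ‹DecidableEq (Fin n × Fin 2)› = instDecidableEqProd := Subsingleton.elim _ _
    have key : ∀ (t : V) (l : Fin n), (fun c => Function.update v (j, b) t (l, c)) =
        if l = j then Function.update (fun c => v (j, c)) b t else fun c => v (l, c) := by
      intro t l
      split_ifs with h
      · subst h; funext c; simp [Function.update_apply]
      · funext c; simp [h]
    simp only [key]
    rw [← Finset.mul_prod_erase _ _ (Finset.mem_univ j),
      ← Finset.mul_prod_erase _ _ (Finset.mem_univ j),
      ← Finset.mul_prod_erase _ _ (Finset.mem_univ j)]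
    have e : ∀ t : V, ∏ l ∈ Finset.univ.erase j,
        w (if l = j then Function.update (fun c => v (j, c)) b t else fun c => v (l, c)) =
        ∏ l ∈ Finset.univ.erase j, w (fun c => v (l, c)) := by
      intro t
      refine Finset.prod_congr rfl fun l hl => ?_
      rw [if_neg (Finset.ne_of_mem_erase hl)]
    simp only [e, if_true, ContinuousAlternatingMap.map_update_add, add_mul]
  map_update_smul' := by
    intro _ v a r u
    obtain ⟨j, b⟩ := a
    obtain rfl : ‹DecidableEq (Fin n × Fin 2)› = instDecidableEqProd := Subsingleton.elim _ _
    have key : ∀ (t : V) (l : Fin n), (fun c => Function.update v (j, b) t (l, c)) =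
        if l = j then Function.update (fun c => v (j, c)) b t else fun c => v (l, c) := by
      intro t l
      split_ifs with h
      · subst h; funext c; simp [Function.update_apply]
      · funext c; simp [h]
    simp only [key]
    rw [← Finset.mul_prod_erase _ _ (Finset.mem_univ j),
      ← Finset.mul_prod_erase _ _ (Finset.mem_univ j)]
    have e : ∀ t : V, ∏ l ∈ Finset.univ.erase j,
        w (if l = j then Function.update (fun c => v (j, c)) b t else fun c => v (l, c)) =
        ∏ l ∈ Finset.univ.erase j, w (fun c => v (l, c)) := by
      intro t
      refine Finset.prod_congr rfl fun l hl => ?_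
      rw [if_neg (Finset.ne_of_mem_erase hl)]
    simp only [e, if_true, ContinuousAlternatingMap.map_update_smul, smul_eq_mul, mul_assoc]
  cont := by
    refine continuous_finsetProd _ fun j _ => ?_
    exact w.cont.comp (continuous_pi fun b => continuous_apply (j, b))

/-- The `n`-th exterior power `w ∧ ⋯ ∧ w` of a `2`-form; see `wedgePow_apply`. -/
def wedgePow (n : ℕ) (w : V [⋀^Fin 2]→L[ℝ] ℝ) : V [⋀^(Fin n × Fin 2)]→L[ℝ] ℝ :=
  ((2 : ℝ) ^ n)⁻¹ • ContinuousMultilinearMap.alternatization (tensorPow n w)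

theorem wedgePow_apply (n : ℕ) (w : V [⋀^Fin 2]→L[ℝ] ℝ) (v : Fin n × Fin 2 → V) :
    wedgePow n w v = ((2 : ℝ) ^ n)⁻¹ * ∑ σ : Equiv.Perm (Fin n × Fin 2),
      ((Equiv.Perm.sign σ : ℤ) : ℝ) * ∏ j : Fin n, w ![v (σ (j, 0)), v (σ (j, 1))] := by
  have h : ∀ σ : Equiv.Perm (Fin n × Fin 2), ∀ j : Fin n,
      (fun b => (v ∘ σ) (j, b)) = ![v (σ (j, 0)), v (σ (j, 1))] := by
    intro σ j; funext b; fin_cases b <;> rfl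
  simp only [wedgePow, ContinuousAlternatingMap.smul_apply,
    ContinuousMultilinearMap.alternatization_apply_apply, smul_eq_mul]
  congr 1
  refine Finset.sum_congr rfl fun σ _ => ?_
  change Equiv.Perm.sign σ • ∏ j : Fin n, w (fun b => (v ∘ σ) (j, b)) = _
  simp only [h, Units.smul_def, zsmul_eq_mul]

/-- The wedge product of two covectors; see `wedge_apply`. -/
def wedge (a b : V [⋀^Fin 1]→L[ℝ] ℝ) : V [⋀^Fin 2]→L[ℝ] ℝ :=
  ContinuousMultilinearMap.alternatization
    { toFun := fun v : Fin 2 → V => a ![v 0] * b ![v 1]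
      map_update_add' := by
        intro _ v j u u'
        have ha : ∀ s t : V, a ![s + t] = a ![s] + a ![t] := fun s t => by
          
          have := a.map_update_add ![0] 0 s t
          simp only [Matrix.vecCons, Fin.update_cons_zero] at this
          exact this
        have hb : ∀ s t : V, b ![s + t] = b ![s] + b ![t] := fun s t => by
          
          have := b.map_update_add ![0] 0 s t
          simp only [Matrix.vecCons, Fin.update_cons_zero] at this
          exact this
        fin_cases j <;> simp [ha, hb] <;> ring
      map_update_smul' := by
        intro _ v j r u
        have ha : ∀ s : V, a ![r • s] = r * a ![s] := fun s => by
          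
          have := a.map_update_smul ![0] 0 r s
          simp only [Matrix.vecCons, Fin.update_cons_zero] at this
          exact this
        have hb : ∀ s : V, b ![r • s] = r * b ![s] := fun s => by
          
          have := b.map_update_smul ![0] 0 r s
          simp only [Matrix.vecCons, Fin.update_cons_zero] at this
          exact this
        fin_cases j <;> simp [ha, hb] <;> ring
      cont := by
        refine Continuous.mul (a.cont.comp ?_) (b.cont.comp ?_) <;>
        · refine continuous_pi fun j => ?_
          fin_cases j
          exact continuous_apply _ }

theorem wedge_apply (a b : V [⋀^Fin 1]→L[ℝ] ℝ) (v : Fin 2 → V) :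
    wedge a b v = a ![v 0] * b ![v 1] - a ![v 1] * b ![v 0] := by
  have h : (Finset.univ : Finset (Equiv.Perm (Fin 2))) = {1, Equiv.swap 0 1} := by decide
  rw [wedge, ContinuousMultilinearMap.alternatization_apply_apply, h,
    Finset.sum_pair (by decide)]
  have e : Equiv.Perm.sign (Equiv.swap (0 : Fin 2) 1) = -1 := Equiv.Perm.sign_swap (by decide)
  rw [e, Equiv.Perm.sign_one, one_smul, Units.neg_smul, one_smul, sub_eq_add_neg]
  rfl

/-- A continuous linear functional, seen as an alternating form of degree one. -/
def covector (l : V →L[ℝ] ℝ) : V [⋀^Fin 1]→L[ℝ] ℝ :=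
  ContinuousAlternatingMap.ofSubsingleton ℝ V ℝ 0 l

theorem covector_apply (l : V →L[ℝ] ℝ) (v : Fin 1 → V) : covector l v = l (v 0) := rfl


/-- Nondegeneracy of a bilinear form. -/
def Nondeg {X : Type*} [Zero X] (B : X → X → ℝ) : Prop :=
  ∀ u : X, (∀ v : X, B u v = 0) → u = 0

end LinearAlgebra

section Manifolds

variable {E : Type*} [NormedAddCommGroup E] [NormedSpace ℝ E]
  {F : Type*} [NormedAddCommGroup F] [NormedSpace ℝ F]
  {M : Type*} [TopologicalSpace M] [ChartedSpace E M]
  {Z : Type*} [TopologicalSpace Z] [ChartedSpace F Z]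

variable (E M) in
/-- Differential `k`-forms on the manifold `M`, modelled on `E`, with no regularity required. -/
abbrev DForm (k : ℕ) : Type _ :=
  ∀ p : M, TangentSpace 𝓘(ℝ, E) p [⋀^Fin k]→L[ℝ] ℝ

/-- The pullback `g^* a` of a form. -/
def pullback {k : ℕ} (g : M → Z) (a : DForm F Z k) : DForm E M k := fun p =>
  (a (g p)).compContinuousLinearMap (mfderiv 𝓘(ℝ, E) 𝓘(ℝ, F) g p)

/-- The expression of a form in the preferred chart `φ` at `p`, that is, the form
`(φ⁻¹)^* a` on the open set `φ.target` of `E`. -/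
def chartRep {k : ℕ} (a : DForm E M k) (p : M) : E → E [⋀^Fin k]→L[ℝ] ℝ :=
  pullback (M := E) (extChartAt 𝓘(ℝ, E) p).symm a

/-- The part of the domain of the preferred chart at `p` which corresponds to `S`. -/
def chartDom (S : Set M) (p : M) : Set E :=
  (extChartAt 𝓘(ℝ, E) p).target ∩ (extChartAt 𝓘(ℝ, E) p).symm ⁻¹' S

/-- The form `a` is smooth on the open set `S`. -/
def SmoothFormOn {k : ℕ} (a : DForm E M k) (S : Set M) : Prop :=
  ∀ p : M, ContDiffOn ℝ ∞ (chartRep a p) (chartDom S p)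

/-- The (smooth) form `a` is closed on the open set `S`. -/
def ClosedFormOn {k : ℕ} (a : DForm E M k) (S : Set M) : Prop :=
  ∀ p : M, ∀ y ∈ chartDom S p, extDeriv (chartRep a p) y = 0

/-- The differential of a function, as a form of degree one. -/
def dForm (g : M → ℝ) : DForm E M 1 := fun p =>
  covector (mfderiv 𝓘(ℝ, E) 𝓘(ℝ, ℝ) g p)

/-- `x` is a global defining function: it is smooth and `0` is a regular value. -/
def IsDefiningFunction (x : M → ℝ) : Prop :=
  ContMDiff 𝓘(ℝ, E) 𝓘(ℝ, ℝ) ∞ x ∧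
    ∀ p, x p = 0 → Function.Surjective (mfderiv 𝓘(ℝ, E) 𝓘(ℝ, ℝ) x p)

/-- The form `a ∧ dx / x ^ m + b`, off the hypersurface `{x = 0}`. -/
def bValue (m : ℕ) (x : M → ℝ) (a : DForm E M 1) (b : DForm E M 2) : DForm E M 2 := fun p =>
  wedge (a p) ((x p ^ m)⁻¹ • dForm x p) + b p

/-- The value at a point `p` of the hypersurface of the `b^m`-form `a ∧ dx / x ^ m + b`,
as a bilinear form on the fiber `T_p Z ⊕ ⟨x ^ m ∂/∂x⟩` of the `b^m`-tangent bundle; here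
`T_p Z = ker dx`, the pair `(u, s)` stands for `u + s x ^ m ∂/∂x`, and the covector `dx / x ^ m`
takes the value `s` on it, while the smooth forms `a` and `b` do not see `x ^ m ∂/∂x`. -/
def bValueOnZ (x : M → ℝ) (a : DForm E M 1) (b : DForm E M 2) (p : M)
    (X Y : (mfderiv 𝓘(ℝ, E) 𝓘(ℝ, ℝ) x p).ker × ℝ) : ℝ :=
  a p ![(X.1 : TangentSpace 𝓘(ℝ, E) p)] * Y.2 - a p ![(Y.1 : TangentSpace 𝓘(ℝ, E) p)] * X.2 +
    b p ![(X.1 : TangentSpace 𝓘(ℝ, E) p), (Y.1 : TangentSpace 𝓘(ℝ, E) p)]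

/-- `w` is a `b^m`-symplectic form on `(M, {x = 0}, x)`: a closed `b^m`-form of degree two, that
is, `w = a ∧ dx / x ^ m + b` with smooth `a` and `b`, which has maximal rank at every point, as a
form on the `b^m`-tangent bundle. A `b^m`-form is determined by its restriction to `{x ≠ 0}`, and
the values of `w` on `{x = 0}` have no meaning. -/
def IsBSymplectic (m : ℕ) (x : M → ℝ) (w : DForm E M 2) : Prop :=
  ClosedFormOn w {p | x p ≠ 0} ∧
  (∀ p, x p ≠ 0 → Nondeg fun u v : TangentSpace 𝓘(ℝ, E) p => w p ![u, v]) ∧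
  ∃ (a : DForm E M 1) (b : DForm E M 2), SmoothFormOn a univ ∧ SmoothFormOn b univ ∧
    (∀ p, x p ≠ 0 → w p = bValue m x a b p) ∧
    ∀ p, x p = 0 → Nondeg (bValueOnZ x a b p)

/-- A tubular neighborhood of `{x = 0}`, parametrized by `i : Z → M`, in which `x` is the normal
coordinate: a diffeomorphism of `Z × (-δ, δ)` onto an open set of `M`. -/
structure Tube (i : Z → M) (x : M → ℝ) where
  δ : ℝ
  δ_pos : 0 < δ
  Φ : OpenPartialHomeomorph (Z × ℝ) M
  source_eq : Φ.source = univ ×ˢ Ioo (-δ) δ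
  contMDiffOn : ContMDiffOn (𝓘(ℝ, F).prod 𝓘(ℝ, ℝ)) 𝓘(ℝ, E) ∞ Φ Φ.source
  contMDiffOn_symm : ContMDiffOn 𝓘(ℝ, E) (𝓘(ℝ, F).prod 𝓘(ℝ, ℝ)) ∞ Φ.symm Φ.target
  apply_zero : ∀ z, Φ (z, 0) = i z
  normal_coord : ∀ z, ∀ t ∈ Ioo (-δ) δ, x (Φ (z, t)) = t

variable {i : Z → M} {x : M → ℝ}

/-- The tubular neighborhood as a subset of `M`. -/
def Tube.nbhd (T : Tube (E := E) (F := F) i x) : Set M := T.Φ.target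

/-- The projection of the tubular neighborhood onto the hypersurface. -/
def Tube.proj (T : Tube (E := E) (F := F) i x) : M → Z := fun p => (T.Φ.symm p).1

/-- The form `∑ j < m, x ^ j π^* (a j)` on a tubular neighborhood. -/
def laurentSum {m : ℕ} (T : Tube (E := E) (F := F) i x) (a : Fin m → DForm F Z 1) :
    DForm E M 1 := fun p => ∑ j : Fin m, x p ^ (j : ℕ) • pullback T.proj (a j) p

/-- The closed one-forms `a 0, …, a (m - 1)` on the hypersurface and the two-form `b` on the
tubular neighborhood are a Laurent series `w = (∑ j < m, x ^ j π^* (a j)) ∧ dx / x ^ m + b`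
of the `b^m`-form `w`. -/
def IsLaurentSeries {m : ℕ} (T : Tube (E := E) (F := F) i x) (w : DForm E M 2)
    (a : Fin m → DForm F Z 1) (b : DForm E M 2) : Prop :=
  (∀ j, SmoothFormOn (a j) univ ∧ ClosedFormOn (a j) univ) ∧
  SmoothFormOn b T.nbhd ∧
  ∀ p ∈ T.nbhd, x p ≠ 0 → w p = bValue m x (laurentSum T a) b p

/-- The functions `f` used for a `b^{2k+1}`-form. -/
structure IsFoldingProfile (k : ℕ) (r R : ℝ) (f : ℝ → ℝ) : Prop where
  smooth : ContDiff ℝ ∞ f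
  even : ∀ t, f (-t) = f t
  deriv_pos : ∀ t, t < 0 → 0 < deriv f t
  inner : ∀ t, |t| ≤ r → f t = -t ^ 2 + 2
  outer_zero : k = 0 → ∀ t, R < |t| → f t = -Real.log |t|
  outer_pos : 0 < k → ∀ t, R < |t| → f t = 1 / (2 * k * t ^ (2 * k))

/-- The rescaled function `f_ε (t) = ε ^ (-2k) f (t / ε)`. -/
def rescale (k : ℕ) (f : ℝ → ℝ) (ε : ℝ) : ℝ → ℝ := fun t => (ε ^ (2 * k))⁻¹ * f (t / ε)

open Classical in
/-- The desingularization `w_ε`: it is `d f_ε(x) ∧ (∑ j, x ^ j π^* (a j)) + b` on the tubular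
neighborhood, and `w` elsewhere. -/
def desing (k : ℕ) (T : Tube (E := E) (F := F) i x) (w : DForm E M 2)
    (a : Fin (2 * k + 1) → DForm F Z 1) (b : DForm E M 2) (f : ℝ → ℝ) (ε : ℝ) :
    DForm E M 2 := fun p =>
  if p ∈ T.nbhd then wedge (dForm (fun q => rescale k f ε (x q)) p) (laurentSum T a p) + b p
  else w p

/-- The expression of the top form `w^n` in the preferred chart at `p`; the values are in the
line of alternating `2n`-forms on `E`. -/
def topRep (n : ℕ) (w : DForm E M 2) (p : M) : E → E [⋀^(Fin n × Fin 2)]→L[ℝ] ℝ :=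
  fun y => wedgePow n (chartRep w p y)

/-- `w^n` is transverse to the zero section of `Λ^{2n} T^*M`: at every zero, the derivative of its
expression in the chart (a trivialization of the line bundle) is onto the fiber. -/
def TransverseToZero (n : ℕ) (w : DForm E M 2) : Prop :=
  ∀ p, wedgePow n (w p) = 0 →
    Function.Surjective (fderiv ℝ (topRep n w p) (extChartAt 𝓘(ℝ, E) p p))

/-- `w` is a folded symplectic form on the `2n`-dimensional manifold `M`: it is smooth and closed,
`w^n` is transverse to the zero section, and the restriction of `w^{n-1}` to the hypersurface
`{w^n = 0}` vanishes nowhere. In the chart at `p`, the tangent space to this hypersurface is the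
kernel of the derivative of `w^n`. -/
def IsFoldedSymplectic (n : ℕ) (w : DForm E M 2) : Prop :=
  SmoothFormOn w univ ∧ ClosedFormOn w univ ∧ TransverseToZero n w ∧
  ∀ p, wedgePow n (w p) = 0 →
    wedgePow (n - 1) ((chartRep w p (extChartAt 𝓘(ℝ, E) p p)).compContinuousLinearMap
      (fderiv ℝ (topRep n w p) (extChartAt 𝓘(ℝ, E) p p)).ker.subtypeL) ≠ 0

end Manifolds

end BSymplectic

end

/-! In tube coordinates (y, t) write A = ∑ t^j α_j and h = f_ε'(t), so that ω_ε = h dt ∧ A + β. The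
folding statements come from the way the top power depends on h.

Evaluated on a basis adapted to F × ℝ, the top power is h C + D, where C comes from dt ∧ A + β|slice
and D from β (`wedgePow_foldForm_linear`). Maximal rank of ω along Z makes dt ∧ A + β|slice
nondegenerate at t = 0 (`IsLaurentSeries.nondeg`), so C is nonzero near Z, and the (n-1)-st power of
β|slice is nonzero on Z (`wedgePow_pred_ne_zero_of_foldForm`). The latter is (b), because f_ε'(0) =
0.

A zero of h C + D forces |h| ≤ |D / C|, which is bounded near Z. For rε ≤ |t| ≤ Rε the size of h is
at least of order ε^-(2k+1), so there is no zero once ε is small. For |t| < rε one has h = -2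
ε^-(2k+2) t, whose derivative is huge, so the term h' C dt dominates the differential of h C + D:
the zero is transverse, the tangent space to the fold is the graph of a small functional on F, and
ω_ε restricted to it is close to β|slice. `eventually_folded` is the quantitative form of this near
one point; compactness of Z gives a common ε₀. For |t| ≥ Rε, h = -t^-(2k+1) and ω_ε = ω. Closedness
holds because h(t) dt ∧ A is closed for every h when the α_j are closed, and β is closed off Z as a
difference of closed forms, hence on Z by continuity.

For (1), a tube is obtained by inverting (ρ, x), where ρ is a smooth retraction of a neighborhood
onto Z (`exists_retraction`, `exists_tube`). The dx-component of α is killed by dx; its restriction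
to the slices is expanded in t by iterating Hadamard's lemma, and the remainder, divisible by t^m,
goes into β (`Tube.exists_isLaurentSeries`). The equation dω = 0 then reads ∑ t^j dα_j = O(t^m) with
j < m, so every dα_j vanishes. -/

namespace BSymplectic

/-! ### Alternating forms of low degree, argument by argument -/

section LinearAlgebra

variable {V W : Type*} [AddCommGroup V] [Module ℝ V] [TopologicalSpace V]
  [AddCommGroup W] [Module ℝ W] [TopologicalSpace W]

theorem comp_pair (w : W [⋀^Fin 2]→L[ℝ] ℝ) (L : V →L[ℝ] W) (u v : V) :
    w.compContinuousLinearMap L ![u, v] = w ![L u, L v] := by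
  rw [ContinuousAlternatingMap.compContinuousLinearMap_apply]
  congr 1
  funext j
  fin_cases j <;> rfl

theorem comp_single (w : W [⋀^Fin 1]→L[ℝ] ℝ) (L : V →L[ℝ] W) (u : V) :
    w.compContinuousLinearMap L ![u] = w ![L u] := by
  rw [ContinuousAlternatingMap.compContinuousLinearMap_apply]
  congr 1
  funext j
  fin_cases j
  rfl

theorem wedgePow_comp (n : ℕ) (w : W [⋀^Fin 2]→L[ℝ] ℝ) (L : V →L[ℝ] W) :
    wedgePow n (w.compContinuousLinearMap L) = (wedgePow n w).compContinuousLinearMap L := by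
  ext v
  rw [ContinuousAlternatingMap.compContinuousLinearMap_apply, wedgePow_apply, wedgePow_apply]
  simp only [comp_pair, Function.comp_apply]

theorem wedge_comp (a b : W [⋀^Fin 1]→L[ℝ] ℝ) (L : V →L[ℝ] W) :
    (wedge a b).compContinuousLinearMap L =
      wedge (a.compContinuousLinearMap L) (b.compContinuousLinearMap L) := by
  ext v
  rw [ContinuousAlternatingMap.compContinuousLinearMap_apply, wedge_apply, wedge_apply]
  simp only [comp_single, Function.comp_apply]

theorem wedge_pair (a b : V [⋀^Fin 1]→L[ℝ] ℝ) (u v : V) :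
    wedge a b ![u, v] = a ![u] * b ![v] - a ![v] * b ![u] := by
  rw [wedge_apply]; rfl

theorem ext_pair {w w' : V [⋀^Fin 2]→L[ℝ] ℝ} (h : ∀ u v, w ![u, v] = w' ![u, v]) : w = w' := by
  ext v
  have : v = ![v 0, v 1] := by funext j; fin_cases j <;> rfl
  rw [this, h]

theorem ext_single {w w' : V [⋀^Fin 1]→L[ℝ] ℝ} (h : ∀ u, w ![u] = w' ![u]) : w = w' := by
  ext v
  have : v = ![v 0] := by funext j; fin_cases j; rfl
  rw [this, h]

theorem single_add (w : V [⋀^Fin 1]→L[ℝ] ℝ) (u v : V) : w ![u + v] = w ![u] + w ![v] := by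
  have := w.map_update_add ![0] 0 u v
  simpa only [Matrix.vecCons, Fin.update_cons_zero] using this

theorem single_smul (w : V [⋀^Fin 1]→L[ℝ] ℝ) (r : ℝ) (u : V) : w ![r • u] = r * w ![u] := by
  have := w.map_update_smul ![0] 0 r u
  simpa only [Matrix.vecCons, Fin.update_cons_zero, smul_eq_mul] using this

theorem pair_add_left (w : V [⋀^Fin 2]→L[ℝ] ℝ) (u u' v : V) :
    w ![u + u', v] = w ![u, v] + w ![u', v] := by
  have := w.map_update_add ![0, v] 0 u u'
  simpa only [Matrix.vecCons, Fin.update_cons_zero] using this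

theorem pair_smul_left (w : V [⋀^Fin 2]→L[ℝ] ℝ) (r : ℝ) (u v : V) :
    w ![r • u, v] = r * w ![u, v] := by
  have := w.map_update_smul ![0, v] 0 r u
  simpa only [Matrix.vecCons, Fin.update_cons_zero, smul_eq_mul] using this

theorem pair_self (w : V [⋀^Fin 2]→L[ℝ] ℝ) (u : V) : w ![u, u] = 0 :=
  w.map_eq_zero_of_eq ![u, u] (i := 0) (j := 1) rfl (by decide)

theorem pair_swap (w : V [⋀^Fin 2]→L[ℝ] ℝ) (u v : V) : w ![u, v] = -w ![v, u] := by
  have := w.map_swap ![v, u] (i := 0) (j := 1) (by decide)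
  refine Eq.trans ?_ this
  change w _ = w _
  congr 1
  funext j
  fin_cases j <;> rfl

theorem pair_add_right (w : V [⋀^Fin 2]→L[ℝ] ℝ) (u v v' : V) :
    w ![u, v + v'] = w ![u, v] + w ![u, v'] := by
  rw [pair_swap, pair_add_left, pair_swap w v, pair_swap w v']; ring

theorem pair_smul_right (w : V [⋀^Fin 2]→L[ℝ] ℝ) (r : ℝ) (u v : V) :
    w ![u, r • v] = r * w ![u, v] := by
  rw [pair_swap, pair_smul_left, pair_swap w v]; ring

/-- The bilinear form underlying an alternating form of degree two. -/
def toBilin (w : V [⋀^Fin 2]→L[ℝ] ℝ) : LinearMap.BilinForm ℝ V :=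
  LinearMap.mk₂ ℝ (fun u v => w ![u, v]) (pair_add_left w) (pair_smul_left w) (pair_add_right w)
    (pair_smul_right w)

theorem toBilin_apply (w : V [⋀^Fin 2]→L[ℝ] ℝ) (u v : V) : toBilin w u v = w ![u, v] := rfl

end LinearAlgebra

/-! ### Darboux families and nonvanishing of powers of a nondegenerate two-form -/

section Darboux

/-- The values of a symplectic form on a Darboux family. -/
def darbouxMatrix {n : ℕ} (x y : Fin n × Fin 2) : ℝ :=
  if x.1 = y.1 then (if x.2 = y.2 then 0 else if x.2 = 0 then 1 else -1) else 0

/-- Symplectic Gram–Schmidt: split off a hyperbolic pair u, v and pass to its orthogonal complement,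
on which B stays nondegenerate and whose dimension drops by at most two. An inequality on the
dimension suffices, which serves later for a hyperplane. -/
theorem exists_darboux (n : ℕ) : ∀ {V : Type*} [AddCommGroup V] [Module ℝ V]
    [FiniteDimensional ℝ V] (B : LinearMap.BilinForm ℝ V), (∀ u, B u u = 0) →
    (∀ u, (∀ v, B u v = 0) → u = 0) → 2 * n ≤ Module.finrank ℝ V →
    ∃ e : Fin n × Fin 2 → V, ∀ x y, B (e x) (e y) = darbouxMatrix x y := by
  induction n with
  | zero => intro V _ _ _ B _ _ _; exact ⟨fun x => x.1.elim0, fun x => x.1.elim0⟩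
  | succ n ih =>
    intro V _ _ _ B hB hN hd
    have hsw : ∀ u v, B u v = -B v u := by
      intro u v
      have := hB (u + v)
      simp only [map_add, LinearMap.add_apply, hB] at this
      linarith
    have : Nontrivial V := Module.nontrivial_of_finrank_pos (R := ℝ) (by omega)
    obtain ⟨u, hu⟩ := exists_ne (0 : V)
    obtain ⟨v', hv'⟩ : ∃ v, B u v ≠ 0 := by
      by_contra! h
      exact hu (hN u h)
    set v := (B u v')⁻¹ • v' with hv
    have huv : B u v = 1 := by simp [hv, hv']
    have hvu : B v u = -1 := by rw [hsw, huv]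
    set P : V →ₗ[ℝ] ℝ × ℝ := (B u).prod (B v) with hP
    set W := LinearMap.ker P with hW
    have hmem : ∀ x, x ∈ W ↔ B u x = 0 ∧ B v x = 0 := by
      intro x; simp [hW, hP, LinearMap.mem_ker]
    have hrank : 2 * n ≤ Module.finrank ℝ W := by
      have h1 := LinearMap.finrank_range_add_finrank_ker P
      have h2 : Module.finrank ℝ (LinearMap.range P) ≤ Module.finrank ℝ (ℝ × ℝ) :=
        Submodule.finrank_le _
      have h3 : Module.finrank ℝ (ℝ × ℝ) = 2 := by simp
      change 2 * n ≤ Module.finrank ℝ (LinearMap.ker P)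
      omega
    obtain ⟨e, he⟩ := ih (B.restrict W) (fun x => hB x) (by
      intro x hx
      have : (x : V) = 0 := by
        apply hN
        intro y
        -- This is the projection of y to W along the span of u and v. A vector of W orthogonal to W
        -- is thus orthogonal to every y.
        have hy : y + B v y • u - B u y • v ∈ W := by
          rw [hmem]
          simp [hB, huv, hvu]
        have h0 := hx ⟨_, hy⟩
        obtain ⟨hx1, hx2⟩ := (hmem x).1 x.2
        rw [hsw] at hx1 hx2
        simp only [LinearMap.BilinForm.restrict_apply, LinearMap.domRestrict_apply, map_add, map_sub, map_smul,
          smul_eq_mul] at h0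
        have e1 : B x u = 0 := by linarith
        have e2 : B x v = 0 := by linarith
        rw [e1, e2] at h0
        linarith
      exact Subtype.ext this) hrank
    have heu : ∀ x, B u (e x) = 0 := fun x => ((hmem _).1 (e x).2).1
    have hev : ∀ x, B v (e x) = 0 := fun x => ((hmem _).1 (e x).2).2
    have heu' : ∀ x, B (e x) u = 0 := fun x => by rw [hsw, heu, neg_zero]
    have hev' : ∀ x, B (e x) v = 0 := fun x => by rw [hsw, hev, neg_zero]
    have he' : ∀ x y, B (e x) (e y) = darbouxMatrix x y := he
    refine ⟨fun x => Fin.cases (motive := fun _ => V) (if x.2 = 0 then u else v)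
      (fun j => e (j, x.2)) x.1, ?_⟩
    rintro ⟨i, a⟩ ⟨j, b⟩
    refine Fin.cases ?_ (fun i => ?_) i <;> refine Fin.cases ?_ (fun j => ?_) j
    · fin_cases a <;> fin_cases b <;> simp [darbouxMatrix, hB, huv, hvu]
    · fin_cases a <;> simp [darbouxMatrix, heu, hev, (Fin.succ_ne_zero j).symm]
    · fin_cases b <;> simp [darbouxMatrix, heu', hev', Fin.succ_ne_zero i]
    · simp [darbouxMatrix, he', Fin.succ_inj]

theorem darbouxMatrix_perm {n : ℕ} (i : Fin n) (φ : Equiv.Perm (Fin 2)) :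
    darbouxMatrix (i, φ 0) (i, φ 1) = ((Equiv.Perm.sign φ : ℤ) : ℝ) := by
  have h : ∀ φ : Equiv.Perm (Fin 2), φ = 1 ∨ φ = Equiv.swap 0 1 := by decide
  rcases h φ with rfl | rfl
  · simp [darbouxMatrix]
  · rw [Equiv.Perm.sign_swap (by decide)]
    simp [darbouxMatrix]

/-- A nonzero term requires σ to carry each pair {(j, 0), (j, 1)} to a pair, so σ is a permutation φ
j inside each pair followed by a permutation τ of the pairs. As τ acts on both members, it
contributes sign(τ)² = 1; the sign of σ and the product of matrix entries are both ∏ sign (φ j), and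
the term is a square. -/
theorem sign_mul_prod_darbouxMatrix_nonneg {n : ℕ} (σ : Equiv.Perm (Fin n × Fin 2)) :
    0 ≤ ((Equiv.Perm.sign σ : ℤ) : ℝ) *
      ∏ j : Fin n, darbouxMatrix (σ (j, 0)) (σ (j, 1)) := by
  by_cases h0 : ∏ j : Fin n, darbouxMatrix (σ (j, 0)) (σ (j, 1)) = 0
  · simp [h0]
  have hb : ∀ j, (σ (j, 0)).1 = (σ (j, 1)).1 := by
    intro j
    by_contra hne
    refine h0 (Finset.prod_eq_zero (Finset.mem_univ j) ?_)
    simp [darbouxMatrix, hne]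
  have hb' : ∀ j b, (σ (j, b)).1 = (σ (j, 0)).1 := by
    intro j b
    fin_cases b
    · rfl
    · exact (hb j).symm
  have hφ : ∀ j, Function.Injective fun b => (σ (j, b)).2 := by
    intro j b b' hbb
    have : σ (j, b) = σ (j, b') := Prod.ext ((hb' j b).trans (hb' j b').symm) hbb
    exact (Prod.mk.inj (σ.injective this)).2
  set φ : Fin n → Equiv.Perm (Fin 2) := fun j =>
    Equiv.ofBijective _ (Finite.injective_iff_bijective.1 (hφ j)) with hφdef
  have hτ : Function.Injective fun j => (σ (j, 0)).1 := by
    intro j j' hjj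
    obtain ⟨b, hb2⟩ := (φ j).surjective (σ (j', 0)).2
    have : σ (j, b) = σ (j', 0) := Prod.ext ((hb' j b).trans hjj) hb2
    exact (Prod.mk.inj (σ.injective this)).1
  set τ : Equiv.Perm (Fin n) := Equiv.ofBijective _ (Finite.injective_iff_bijective.1 hτ)
    with hτdef
  have hσ : σ = (Equiv.prodCongrRight φ).trans (Equiv.prodCongrLeft fun _ => τ) := by
    ext1 ⟨j, b⟩
    exact Prod.ext (hb' j b) rfl
  have hs : ((Equiv.Perm.sign σ : ℤ) : ℝ) = ∏ j, ((Equiv.Perm.sign (φ j) : ℤ) : ℝ) := by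
    rw [hσ, Equiv.Perm.sign_trans, Equiv.Perm.sign_prodCongrRight, Equiv.Perm.sign_prodCongrLeft]
    simp
  have hp : ∀ j, darbouxMatrix (σ (j, 0)) (σ (j, 1)) = ((Equiv.Perm.sign (φ j) : ℤ) : ℝ) := by
    intro j
    rw [← darbouxMatrix_perm (τ j) (φ j)]
    congr 1
    exact Prod.ext (hb' j 1) rfl
  rw [hs, Finset.prod_congr rfl fun j _ => hp j]
  exact mul_self_nonneg _

/-- On a Darboux family no cancellation can occur in the sum over permutations: all terms are
nonnegative and the identity contributes 1. -/
theorem wedgePow_ne_zero {V : Type*} [AddCommGroup V] [Module ℝ V] [TopologicalSpace V]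
    [FiniteDimensional ℝ V] {n : ℕ} (w : V [⋀^Fin 2]→L[ℝ] ℝ)
    (hw : Nondeg fun u v : V => w ![u, v]) (hn : 2 * n ≤ Module.finrank ℝ V) :
    wedgePow n w ≠ 0 := by
  obtain ⟨e, he⟩ := exists_darboux n (toBilin w) (pair_self w) hw hn
  intro h0
  have h1 : wedgePow n w e = 0 := by rw [h0]; rfl
  rw [wedgePow_apply] at h1
  simp only [← toBilin_apply, he] at h1
  have h2 : 0 < ∑ σ : Equiv.Perm (Fin n × Fin 2), ((Equiv.Perm.sign σ : ℤ) : ℝ) *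
      ∏ j : Fin n, darbouxMatrix (σ (j, 0)) (σ (j, 1)) := by
    refine Finset.sum_pos' (fun σ _ => sign_mul_prod_darbouxMatrix_nonneg σ)
      ⟨1, Finset.mem_univ _, ?_⟩
    simp [darbouxMatrix]
  have h3 : (0 : ℝ) < ((2 : ℝ) ^ n)⁻¹ := by positivity
  exact (mul_pos h3 h2).ne' h1

end Darboux

/-! ### Linear algebra of dt ∧ A + B on F × ℝ -/

section FoldForm

variable {F : Type*} [NormedAddCommGroup F] [NormedSpace ℝ F]

/-- The two-form `dt ∧ A + B` on `F × ℝ`. -/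
noncomputable def foldForm (A : F [⋀^Fin 1]→L[ℝ] ℝ) (B : F [⋀^Fin 2]→L[ℝ] ℝ) :
    (F × ℝ) [⋀^Fin 2]→L[ℝ] ℝ :=
  wedge (covector (ContinuousLinearMap.snd ℝ F ℝ))
    (A.compContinuousLinearMap (ContinuousLinearMap.fst ℝ F ℝ)) +
  B.compContinuousLinearMap (ContinuousLinearMap.fst ℝ F ℝ)

theorem foldForm_pair (A : F [⋀^Fin 1]→L[ℝ] ℝ) (B : F [⋀^Fin 2]→L[ℝ] ℝ) (X Y : F × ℝ) :
    foldForm A B ![X, Y] = X.2 * A ![Y.1] - Y.2 * A ![X.1] + B ![X.1, Y.1] := by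
  rw [foldForm, ContinuousAlternatingMap.add_apply, wedge_pair, comp_pair, comp_single,
    comp_single, covector_apply, covector_apply]
  rfl

/-- The one-form `ι_{∂/∂t} w` on `F`. -/
noncomputable def contractLast (w : (F × ℝ) [⋀^Fin 2]→L[ℝ] ℝ) : F [⋀^Fin 1]→L[ℝ] ℝ :=
  (w.curryLeft (0, 1)).compContinuousLinearMap (ContinuousLinearMap.inl ℝ F ℝ)

theorem contractLast_single (w : (F × ℝ) [⋀^Fin 2]→L[ℝ] ℝ) (u : F) :
    contractLast w ![u] = w ![(0, 1), (u, 0)] := by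
  rw [contractLast, comp_single]; rfl

/-- Every two-form on the product splits into its contraction with ∂/∂t and its restriction to F. -/
theorem foldForm_contractLast (w : (F × ℝ) [⋀^Fin 2]→L[ℝ] ℝ) :
    foldForm (contractLast w) (w.compContinuousLinearMap (ContinuousLinearMap.inl ℝ F ℝ)) = w := by
  refine ext_pair fun X Y => ?_
  have h : ∀ X : F × ℝ, X = (X.1, 0) + X.2 • ((0 : F), (1 : ℝ)) := fun X => by ext <;> simp
  rw [foldForm_pair, contractLast_single, contractLast_single, comp_pair]
  conv_rhs => rw [h X, h Y]
  simp only [pair_add_left, pair_add_right, pair_smul_left, pair_smul_right, pair_self,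
    ContinuousLinearMap.inl_apply]
  rw [pair_swap w (X.1, 0) (0, 1)]
  ring

/-- Adding s dt ∧ A changes only the contraction with ∂/∂t, by s A; the restriction to F is
untouched. This brings h dt ∧ A + β into the form to which linearity in the first slot applies. -/
theorem smul_wedge_add_eq_foldForm (s : ℝ) (A : F [⋀^Fin 1]→L[ℝ] ℝ)
    (w : (F × ℝ) [⋀^Fin 2]→L[ℝ] ℝ) :
    s • wedge (covector (ContinuousLinearMap.snd ℝ F ℝ))
      (A.compContinuousLinearMap (ContinuousLinearMap.fst ℝ F ℝ)) + w =
    foldForm (s • A + contractLast w)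
      (w.compContinuousLinearMap (ContinuousLinearMap.inl ℝ F ℝ)) := by
  conv_lhs => rw [← foldForm_contractLast w]
  refine ext_pair fun X Y => ?_
  simp only [ContinuousAlternatingMap.add_apply, ContinuousAlternatingMap.smul_apply,
    foldForm_pair, wedge_pair, comp_single, covector_apply, smul_eq_mul]
  simp
  ring

/-- A basis of `F × ℝ` adapted to the product, indexed as the arguments of `wedgePow n`. -/
theorem exists_adapted_basis [FiniteDimensional ℝ F] (n : ℕ) (hF : Module.finrank ℝ F + 1 = 2 * n) :
    ∃ (e : Module.Basis (Fin n × Fin 2) ℝ (F × ℝ)) (j : Fin n × Fin 2),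
      e j = (0, 1) ∧ ∀ l, l ≠ j → (e l).2 = 0 := by
  let b := Module.finBasis ℝ F
  let b' : Module.Basis (Fin (Module.finrank ℝ F) ⊕ Unit) ℝ (F × ℝ) :=
    b.prod (Module.Basis.singleton Unit ℝ)
  have hc : Fintype.card (Fin (Module.finrank ℝ F) ⊕ Unit) = Fintype.card (Fin n × Fin 2) := by
    simp [hF, mul_comm]
  let q := Fintype.equivOfCardEq hc
  refine ⟨b'.reindex q, q (Sum.inr ()), ?_, ?_⟩
  · simp [b']
  · intro l hl
    obtain ⟨m, rfl⟩ := q.surjective l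
    rcases m with m | m
    · simp [b']
    · exact absurd rfl hl

/-- Scaling A by r is the pullback by (u, t) ↦ (u, r t), which fixes all vectors of an adapted basis
except ∂/∂t; multilinearity then yields a single factor r. -/
theorem wedgePow_foldForm_smul {n : ℕ} (e : Fin n × Fin 2 → F × ℝ) (j : Fin n × Fin 2)
    (hj : e j = (0, 1)) (hl : ∀ l, l ≠ j → (e l).2 = 0)
    (A : F [⋀^Fin 1]→L[ℝ] ℝ) (B : F [⋀^Fin 2]→L[ℝ] ℝ) (r : ℝ) :
    wedgePow n (foldForm (r • A) B) e = r * wedgePow n (foldForm A B) e := by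
  have h1 : foldForm (r • A) B = (foldForm A B).compContinuousLinearMap
      ((ContinuousLinearMap.fst ℝ F ℝ).prod (r • ContinuousLinearMap.snd ℝ F ℝ)) := by
    refine ext_pair fun X Y => ?_
    rw [comp_pair, foldForm_pair, foldForm_pair]
    simp
    ring
  rw [h1, wedgePow_comp, ContinuousAlternatingMap.compContinuousLinearMap_apply]
  have h2 : (⇑((ContinuousLinearMap.fst ℝ F ℝ).prod (r • ContinuousLinearMap.snd ℝ F ℝ)) ∘ e) =
      Function.update e j (r • e j) := by
    funext l
    by_cases h : l = j
    · subst h; simp [hj]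
    · simp only [Function.comp_apply, Function.update_of_ne h]
      ext <;> simp [hl l h]
  rw [h2, ContinuousAlternatingMap.map_update_smul, Function.update_eq_self, smul_eq_mul]

/-- Differentiate r ↦ q (r v) = r q v at r = 0. Homogeneity and differentiability at the origin thus
replace a combinatorial proof of additivity. -/
theorem eq_fderiv_of_homogeneous {X : Type*} [NormedAddCommGroup X] [NormedSpace ℝ X]
    {q : X → ℝ} (hq : DifferentiableAt ℝ q 0) (h : ∀ (r : ℝ) v, q (r • v) = r * q v) (v : X) :
    q v = fderiv ℝ q 0 v := by
  have h1 : HasDerivAt (fun r : ℝ => r • v) v 0 := by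
    simpa using (hasDerivAt_id (0 : ℝ)).smul_const v
  have h2 : HasDerivAt (fun r : ℝ => q (r • v)) (fderiv ℝ q 0 v) 0 := by
    have : HasFDerivAt q (fderiv ℝ q 0) ((0 : ℝ) • v) := by
      rw [zero_smul]; exact hq.hasFDerivAt
    exact this.comp_hasDerivAt (0 : ℝ) h1
  have h3 : HasDerivAt (fun r : ℝ => q (r • v)) (q v) 0 := by
    simp only [h]
    simpa using (hasDerivAt_id (0 : ℝ)).mul_const (q v)
  exact h3.unique h2

/-- The top power of `dt ∧ A + B` is linear in `A`. -/
theorem wedgePow_foldForm_linear {n : ℕ} (e : Fin n × Fin 2 → F × ℝ) (j : Fin n × Fin 2)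
    (hj : e j = (0, 1)) (hl : ∀ l, l ≠ j → (e l).2 = 0)
    (A C : F [⋀^Fin 1]→L[ℝ] ℝ) (B : F [⋀^Fin 2]→L[ℝ] ℝ) (s : ℝ) :
    wedgePow n (foldForm (s • A + C) B) e =
      s * wedgePow n (foldForm A B) e + wedgePow n (foldForm C B) e := by
  -- As a function of the two coefficients, the top power is a polynomial, and by the scaling lemma
  -- it is homogeneous of degree one; hence it is linear.
  set q : ℝ × ℝ → ℝ := fun v => wedgePow n (foldForm (v.1 • A + v.2 • C) B) e with hq
  have hd : DifferentiableAt ℝ q 0 := by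
    simp only [hq, wedgePow_apply, foldForm_pair, ContinuousAlternatingMap.add_apply,
      ContinuousAlternatingMap.smul_apply, smul_eq_mul]
    fun_prop
  have hh : ∀ (r : ℝ) v, q (r • v) = r * q v := by
    intro r v
    rw [hq]
    simp only
    rw [← wedgePow_foldForm_smul e j hj hl]
    simp [smul_add, smul_smul]
  have h1 : q (s, 1) = s * q (1, 0) + q (0, 1) := by
    rw [eq_fderiv_of_homogeneous hd hh (s, 1), eq_fderiv_of_homogeneous hd hh (1, 0),
      eq_fderiv_of_homogeneous hd hh (0, 1)]
    have : ((s, 1) : ℝ × ℝ) = s • (1, 0) + (0, 1) := by ext <;> simp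
    rw [this, map_add, map_smul, smul_eq_mul]
  simpa [hq] using h1

theorem wedgePow_foldForm_ne_zero [FiniteDimensional ℝ F] {n : ℕ}
    (hF : Module.finrank ℝ F + 1 = 2 * n) (A : F [⋀^Fin 1]→L[ℝ] ℝ) (B : F [⋀^Fin 2]→L[ℝ] ℝ)
    (h : Nondeg fun X Y : F × ℝ => foldForm A B ![X, Y]) : wedgePow n (foldForm A B) ≠ 0 :=
  wedgePow_ne_zero _ h (by simp [hF])

/-- Let X be the vector dual to dt under the nondegenerate form. Then X lies in F, A(X) = -1 and X
is in the kernel of B, so F is the sum of ℝX and ker A. A vector of ker A on which B vanishes along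
ker A is therefore B-orthogonal to F, hence zero: B is nondegenerate on ker A, whose dimension is at
least 2(n - 1). -/
theorem wedgePow_pred_ne_zero_of_foldForm [FiniteDimensional ℝ F] {n : ℕ}
    (hF : Module.finrank ℝ F + 1 = 2 * n) (A : F [⋀^Fin 1]→L[ℝ] ℝ) (B : F [⋀^Fin 2]→L[ℝ] ℝ)
    (h : Nondeg fun X Y : F × ℝ => foldForm A B ![X, Y]) : wedgePow (n - 1) B ≠ 0 := by
  let Al : F →ₗ[ℝ] ℝ :=
    { toFun := fun u => A ![u]
      map_add' := single_add A
      map_smul' := single_smul A }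
  have hAl : ∀ u, Al u = A ![u] := fun _ => rfl
  let Bf : LinearMap.BilinForm ℝ (F × ℝ) := toBilin (foldForm A B)
  have hker : LinearMap.ker Bf = ⊥ := by
    rw [Submodule.eq_bot_iff]
    intro u hu
    refine h u fun v => ?_
    exact LinearMap.congr_fun (LinearMap.mem_ker.1 hu) v
  have hinj : Function.Injective Bf := LinearMap.ker_eq_bot.1 hker
  have hsurj : Function.Surjective Bf :=
    (LinearMap.injective_iff_surjective_of_finrank_eq_finrank
      (Subspace.dual_finrank_eq (K := ℝ) (V := F × ℝ)).symm).1 hinj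
  obtain ⟨X, hX⟩ := hsurj (LinearMap.snd ℝ F ℝ)
  have hX' : ∀ Y : F × ℝ, X.2 * A ![Y.1] - Y.2 * A ![X.1] + B ![X.1, Y.1] = Y.2 := by
    intro Y
    rw [← foldForm_pair]
    exact LinearMap.congr_fun hX Y
  have hX2 : X.2 = 0 := by
    rw [← hX' X, pair_self]; ring
  have hA0 : A ![(0 : F)] = 0 := by simpa using single_smul A 0 0
  have hB0 : ∀ u : F, B ![u, 0] = 0 := fun u => by simpa using pair_smul_right B 0 u 0
  have hAX : A ![X.1] = -1 := by
    have := hX' (0, 1)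
    simp only [hX2, hB0] at this
    linarith
  have hBX : ∀ v, B ![X.1, v] = 0 := by
    intro v
    have := hX' (v, 0)
    simp only [hX2] at this
    linarith
  set H := LinearMap.ker Al with hH
  have hfr : 2 * (n - 1) ≤ Module.finrank ℝ H := by
    have h1 := LinearMap.finrank_range_add_finrank_ker Al
    have h2 : Module.finrank ℝ (LinearMap.range Al) ≤ Module.finrank ℝ ℝ :=
      Submodule.finrank_le _
    have h3 : Module.finrank ℝ ℝ = 1 := by simp
    change 2 * (n - 1) ≤ Module.finrank ℝ (LinearMap.ker Al)
    omega
  have hne : wedgePow (n - 1) (B.compContinuousLinearMap H.subtypeL) ≠ 0 := by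
    refine wedgePow_ne_zero _ ?_ hfr
    intro u hu
    simp only [comp_pair, Submodule.subtypeL_apply] at hu
    have hAu : A ![(u : F)] = 0 := u.2
    have hBu : ∀ v, B ![(u : F), v] = 0 := by
      intro v
      -- Projection to ker A along X; it does not change pairings under B because X is in the kernel
      -- of B.
      have hv : v + A ![v] • X.1 ∈ H := by
        rw [hH, LinearMap.mem_ker, map_add, map_smul, hAl, hAl, hAX, smul_eq_mul]; ring
      have h1 := hu ⟨_, hv⟩
      simp only at h1
      rw [pair_add_right, pair_smul_right, pair_swap B (u : F) X.1, hBX] at h1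
      linarith
    have h0 : (((u : F), 0) : F × ℝ) = 0 := by
      refine h _ fun Y => ?_
      simp only [foldForm_pair, hAu, hBu]
      ring
    exact Subtype.ext (Prod.mk.inj h0).1
  intro h0
  rw [wedgePow_comp, h0] at hne
  exact hne rfl

end FoldForm

/-! ### Smooth families of alternating forms -/

section Smoothness

open Filter Topology

variable {X : Type*} [NormedAddCommGroup X] [NormedSpace ℝ X]
  {E : Type*} [NormedAddCommGroup E] [NormedSpace ℝ E]
  {F : Type*} [NormedAddCommGroup F] [NormedSpace ℝ F]

/-- Smoothness of a family of alternating forms can be checked on fixed arguments. -/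
theorem contDiffAt_alternating [FiniteDimensional ℝ E] {ι : Type*} [Fintype ι]
    {f : X → E [⋀^ι]→L[ℝ] ℝ} {x : X} {N : WithTop ℕ∞}
    (h : ∀ v, ContDiffAt ℝ N (fun y => f y v) x) : ContDiffAt ℝ N f x := by
  classical
  let b := Module.finBasis ℝ E
  let ev : (E [⋀^ι]→L[ℝ] ℝ) →ₗ[ℝ] ((ι → Fin (Module.finrank ℝ E)) → ℝ) :=
    { toFun := fun w k => w fun l => b (k l)
      map_add' := fun _ _ => rfl
      map_smul' := fun _ _ => rfl }
  have hinj : LinearMap.ker ev = ⊥ := by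
    rw [LinearMap.ker_eq_bot]
    intro w w' hw
    apply ContinuousAlternatingMap.toAlternatingMap_injective
    apply AlternatingMap.coe_multilinearMap_injective
    exact Module.Basis.ext_multilinear (fun _ => b) fun k => congrFun hw k
  obtain ⟨g, hg⟩ := LinearMap.exists_leftInverse_of_injective ev hinj
  have hf : f = fun y => LinearMap.toContinuousLinearMap g (ev (f y)) := by
    funext y
    exact (LinearMap.congr_fun hg (f y)).symm
  rw [hf]
  exact (LinearMap.toContinuousLinearMap g).contDiff.contDiffAt.comp x
    (contDiffAt_pi.2 fun k => h _)

theorem _root_.ContDiffAt.alternating_apply {ι : Type*} [Fintype ι]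
    {f : X → E [⋀^ι]→L[ℝ] ℝ} {x : X} {N : WithTop ℕ∞} (h : ContDiffAt ℝ N f x) (v : ι → E) :
    ContDiffAt ℝ N (fun y => f y v) x :=
  (ContinuousAlternatingMap.apply ℝ E ℝ v).contDiff.contDiffAt.comp x h

/-- Pullback is linear in the form and multilinear in the copies of the linear map, so it is smooth
in both. -/
theorem _root_.ContDiffAt.alternating_comp [FiniteDimensional ℝ E] {ι : Type*} [Fintype ι]
    {f : X → F [⋀^ι]→L[ℝ] ℝ} {g : X → E →L[ℝ] F} {x : X} {N : WithTop ℕ∞}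
    (hf : ContDiffAt ℝ N f x) (hg : ContDiffAt ℝ N g x) :
    ContDiffAt ℝ N (fun y => (f y).compContinuousLinearMap (g y)) x := by
  refine contDiffAt_alternating fun v => ?_
  have h0 : ContDiff ℝ N fun w : F [⋀^ι]→L[ℝ] ℝ =>
      ContinuousAlternatingMap.toContinuousMultilinearMapCLM ℝ w := ContinuousLinearMap.contDiff _
  have h1 : ContDiffAt ℝ N (fun y => ContinuousAlternatingMap.toContinuousMultilinearMapCLM ℝ
      (f y)) x := h0.contDiffAt.comp x hf
  have h2 : ContDiffAt ℝ N (fun y =>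
      ContinuousMultilinearMap.compContinuousLinearMapContinuousMultilinear ℝ (fun _ : ι => E)
        (fun _ => F) ℝ (fun _ => g y)) x :=
    (ContinuousMultilinearMap.contDiff _).contDiffAt.comp x (contDiffAt_pi.2 fun _ => hg)
  exact (ContinuousMultilinearMap.apply ℝ (fun _ : ι => E) ℝ v).contDiff.contDiffAt.comp x
    (h2.clm_apply h1)

theorem _root_.ContDiffAt.wedge [FiniteDimensional ℝ E] {a b : X → E [⋀^Fin 1]→L[ℝ] ℝ} {x : X}
    {N : WithTop ℕ∞} (ha : ContDiffAt ℝ N a x) (hb : ContDiffAt ℝ N b x) :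
    ContDiffAt ℝ N (fun y => BSymplectic.wedge (a y) (b y)) x := by
  refine contDiffAt_alternating fun v => ?_
  simp only [wedge_apply]
  exact ((ha.alternating_apply _).mul (hb.alternating_apply _)).sub
    ((ha.alternating_apply _).mul (hb.alternating_apply _))

theorem _root_.ContDiffAt.wedgePow_apply {n : ℕ} {w : X → E [⋀^Fin 2]→L[ℝ] ℝ}
    {x : X} {N : WithTop ℕ∞} (hw : ContDiffAt ℝ N w x) (v : Fin n × Fin 2 → E) :
    ContDiffAt ℝ N (fun y => BSymplectic.wedgePow n (w y) v) x := by
  simp only [BSymplectic.wedgePow_apply]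
  refine contDiffAt_const.mul (ContDiffAt.sum fun σ _ => contDiffAt_const.mul ?_)
  exact contDiffAt_prod fun j _ => hw.alternating_apply _

theorem _root_.ContDiffAt.wedgePow [FiniteDimensional ℝ E] {n : ℕ} {w : X → E [⋀^Fin 2]→L[ℝ] ℝ}
    {x : X} {N : WithTop ℕ∞} (hw : ContDiffAt ℝ N w x) :
    ContDiffAt ℝ N (fun y => BSymplectic.wedgePow n (w y)) x :=
  contDiffAt_alternating fun v => hw.wedgePow_apply v

theorem _root_.ContDiffAt.covector [FiniteDimensional ℝ E] {l : X → E →L[ℝ] ℝ} {x : X}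
    {N : WithTop ℕ∞} (hl : ContDiffAt ℝ N l x) :
    ContDiffAt ℝ N (fun y => BSymplectic.covector (l y)) x := by
  refine contDiffAt_alternating fun v => ?_
  simp only [covector_apply]
  exact hl.clm_apply contDiffAt_const

end Smoothness

/-! ### Exterior derivative on constant vector fields -/

section ExteriorDerivative

variable {E : Type*} [NormedAddCommGroup E] [NormedSpace ℝ E]

theorem extDeriv_pair {a : E → E [⋀^Fin 1]→L[ℝ] ℝ} {x : E} (ha : DifferentiableAt ℝ a x)
    (X Y : E) : extDeriv a x ![X, Y] =
      fderiv ℝ (fun y => a y ![Y]) x X - fderiv ℝ (fun y => a y ![X]) x Y := by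
  rw [extDeriv_apply ha]
  have h0 : (0 : Fin 2).removeNth ![X, Y] = ![Y] := by funext j; fin_cases j; rfl
  have h1 : (1 : Fin 2).removeNth ![X, Y] = ![X] := by funext j; fin_cases j; rfl
  simp [Fin.sum_univ_two, h0, h1, sub_eq_add_neg]

theorem extDeriv_triple {w : E → E [⋀^Fin 2]→L[ℝ] ℝ} {x : E} (hw : DifferentiableAt ℝ w x)
    (X Y T : E) : extDeriv w x ![X, Y, T] =
      fderiv ℝ (fun y => w y ![Y, T]) x X - fderiv ℝ (fun y => w y ![X, T]) x Y +
        fderiv ℝ (fun y => w y ![X, Y]) x T := by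
  rw [extDeriv_apply hw]
  have h0 : (0 : Fin 3).removeNth ![X, Y, T] = ![Y, T] := by funext j; fin_cases j <;> rfl
  have h1 : (1 : Fin 3).removeNth ![X, Y, T] = ![X, T] := by funext j; fin_cases j <;> rfl
  have h2 : (2 : Fin 3).removeNth ![X, Y, T] = ![X, Y] := by funext j; fin_cases j <;> rfl
  simp [Fin.sum_univ_three, h0, h1, h2, sub_eq_add_neg]

theorem ext_triple {w w' : E [⋀^Fin 3]→L[ℝ] ℝ} (h : ∀ X Y T, w ![X, Y, T] = w' ![X, Y, T]) :
    w = w' := by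
  ext v
  have : v = ![v 0, v 1, v 2] := by funext j; fin_cases j <;> rfl
  rw [this, h]

/-- The Leibniz rule d(a ∧ c) = da ∧ c - a ∧ dc, checked on constant vectors, where d is an
alternating sum of directional derivatives. -/
theorem extDeriv_wedge {a c : E → E [⋀^Fin 1]→L[ℝ] ℝ} {x : E} (ha : DifferentiableAt ℝ a x)
    (hc : DifferentiableAt ℝ c x) (hw : DifferentiableAt ℝ (fun y => wedge (a y) (c y)) x)
    (X Y T : E) :
    extDeriv (fun y => wedge (a y) (c y)) x ![X, Y, T] =
      (extDeriv a x ![X, Y] * c x ![T] - extDeriv a x ![X, T] * c x ![Y] +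
        extDeriv a x ![Y, T] * c x ![X]) -
      (a x ![X] * extDeriv c x ![Y, T] - a x ![Y] * extDeriv c x ![X, T] +
        a x ![T] * extDeriv c x ![X, Y]) := by
  have ha' : ∀ U, DifferentiableAt ℝ (fun y => a y ![U]) x := fun U =>
    (ContinuousAlternatingMap.apply ℝ E ℝ ![U]).differentiableAt.comp x ha
  have hc' : ∀ U, DifferentiableAt ℝ (fun y => c y ![U]) x := fun U =>
    (ContinuousAlternatingMap.apply ℝ E ℝ ![U]).differentiableAt.comp x hc
  have key : ∀ U V W : E, fderiv ℝ (fun y => wedge (a y) (c y) ![U, V]) x W =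
      a x ![U] * fderiv ℝ (fun y => c y ![V]) x W + c x ![V] * fderiv ℝ (fun y => a y ![U]) x W -
      (a x ![V] * fderiv ℝ (fun y => c y ![U]) x W +
        c x ![U] * fderiv ℝ (fun y => a y ![V]) x W) := by
    intro U V W
    simp only [wedge_pair]
    rw [fderiv_fun_sub ((ha' U).fun_mul (hc' V)) ((ha' V).fun_mul (hc' U)), fderiv_fun_mul (ha' U) (hc' V),
      fderiv_fun_mul (ha' V) (hc' U)]
    simp
  rw [extDeriv_triple hw]
  simp only [key, extDeriv_pair ha, extDeriv_pair hc]
  ring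

end ExteriorDerivative

/-! ### Parameter integrals, Hadamard's lemma and comparison of coefficients -/

section Hadamard

open Filter Topology MeasureTheory

/-- Differentiation under the integral sign. A directional derivative of the integral is the
integral of a function of the same kind, so the induction on the order of smoothness runs over all
integrands at once. -/
theorem contDiffOn_intervalIntegral {H G : Type*} [NormedAddCommGroup H] [NormedSpace ℝ H]
    [FiniteDimensional ℝ H] [NormedAddCommGroup G] [NormedSpace ℝ G] [CompleteSpace G]
    {O : Set H} (hO : IsOpen O) {V : Set (H × ℝ)} (hV : IsOpen V)
    (hOV : ∀ h ∈ O, ∀ s ∈ Icc (0 : ℝ) 1, (h, s) ∈ V) {f : H × ℝ → G} (hf : ContDiffOn ℝ ∞ f V) :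
    ContDiffOn ℝ ∞ (fun h => ∫ s in (0 : ℝ)..1, f (h, s)) O := by
  suffices h : ∀ (N : ℕ) (f : H × ℝ → G), ContDiffOn ℝ ∞ f V →
      ContDiffOn ℝ N (fun h => ∫ s in (0 : ℝ)..1, f (h, s)) O from
    contDiffOn_infty.2 fun N => h N f hf
  have hder : ∀ f : H × ℝ → G, ContDiffOn ℝ ∞ f V → ∀ h ∈ O,
      HasFDerivAt (fun h => ∫ s in (0 : ℝ)..1, f (h, s))
        (∫ s in (0 : ℝ)..1, (fderiv ℝ f (h, s)).comp (ContinuousLinearMap.inl ℝ H ℝ)) h ∧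
      ContinuousOn (fun s => (fderiv ℝ f (h, s)).comp (ContinuousLinearMap.inl ℝ H ℝ))
        (Icc (0 : ℝ) 1) := by
    intro f hf h hh
    have hc : ContinuousOn (fderiv ℝ f) V := hf.continuousOn_fderiv_of_isOpen hV (by simp)
    have hK : ∀ h ∈ O, ContinuousOn (fun s : ℝ => f (h, s)) (Icc 0 1) := fun h hh =>
      hf.continuousOn.comp (by fun_prop) (hOV h hh)
    have hK1 : ContinuousOn (fun s : ℝ => fderiv ℝ f (h, s)) (Icc 0 1) :=
      hc.comp (by fun_prop) (hOV h hh)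
    have hK' : ContinuousOn (fun s => (fderiv ℝ f (h, s)).comp (ContinuousLinearMap.inl ℝ H ℝ))
        (Icc (0 : ℝ) 1) := hK1.clm_comp continuousOn_const
    refine ⟨?_, hK'⟩
    obtain ⟨C, hC⟩ := isCompact_Icc.exists_bound_of_continuousOn hK1
    -- Compactness of {h} × [0, 1] gives one neighborhood of h on which C + 1 bounds the derivative
    -- for all s; this is the dominating constant.
    have hev : ∀ᶠ h' in 𝓝 h, ∀ s ∈ Icc (0 : ℝ) 1, (h', s) ∈ V ∧ ‖fderiv ℝ f (h', s)‖ < C + 1 := by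
      refine isCompact_Icc.eventually_forall_of_forall_eventually fun s hs => ?_
      have hVs : V ∈ 𝓝 (h, s) := hV.mem_nhds (hOV h hh s hs)
      have h1 : ContinuousAt (fun p => ‖fderiv ℝ f p‖) (h, s) := (hc.continuousAt hVs).norm
      filter_upwards [hVs, h1.eventually_lt_const (show ‖fderiv ℝ f (h, s)‖ < C + 1 by
        linarith [hC s hs])] with p hp hp'
      exact ⟨hp, hp'⟩
    have hsub : uIoc (0 : ℝ) 1 ⊆ Icc 0 1 := by
      rw [uIoc_of_le zero_le_one]; exact Ioc_subset_Icc_self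
    set L := (ContinuousLinearMap.inl ℝ H ℝ)
    refine intervalIntegral.hasFDerivAt_integral_of_dominated_of_fderiv_le
      (F' := fun h s => (fderiv ℝ f (h, s)).comp L) (bound := fun _ => (C + 1) * ‖L‖)
      (hev.and (hO.mem_nhds hh)) ?_ ?_ ?_ ?_ ?_ ?_
    · filter_upwards [hO.mem_nhds hh] with h' hh'
      exact ((hK h' hh').mono hsub).aestronglyMeasurable measurableSet_uIoc
    · exact ContinuousOn.intervalIntegrable (by rw [uIcc_of_le zero_le_one]; exact hK h hh)
    · exact (hK'.mono hsub).aestronglyMeasurable measurableSet_uIoc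
    · refine Eventually.of_forall fun s hs h' hh' => ?_
      refine (ContinuousLinearMap.opNorm_comp_le _ _).trans ?_
      gcongr
      exact (hh'.1 s (hsub hs)).2.le
    · exact intervalIntegrable_const
    · refine Eventually.of_forall fun s hs h' hh' => ?_
      have h1 : HasFDerivAt f (fderiv ℝ f (h', s)) (h', s) :=
        ((hf.contDiffAt (hV.mem_nhds (hh'.1 s (hsub hs)).1)).differentiableAt
          (by simp)).hasFDerivAt
      exact h1.comp h' (hasFDerivAt_prodMk_left h' s)
  intro N
  induction N with
  | zero =>
    intro f hf
    exact contDiffOn_zero.2 fun h hh => (hder f hf h hh).1.continuousAt.continuousWithinAt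
  | succ N ih =>
    intro f hf
    rw [Nat.cast_succ]
    refine contDiffOn_succ_of_fderiv_apply
      (fun h hh => (hder f hf h hh).1.differentiableAt.differentiableWithinAt)
      (fun h => absurd h (by simp)) fun v => ?_
    have hfv : ContDiffOn ℝ ∞ (fun p => fderiv ℝ f p (v, 0)) V :=
      (hf.fderiv_of_isOpen hV (by simp)).clm_apply contDiffOn_const
    refine (ih _ hfv).congr fun h hh => ?_
    obtain ⟨h1, h2⟩ := hder f hf h hh
    rw [fderivWithin_of_isOpen hO hh, h1.fderiv, ContinuousLinearMap.intervalIntegral_apply]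
    · rfl
    · exact ContinuousOn.intervalIntegrable (by rw [uIcc_of_le zero_le_one]; exact h2)

/-- Hadamard's lemma with parameters: the difference quotient at `0` is smooth. -/
theorem contDiffOn_dslope {H G : Type*} [NormedAddCommGroup H] [NormedSpace ℝ H]
    [FiniteDimensional ℝ H] [NormedAddCommGroup G] [NormedSpace ℝ G] [CompleteSpace G]
    {O : Set H} (hO : IsOpen O) {δ : ℝ} {A : H × ℝ → G}
    (hA : ContDiffOn ℝ ∞ A (O ×ˢ Ioo (-δ) δ)) :
    ContDiffOn ℝ ∞ (fun p : H × ℝ => dslope (fun t => A (p.1, t)) 0 p.2) (O ×ˢ Ioo (-δ) δ) := by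
  have hU : IsOpen (O ×ˢ Ioo (-δ) δ) := hO.prod isOpen_Ioo
  -- The difference quotient is the integral over s in [0, 1] of ∂A/∂t at (y, s t), for t = 0 as
  -- well; κ (p, s) is the point where the derivative is taken.
  set κ : (H × ℝ) × ℝ → H × ℝ := fun q => (q.1.1, q.2 * q.1.2) with hκ
  have hκc : ContDiff ℝ ∞ κ := by fun_prop
  have hmem : ∀ p ∈ O ×ˢ Ioo (-δ) δ, ∀ s ∈ Icc (0 : ℝ) 1, κ (p, s) ∈ O ×ˢ Ioo (-δ) δ := by
    rintro ⟨y, t⟩ ⟨hy, ht⟩ s hs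
    refine ⟨hy, ?_⟩
    simp only [mem_Ioo, ← abs_lt] at ht ⊢
    rw [abs_mul, abs_of_nonneg hs.1]
    exact (mul_le_of_le_one_left (abs_nonneg t) hs.2).trans_lt ht
  have hd : ContDiffOn ℝ ∞ (fun p => fderiv ℝ A p (0, 1)) (O ×ˢ Ioo (-δ) δ) :=
    (hA.fderiv_of_isOpen hU (by simp)).clm_apply contDiffOn_const
  have hI := contDiffOn_intervalIntegral hU (hU.preimage hκc.continuous) hmem
    (hd.comp hκc.contDiffOn (fun q hq => hq))
  refine hI.congr ?_
  rintro ⟨y, t⟩ ⟨hy, ht⟩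
  have hderA : ∀ r ∈ Ioo (-δ) δ, HasDerivAt (fun t => A (y, t)) (fderiv ℝ A (y, r) (0, 1)) r := by
    intro r hr
    have h1 : HasFDerivAt A (fderiv ℝ A (y, r)) (y, r) :=
      ((hA.contDiffAt (hU.mem_nhds (show (y, r) ∈ _ from ⟨hy, hr⟩))).differentiableAt (by simp)).hasFDerivAt
    exact h1.comp_hasDerivAt r ((hasDerivAt_const r y).prodMk (hasDerivAt_id r))
  simp only [Function.comp_apply, hκ]
  by_cases h0 : t = 0
  · subst h0
    simp [dslope_same, (hderA 0 ht).deriv]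
  · rw [dslope_of_ne _ h0, slope_def_module, sub_zero]
    have hFTC : ∫ s in (0 : ℝ)..1, t • fderiv ℝ A (y, s * t) (0, 1) = A (y, t) - A (y, 0) := by
      have := intervalIntegral.integral_eq_sub_of_hasDerivAt
        (f := fun s : ℝ => A (y, s * t)) (a := 0) (b := 1)
        (f' := fun s => t • fderiv ℝ A (y, s * t) (0, 1)) (fun s hs => ?_) ?_
      · simpa using this
      · rw [uIcc_of_le zero_le_one] at hs
        have h1 := hderA (s * t) (hmem (y, t) ⟨hy, ht⟩ s hs).2
        have h2 : HasDerivAt (fun s : ℝ => s * t) t s := by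
          simpa using (hasDerivAt_id s).mul_const t
        exact h1.scomp s h2
      · refine ContinuousOn.intervalIntegrable ?_
        rw [uIcc_of_le zero_le_one]
        refine ContinuousOn.const_smul ?_ t
        exact hd.continuousOn.comp (f := fun s : ℝ => ((y, s * t) : H × ℝ))
          (by fun_prop) (fun s hs => hmem (y, t) ⟨hy, ht⟩ s hs)
    rw [← hFTC, intervalIntegral.integral_smul, smul_smul, inv_mul_cancel₀ h0, one_smul]

/-- Let t → 0 to get c 0 = 0, then divide by t and repeat. Only a limit of B at 0 is needed. -/
theorem coeff_eq_zero_of_eventually_eq : ∀ (m : ℕ) (c : Fin m → ℝ) (B : ℝ → ℝ) (l : ℝ),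
    Tendsto B (𝓝[≠] 0) (𝓝 l) →
    (∀ᶠ t in 𝓝[≠] (0 : ℝ), ∑ j : Fin m, t ^ (j : ℕ) * c j = t ^ m * B t) → ∀ j, c j = 0
  | 0, _, _, _, _, _ => fun j => j.elim0
  | m + 1, c, B, l, hB, h => by
    have hid : Tendsto (fun t : ℝ => t) (𝓝[≠] 0) (𝓝 0) := nhdsWithin_le_nhds
    have h1 : Tendsto (fun t : ℝ => t ^ (m + 1) * B t) (𝓝[≠] 0) (𝓝 0) := by
      simpa using (hid.pow (m + 1)).mul hB
    have h2 : Tendsto (fun t : ℝ => ∑ j : Fin (m + 1), t ^ (j : ℕ) * c j) (𝓝[≠] 0)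
        (𝓝 (∑ j : Fin (m + 1), 0 ^ (j : ℕ) * c j)) :=
      tendsto_finsetSum _ fun j _ => (hid.pow _).mul_const _
    have h3 := tendsto_nhds_unique (h2.congr' h) h1
    have hc0 : c 0 = 0 := by simpa [Fin.sum_univ_succ] using h3
    have h4 := coeff_eq_zero_of_eventually_eq m (fun j => c j.succ) B l hB (by
      filter_upwards [h, self_mem_nhdsWithin] with t ht ht0
      have ht0 : t ≠ 0 := ht0
      rw [Fin.sum_univ_succ, hc0] at ht
      refine mul_left_cancel₀ ht0 ?_
      rw [Finset.mul_sum, ← mul_assoc, ← pow_succ', ← ht]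
      simp [pow_succ', mul_assoc])
    exact fun j => Fin.cases hc0 h4 j

end Hadamard

/-! ### Forms in arbitrary parametrizations -/

section Representation

open Filter Topology

variable {E : Type*} [NormedAddCommGroup E] [NormedSpace ℝ E]
  {M : Type*} [TopologicalSpace M] [ChartedSpace E M]
  {F : Type*} [NormedAddCommGroup F] [NormedSpace ℝ F]
  {Z : Type*} [TopologicalSpace Z] [ChartedSpace F Z]
  {X : Type*} [NormedAddCommGroup X] [NormedSpace ℝ X]
  {Y : Type*} [NormedAddCommGroup Y] [NormedSpace ℝ Y]

/-- The expression of a form in the parametrization `g`. -/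
noncomputable def rep {k : ℕ} (g : X → M) (a : DForm E M k) : X → X [⋀^Fin k]→L[ℝ] ℝ :=
  pullback (M := X) g a

theorem pullback_comp {N : Type*} [TopologicalSpace N] [ChartedSpace X N] {k : ℕ} {g : Z → M}
    {h : N → Z} {p : N} (hg : MDifferentiableAt 𝓘(ℝ, F) 𝓘(ℝ, E) g (h p))
    (hh : MDifferentiableAt 𝓘(ℝ, X) 𝓘(ℝ, F) h p) (a : DForm E M k) :
    pullback (E := X) (F := E) (g ∘ h) a p =
      pullback (E := X) (F := F) h (pullback (E := F) (F := E) g a) p := by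
  simp only [pullback]
  rw [mfderiv_comp p hg hh]
  rfl

theorem rep_comp {k : ℕ} {g : X → M} {θ : Y → X} {y : Y}
    (hg : MDifferentiableAt 𝓘(ℝ, X) 𝓘(ℝ, E) g (θ y)) (hθ : DifferentiableAt ℝ θ y)
    (a : DForm E M k) :
    rep (g ∘ θ) a y = (rep g a (θ y)).compContinuousLinearMap (fderiv ℝ θ y) := by
  simp only [rep, pullback]
  rw [mfderiv_comp y hg hθ.mdifferentiableAt, mfderiv_eq_fderiv]
  rfl

theorem rep_congr {k : ℕ} {g g' : X → M} {y : X} (h : g =ᶠ[𝓝 y] g') (a : DForm E M k) :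
    rep g a y = rep g' a y := by
  have h1 := h.self_of_nhds
  have h2 : mfderiv 𝓘(ℝ, X) 𝓘(ℝ, E) g y = mfderiv 𝓘(ℝ, X) 𝓘(ℝ, E) g' y := h.mfderiv_eq
  simp only [rep, pullback]
  rw [h2]
  rw [h1]

theorem rep_eventuallyEq {k : ℕ} {g : X → M} {g' : Y → M} {θ : Y → X} {y : Y}
    (hg : ∀ᶠ x in 𝓝 (θ y), MDifferentiableAt 𝓘(ℝ, X) 𝓘(ℝ, E) g x) (hθ : ContDiffAt ℝ ∞ θ y)
    (h : g' =ᶠ[𝓝 y] g ∘ θ) (a : DForm E M k) :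
    rep g' a =ᶠ[𝓝 y] fun y => (rep g a (θ y)).compContinuousLinearMap (fderiv ℝ θ y) := by
  have h1 : ∀ᶠ y' in 𝓝 y, DifferentiableAt ℝ θ y' := by
    have := (hθ.of_le (show (1 : WithTop ℕ∞) ≤ ∞ by simp)).eventually (by simp)
    filter_upwards [this] with y' hy'
    exact hy'.differentiableAt (by simp)
  filter_upwards [hθ.continuousAt.eventually hg, h1, h.eventuallyEq_nhds] with y' h2 h3 h4
  rw [rep_congr h4, rep_comp h2 h3]

theorem contDiffAt_rep_of_comp [FiniteDimensional ℝ Y] {k : ℕ} {g : X → M} {g' : Y → M}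
    {θ : Y → X} {y : Y}
    (hg : ∀ᶠ x in 𝓝 (θ y), MDifferentiableAt 𝓘(ℝ, X) 𝓘(ℝ, E) g x) (hθ : ContDiffAt ℝ ∞ θ y)
    (h : g' =ᶠ[𝓝 y] g ∘ θ) {a : DForm E M k} (ha : ContDiffAt ℝ ∞ (rep g a) (θ y)) :
    ContDiffAt ℝ ∞ (rep g' a) y :=
  ((ha.comp y hθ).alternating_comp (hθ.fderiv_right (by simp))).congr_of_eventuallyEq
    (rep_eventuallyEq hg hθ h a)

theorem extDeriv_rep_of_comp {k : ℕ} {g : X → M} {g' : Y → M} {θ : Y → X} {y : Y}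
    (hg : ∀ᶠ x in 𝓝 (θ y), MDifferentiableAt 𝓘(ℝ, X) 𝓘(ℝ, E) g x) (hθ : ContDiffAt ℝ ∞ θ y)
    (h : g' =ᶠ[𝓝 y] g ∘ θ) {a : DForm E M k} (ha : DifferentiableAt ℝ (rep g a) (θ y)) :
    extDeriv (rep g' a) y =
      (extDeriv (rep g a) (θ y)).compContinuousLinearMap (fderiv ℝ θ y) := by
  rw [(rep_eventuallyEq hg hθ h a).extDeriv_eq]
  refine extDeriv_pullback ha hθ ?_
  rw [minSmoothness_of_isRCLikeNormedField]
  exact WithTop.coe_le_coe.2 (le_top : (2 : ℕ∞) ≤ ⊤)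

theorem isOpen_chartDom {S : Set M} (hS : IsOpen S) (p : M) : IsOpen (chartDom (E := E) S p) :=
  (continuousOn_extChartAt_symm p).isOpen_inter_preimage (isOpen_extChartAt_target p) hS

variable [IsManifold 𝓘(ℝ, E) ∞ M]

theorem contMDiffAt_extChartAt_symm {p : M} {y : E}
    (hy : y ∈ (extChartAt 𝓘(ℝ, E) p).target) :
    ContMDiffAt 𝓘(ℝ, E) 𝓘(ℝ, E) ∞ (extChartAt 𝓘(ℝ, E) p).symm y :=
  (contMDiffOn_extChartAt_symm p).contMDiffAt ((isOpen_extChartAt_target p).mem_nhds hy)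

theorem eventually_mdifferentiableAt_extChartAt_symm {p : M} {y : E}
    (hy : y ∈ (extChartAt 𝓘(ℝ, E) p).target) : ∀ᶠ x in 𝓝 y,
    MDifferentiableAt 𝓘(ℝ, E) 𝓘(ℝ, E) (extChartAt 𝓘(ℝ, E) p).symm x := by
  filter_upwards [(isOpen_extChartAt_target p).mem_nhds hy] with x hx
  exact (contMDiffAt_extChartAt_symm hx).mdifferentiableAt (by simp)

omit [IsManifold 𝓘(ℝ, E) ∞ M] in
theorem contDiffAt_extChartAt_comp {g : X → M} {y : X}
    (hg : ContMDiffAt 𝓘(ℝ, X) 𝓘(ℝ, E) ∞ g y) :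
    ContDiffAt ℝ ∞ (extChartAt 𝓘(ℝ, E) (g y) ∘ g) y :=
  ((contMDiffAt_extChartAt (I := 𝓘(ℝ, E)) (x := g y)).comp y hg).contDiffAt

omit [NormedSpace ℝ X] [IsManifold 𝓘(ℝ, E) ∞ M] in
theorem eventuallyEq_extChartAt_symm_comp {g : X → M} {y : X} (hg : ContinuousAt g y) :
    g =ᶠ[𝓝 y] (extChartAt 𝓘(ℝ, E) (g y)).symm ∘ (extChartAt 𝓘(ℝ, E) (g y) ∘ g) := by
  filter_upwards [hg.eventually (extChartAt_source_mem_nhds (I := 𝓘(ℝ, E)) (g y))] with x hx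
  exact ((extChartAt 𝓘(ℝ, E) (g y)).left_inv hx).symm

/-- Smoothness of a form is defined in preferred charts only. Factoring g locally through such a
chart extends it to pullbacks along any smooth map; `extDeriv_rep_eq_zero` does the same for
closedness. -/
theorem contDiffAt_rep [FiniteDimensional ℝ X] {k : ℕ} {a : DForm E M k} {S : Set M}
    (ha : SmoothFormOn a S) (hS : IsOpen S) {g : X → M} {y : X}
    (hg : ContMDiffAt 𝓘(ℝ, X) 𝓘(ℝ, E) ∞ g y) (hy : g y ∈ S) : ContDiffAt ℝ ∞ (rep g a) y := by
  refine contDiffAt_rep_of_comp (g := (extChartAt 𝓘(ℝ, E) (g y)).symm)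
    (θ := extChartAt 𝓘(ℝ, E) (g y) ∘ g)
    (eventually_mdifferentiableAt_extChartAt_symm (mem_extChartAt_target (g y)))
    (contDiffAt_extChartAt_comp hg) (eventuallyEq_extChartAt_symm_comp hg.continuousAt) ?_
  refine (ha (g y)).contDiffAt ((isOpen_chartDom hS (g y)).mem_nhds ⟨mem_extChartAt_target (g y), ?_⟩)
  simpa using hy

theorem extDeriv_rep_eq_zero {k : ℕ} {a : DForm E M k} {S : Set M}
    (ha : SmoothFormOn a S) (hac : ClosedFormOn a S) (hS : IsOpen S) {g : X → M} {y : X}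
    (hg : ContMDiffAt 𝓘(ℝ, X) 𝓘(ℝ, E) ∞ g y) (hy : g y ∈ S) : extDeriv (rep g a) y = 0 := by
  have hmem : extChartAt 𝓘(ℝ, E) (g y) (g y) ∈ chartDom S (g y) :=
    ⟨mem_extChartAt_target (g y), by simpa using hy⟩
  rw [extDeriv_rep_of_comp (g := (extChartAt 𝓘(ℝ, E) (g y)).symm)
    (θ := extChartAt 𝓘(ℝ, E) (g y) ∘ g)
    (eventually_mdifferentiableAt_extChartAt_symm (mem_extChartAt_target (g y)))
    (contDiffAt_extChartAt_comp hg) (eventuallyEq_extChartAt_symm_comp hg.continuousAt)]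
  · have h0 := hac (g y) _ hmem
    have h0' : extDeriv (rep (extChartAt 𝓘(ℝ, E) (g y)).symm a)
      ((extChartAt 𝓘(ℝ, E) (g y) ∘ g) y) = 0 := h0
    rw [h0']
    rfl
  · exact ((ha (g y)).contDiffAt ((isOpen_chartDom hS (g y)).mem_nhds hmem)).differentiableAt
      (by simp)

/-- A parametrization of an open set of `M`: a diffeomorphism from an open set of a normed space. -/
structure IsParam (G : OpenPartialHomeomorph X M) : Prop where
  contMDiffOn : ContMDiffOn 𝓘(ℝ, X) 𝓘(ℝ, E) ∞ G G.source
  contMDiffOn_symm : ContMDiffOn 𝓘(ℝ, E) 𝓘(ℝ, X) ∞ G.symm G.target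

omit [IsManifold 𝓘(ℝ, E) ∞ M] in
theorem IsParam.eventually_mdifferentiableAt {G : OpenPartialHomeomorph X M}
    (hG : IsParam (E := E) G) {x : X} (hx : x ∈ G.source) :
    ∀ᶠ x' in 𝓝 x, MDifferentiableAt 𝓘(ℝ, X) 𝓘(ℝ, E) G x' := by
  filter_upwards [G.open_source.mem_nhds hx] with x' hx'
  exact (hG.contMDiffOn.contMDiffAt (G.open_source.mem_nhds hx')).mdifferentiableAt (by simp)

omit [NormedSpace ℝ X] [NormedSpace ℝ Y] [IsManifold 𝓘(ℝ, E) ∞ M] in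
theorem IsParam.eventuallyEq_comp {G : OpenPartialHomeomorph X M} {g : Y → M} {y : Y}
    (hg : ContinuousAt g y) (hy : g y ∈ G.target) : g =ᶠ[𝓝 y] G ∘ (G.symm ∘ g) := by
  filter_upwards [hg.eventually (G.open_target.mem_nhds hy)] with y' hy'
  exact (G.right_inv hy').symm

omit [IsManifold 𝓘(ℝ, E) ∞ M] in
theorem IsParam.contDiffAt_comp {G : OpenPartialHomeomorph X M} (hG : IsParam (E := E) G)
    {g : Y → M} {y : Y} (hg : ContMDiffAt 𝓘(ℝ, Y) 𝓘(ℝ, E) ∞ g y) (hy : g y ∈ G.target) :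
    ContDiffAt ℝ ∞ (G.symm ∘ g) y :=
  ((hG.contMDiffOn_symm.contMDiffAt (G.open_target.mem_nhds hy)).comp y hg).contDiffAt

theorem IsParam.contDiffAt_chartRep [FiniteDimensional ℝ E] {G : OpenPartialHomeomorph X M}
    (hG : IsParam (E := E) G) {k : ℕ} {a : DForm E M k} {p : M} {y : E}
    (hy : y ∈ (extChartAt 𝓘(ℝ, E) p).target) (hyG : (extChartAt 𝓘(ℝ, E) p).symm y ∈ G.target)
    (h : ContDiffAt ℝ ∞ (rep G a) (G.symm ((extChartAt 𝓘(ℝ, E) p).symm y))) :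
    ContDiffAt ℝ ∞ (chartRep a p) y :=
  contDiffAt_rep_of_comp (g := G) (g' := (extChartAt 𝓘(ℝ, E) p).symm)
    (θ := G.symm ∘ (extChartAt 𝓘(ℝ, E) p).symm)
    (hG.eventually_mdifferentiableAt (G.map_target hyG))
    (hG.contDiffAt_comp (contMDiffAt_extChartAt_symm hy) hyG)
    (IsParam.eventuallyEq_comp (contMDiffAt_extChartAt_symm hy).continuousAt hyG) h

theorem IsParam.extDeriv_chartRep {G : OpenPartialHomeomorph X M}
    (hG : IsParam (E := E) G) {k : ℕ} {a : DForm E M k} {p : M} {y : E}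
    (hy : y ∈ (extChartAt 𝓘(ℝ, E) p).target) (hyG : (extChartAt 𝓘(ℝ, E) p).symm y ∈ G.target)
    (h : DifferentiableAt ℝ (rep G a) (G.symm ((extChartAt 𝓘(ℝ, E) p).symm y)))
    (h0 : extDeriv (rep G a) (G.symm ((extChartAt 𝓘(ℝ, E) p).symm y)) = 0) :
    extDeriv (chartRep a p) y = 0 := by
  have := extDeriv_rep_of_comp (g := G) (g' := (extChartAt 𝓘(ℝ, E) p).symm)
    (θ := G.symm ∘ (extChartAt 𝓘(ℝ, E) p).symm)
    (hG.eventually_mdifferentiableAt (G.map_target hyG))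
    (hG.contDiffAt_comp (contMDiffAt_extChartAt_symm hy) hyG)
    (IsParam.eventuallyEq_comp (contMDiffAt_extChartAt_symm hy).continuousAt hyG) h
  refine this.trans ?_
  rw [show (G.symm ∘ (extChartAt 𝓘(ℝ, E) p).symm) y =
    G.symm ((extChartAt 𝓘(ℝ, E) p).symm y) from rfl, h0]
  rfl

/-- This is the term of the product rule in which the pulling map is differentiated; it disappears
where the form vanishes. -/
theorem _root_.ContinuousAlternatingMap.zero_fderivCompContinuousLinearMap {ι : Type*} [Fintype ι]
    [DecidableEq ι] (L : Y →L[ℝ] X) :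
    (0 : X [⋀^ι]→L[ℝ] ℝ).fderivCompContinuousLinearMap L = 0 := by
  ext l v
  rw [ContinuousAlternatingMap.fderivCompContinuousLinearMap_apply]
  simp

/-- The folding conditions at a point can be checked in a parametrization. -/
theorem IsParam.folded [FiniteDimensional ℝ E] [FiniteDimensional ℝ X]
    {G : OpenPartialHomeomorph X M}
    (hG : IsParam (E := E) G) {n : ℕ} {w : DForm E M 2} {x : X} (hx : x ∈ G.source)
    (hw : ContDiffAt ℝ ∞ (rep G w) x) (hp : wedgePow n (w (G x)) = 0)
    (h : wedgePow n (rep G w x) = 0 →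
      Function.Surjective (fderiv ℝ (fun x => wedgePow n (rep G w x)) x) ∧
      ∃ j : F →L[ℝ] X, (∀ u, fderiv ℝ (fun x => wedgePow n (rep G w x)) x (j u) = 0) ∧
        wedgePow (n - 1) ((rep G w x).compContinuousLinearMap j) ≠ 0) :
    Function.Surjective (fderiv ℝ (topRep n w (G x)) (extChartAt 𝓘(ℝ, E) (G x) (G x))) ∧
    wedgePow (n - 1) ((chartRep w (G x) (extChartAt 𝓘(ℝ, E) (G x) (G x))).compContinuousLinearMap
      (fderiv ℝ (topRep n w (G x)) (extChartAt 𝓘(ℝ, E) (G x) (G x))).ker.subtypeL) ≠ 0 := by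
  set p := G x with hpdef
  set φ := extChartAt 𝓘(ℝ, E) p with hφ
  set y := φ p with hy
  have hyt : y ∈ φ.target := mem_extChartAt_target p
  have hys : φ.symm y = p := extChartAt_to_inv p
  have hpG : p ∈ G.target := G.map_source hx
  have hT0 : wedgePow n (rep G w x) = 0 := by
    change wedgePow n ((w p).compContinuousLinearMap (mfderiv 𝓘(ℝ, X) 𝓘(ℝ, E) G x)) = 0
    rw [wedgePow_comp, hp]
    rfl
  obtain ⟨hsurj, j, hj, hne⟩ := h hT0
  set T := fun x => wedgePow n (rep G w x) with hT
  have hTd : DifferentiableAt ℝ T x := (hw.wedgePow).differentiableAt (by simp)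
  set θ := G.symm ∘ φ.symm with hθ
  have hyG : φ.symm y ∈ G.target := by rw [hys]; exact hpG
  have hθy : θ y = x := by
    rw [hθ, Function.comp_apply, hys, hpdef, G.left_inv hx]
  have hθd : ContDiffAt ℝ ∞ θ y := hG.contDiffAt_comp (contMDiffAt_extChartAt_symm hyt) hyG
  have hrep : chartRep w p =ᶠ[𝓝 y]
      fun y => (rep G w (θ y)).compContinuousLinearMap (fderiv ℝ θ y) :=
    rep_eventuallyEq (g := G) (hG.eventually_mdifferentiableAt (by rw [hθy]; exact hx))
      hθd (IsParam.eventuallyEq_comp (contMDiffAt_extChartAt_symm hyt).continuousAt hyG) w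
  have htop : topRep n w p =ᶠ[𝓝 y]
      fun y => (T (θ y)).compContinuousLinearMap (fderiv ℝ θ y) := by
    filter_upwards [hrep] with y' hy'
    rw [topRep, hy', wedgePow_comp]
  set P := fderiv ℝ θ y with hP
  -- the inverse change of coordinates
  set κ := φ ∘ G with hκ
  have hGx : ContMDiffAt 𝓘(ℝ, X) 𝓘(ℝ, E) ∞ G x :=
    hG.contMDiffOn.contMDiffAt (G.open_source.mem_nhds hx)
  have hκd : ContDiffAt ℝ ∞ κ x := contDiffAt_extChartAt_comp hGx
  have hκx : κ x = y := rfl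
  set Q := fderiv ℝ κ x with hQ
  have hPQ : P.comp Q = ContinuousLinearMap.id ℝ X := by
    have h1 : θ ∘ κ =ᶠ[𝓝 x] id := by
      filter_upwards [G.open_source.mem_nhds hx, eventuallyEq_extChartAt_symm_comp (E := E)
        hGx.continuousAt] with x' h1 h2
      have h2' : G x' = φ.symm (φ (G x')) := h2
      simp only [hθ, hκ, Function.comp_apply, ← h2', id, G.left_inv h1]
    have h2 := fderiv_comp x (g := θ) (f := κ) (hθd.differentiableAt (by simp))
      (hκd.differentiableAt (by simp))
    rw [h1.fderiv_eq, fderiv_id] at h2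
    exact h2.symm
  have hQP : Q.comp P = ContinuousLinearMap.id ℝ E := by
    have h1 : κ ∘ θ =ᶠ[𝓝 y] id := by
      filter_upwards [(isOpen_extChartAt_target p).mem_nhds hyt,
        (contMDiffAt_extChartAt_symm hyt).continuousAt.eventually (G.open_target.mem_nhds hyG)]
        with y' h1 h2
      simp only [hθ, hκ, Function.comp_apply, id]
      rw [G.right_inv h2]
      exact φ.right_inv h1
    have h2 := fderiv_comp y (g := κ) (f := θ) (by rw [hθy]; exact hκd.differentiableAt (by simp))
      (hθd.differentiableAt (by simp))
    rw [h1.fderiv_eq, fderiv_id, hθy] at h2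
    exact h2.symm
  have hPQ' : ∀ v, P (Q v) = v := fun v => congrArg (fun l : X →L[ℝ] X => l v) hPQ
  have hQP' : ∀ v, Q (P v) = v := fun v => congrArg (fun l : E →L[ℝ] E => l v) hQP
  -- At a zero of w^n, the derivative of the change of coordinates drops out, so the differential of
  -- w^n transforms tensorially.
  have hD : ∀ v, fderiv ℝ (topRep n w p) y v =
      (fderiv ℝ T x (P v)).compContinuousLinearMap P := by
    intro v
    have hTd' : DifferentiableAt ℝ T (θ y) := by rw [hθy]; exact hTd
    have hTθ : DifferentiableAt ℝ (fun y => T (θ y)) y :=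
      hTd'.comp y (hθd.differentiableAt (by simp))
    rw [htop.fderiv_eq, fderiv_continuousAlternatingMapCompContinuousLinearMap hTθ
      ((hθd.fderiv_right (m := 1) (by exact WithTop.coe_le_coe.2 le_top)).differentiableAt (by simp))]
    have h0 : T (θ y) = 0 := by rw [hθy]; exact hT0
    rw [h0, ContinuousAlternatingMap.zero_fderivCompContinuousLinearMap,
      fderiv_fun_comp y hTd' (hθd.differentiableAt (by simp)), hθy]
    simp
    rfl
  constructor
  · intro η
    obtain ⟨v, hv⟩ := hsurj (η.compContinuousLinearMap Q)
    refine ⟨Q v, ?_⟩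
    rw [hD, hPQ', hv]
    ext u
    simp only [ContinuousAlternatingMap.compContinuousLinearMap_apply]
    congr 1
    funext l
    exact hQP' _
  · set K := (fderiv ℝ (topRep n w p) y).ker
    have hmem : ∀ u, Q (j u) ∈ K := by
      intro u
      change fderiv ℝ (topRep n w p) y (Q (j u)) = 0
      rw [hD, hPQ', hj]
      rfl
    -- The image of j need only lie in the kernel: the restriction along j is a pullback of the
    -- restriction to K, so its nonvanishing power forces that of the latter.
    let j' : F →L[ℝ] K := (Q.comp j).codRestrict K hmem
    intro h0
    apply hne
    have h1 : (rep G w x).compContinuousLinearMap j =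
        ((chartRep w p y).compContinuousLinearMap K.subtypeL).compContinuousLinearMap j' := by
      rw [hrep.self_of_nhds]
      ext u
      simp only [ContinuousAlternatingMap.compContinuousLinearMap_apply]
      rw [hθy]
      congr 1
      funext l
      exact (hPQ' _).symm
    rw [h1, wedgePow_comp, h0]
    rfl

end Representation

/-! ### A smooth retraction of a neighborhood onto the hypersurface -/

section Retraction

open Filter Topology

variable {E : Type*} [NormedAddCommGroup E] [NormedSpace ℝ E]
  {M : Type*} [TopologicalSpace M] [ChartedSpace E M]
  {F : Type*} [NormedAddCommGroup F] [NormedSpace ℝ F]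
  {Z : Type*} [TopologicalSpace Z] [ChartedSpace F Z]

/-- In immersion charts i is u ↦ (u, 0), and the retraction is the projection to the first factor.
-/
theorem exists_local_retraction {i : Z → M}
    (hi : Manifold.IsSmoothEmbedding 𝓘(ℝ, F) 𝓘(ℝ, E) ∞ i) (z₀ : Z) :
    ∃ (U : Set M) (ρ : M → Z), IsOpen U ∧ i z₀ ∈ U ∧ ContMDiffOn 𝓘(ℝ, E) 𝓘(ℝ, F) ∞ ρ U ∧
      ∀ z, i z ∈ U → ρ (i z) = z := by
  have h : Manifold.IsImmersionAt 𝓘(ℝ, F) 𝓘(ℝ, E) ∞ i z₀ := hi.isImmersion.isImmersionAt z₀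
  set d := h.domChart
  set c := h.codChart
  let L : E →L[ℝ] F := (ContinuousLinearMap.fst ℝ F h.complement).comp
    (h.equiv.symm : E →L[ℝ] F × h.complement)
  -- The embedding property keeps points of Z outside the chart domain from being mapped into O.
  obtain ⟨O, hO, hOd⟩ := hi.isEmbedding.isOpen_iff.1 d.open_source
  have hLc : ∀ z ∈ d.source, L (c (i z)) = d z := by
    intro z hz
    have h1 : d.extend 𝓘(ℝ, F) z ∈ (d.extend 𝓘(ℝ, F)).target := by
      simpa using d.map_source hz
    have h2 := h.writtenInCharts h1
    have h3 : c (i (d.symm (d z))) = h.equiv (d z, 0) := by simpa using h2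
    rw [d.left_inv hz] at h3
    simp [L, h3]
  have hco : IsOpen (c.source ∩ c ⁻¹' (L ⁻¹' d.target)) :=
    c.continuousOn.isOpen_inter_preimage c.open_source (d.open_target.preimage L.continuous)
  have hsrc : ∀ z ∈ d.source, i z ∈ c.source := fun z hz => h.source_subset_preimage_source hz
  refine ⟨O ∩ (c.source ∩ c ⁻¹' (L ⁻¹' d.target)), fun p => d.symm (L (c p)), hO.inter hco,
    ?_, ?_, ?_⟩
  · have hz₀ : z₀ ∈ d.source := h.mem_domChart_source
    refine ⟨?_, hsrc z₀ hz₀, ?_⟩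
    · rw [← hOd] at hz₀; exact hz₀
    · change L (c (i z₀)) ∈ d.target
      rw [hLc z₀ hz₀]
      exact d.map_source hz₀
  · have h1 : ContMDiffOn 𝓘(ℝ, E) 𝓘(ℝ, E) ∞ c c.source :=
      contMDiffOn_of_mem_maximalAtlas h.codChart_mem_maximalAtlas
    have h2 : ContMDiffOn 𝓘(ℝ, F) 𝓘(ℝ, F) ∞ d.symm d.target :=
      contMDiffOn_symm_of_mem_maximalAtlas h.domChart_mem_maximalAtlas
    have h3 : ContMDiff 𝓘(ℝ, E) 𝓘(ℝ, F) ∞ L := L.contDiff.contMDiff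
    exact h2.comp (h3.comp_contMDiffOn (h1.mono fun p hp => hp.2.1)) fun p hp => hp.2.2
  · intro z hz
    have hzd : z ∈ d.source := by rw [← hOd]; exact hz.1
    change d.symm (L (c (i z))) = z
    rw [hLc z hzd, d.left_inv hzd]

variable [FiniteDimensional ℝ E] [IsManifold 𝓘(ℝ, E) ∞ M] [CompactSpace M] [T2Space M]
  [IsManifold 𝓘(ℝ, F) ∞ Z]

/-- Two retractions, the second one over a chart of the hypersurface, can be glued. -/
theorem exists_glued_retraction {i : Z → M} (hi : Continuous i) {K : Set Z} (hK : IsCompact K)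
    {U U' : Set M} {ρ ρ' : M → Z} (hU : IsOpen U) (hU' : IsOpen U')
    (hρ : ContMDiffOn 𝓘(ℝ, E) 𝓘(ℝ, F) ∞ ρ U) (hρ' : ContMDiffOn 𝓘(ℝ, E) 𝓘(ℝ, F) ∞ ρ' U')
    (hr : ∀ z, i z ∈ U → ρ (i z) = z) (hr' : ∀ z, i z ∈ U' → ρ' (i z) = z) (hKU : i '' K ⊆ U)
    {s : Z} {K' : Set Z} (hK's : K' ⊆ (chartAt F s).source) (hK'U : i '' K' ⊆ U') :
    ∃ (V : Set M) (σ : M → Z), IsOpen V ∧ i '' (K ∪ K') ⊆ V ∧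
      ContMDiffOn 𝓘(ℝ, E) 𝓘(ℝ, F) ∞ σ V ∧ ∀ z, i z ∈ V → σ (i z) = z := by
  classical
  set ψ := chartAt F s
  obtain ⟨χ, hχ0, hχ1, -⟩ := exists_contMDiffMap_zero_one_nhds_of_isClosed (n := ⊤) 𝓘(ℝ, E)
    hU.isClosed_compl (hK.image hi).isClosed
    (disjoint_left.2 fun p hp hp' => hp (hKU hp'))
  -- The average is taken in the chart ψ, where no convexity is available. It is used only on the
  -- open set Q where it lies in the chart target; on Z both retractions return z, so the average is
  -- ψ z. The value of σ outside the neighborhood finally chosen is irrelevant.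
  set c : M → F := fun p => χ p • ψ (ρ p) + (1 - χ p) • ψ (ρ' p) with hc
  set σ : M → Z := fun p => if χ p = 1 then ρ p else if χ p = 0 then ρ' p else ψ.symm (c p)
    with hσ
  have hχs : ContMDiff 𝓘(ℝ, E) 𝓘(ℝ, ℝ) ∞ χ := χ.contMDiff
  have hψ : ∀ z ∈ ψ.source, ContMDiffAt 𝓘(ℝ, F) 𝓘(ℝ, F) ∞ ψ z := fun z hz =>
    contMDiffOn_chart.contMDiffAt (ψ.open_source.mem_nhds hz)
  have hψ' : ∀ y ∈ ψ.target, ContMDiffAt 𝓘(ℝ, F) 𝓘(ℝ, F) ∞ ψ.symm y := fun y hy =>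
    contMDiffOn_chart_symm.contMDiffAt (ψ.open_target.mem_nhds hy)
  set Q₀ := (U ∩ ρ ⁻¹' ψ.source) ∩ (U' ∩ ρ' ⁻¹' ψ.source) with hQ₀
  have hQ₀o : IsOpen Q₀ := (hρ.continuousOn.isOpen_inter_preimage hU ψ.open_source).inter
    (hρ'.continuousOn.isOpen_inter_preimage hU' ψ.open_source)
  have hcs : ∀ p ∈ Q₀, ContMDiffAt 𝓘(ℝ, E) 𝓘(ℝ, F) ∞ c p := by
    rintro p ⟨⟨hpU, hpρ⟩, hpU', hpρ'⟩
    have h1 : ContMDiffAt 𝓘(ℝ, E) 𝓘(ℝ, F) ∞ (fun p => ψ (ρ p)) p :=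
      (hψ _ hpρ).comp p (hρ.contMDiffAt (hU.mem_nhds hpU))
    have h2 : ContMDiffAt 𝓘(ℝ, E) 𝓘(ℝ, F) ∞ (fun p => ψ (ρ' p)) p :=
      (hψ _ hpρ').comp p (hρ'.contMDiffAt (hU'.mem_nhds hpU'))
    exact (hχs.contMDiffAt.smul h1).add
      ((contMDiffAt_const.sub hχs.contMDiffAt).smul h2)
  set Q := Q₀ ∩ c ⁻¹' ψ.target with hQ
  have hQo : IsOpen Q := ContinuousOn.isOpen_inter_preimage
    (fun p hp => (hcs p hp).continuousAt.continuousWithinAt) hQ₀o ψ.open_target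
  -- All three branches of σ agree on Q, so σ is smooth there although it is defined by cases.
  have hσQ : ∀ p ∈ Q, σ p = ψ.symm (c p) := by
    rintro p ⟨⟨⟨hpU, hpρ⟩, hpU', hpρ'⟩, hpc⟩
    simp only [hσ]
    split_ifs with h1 h0
    · simp [hc, h1, ψ.left_inv hpρ]
    · simp [hc, h0, ψ.left_inv hpρ']
    · rfl
  set O₁ := interior {p | χ p = 1}
  set O₀ := interior {p | χ p = 0}
  have hO₁ : i '' K ⊆ O₁ := subset_interior_iff_mem_nhdsSet.2 hχ1
  have hO₀ : Uᶜ ⊆ O₀ := subset_interior_iff_mem_nhdsSet.2 hχ0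
  have h₁ : ∀ p ∈ O₁, σ p = ρ p := fun p hp => by
    have : χ p = 1 := interior_subset (s := {p | χ p = 1}) hp
    simp [hσ, this]
  have h₀ : ∀ p ∈ O₀, σ p = ρ' p := fun p hp => by
    have : χ p = 0 := interior_subset (s := {p | χ p = 0}) hp
    simp [hσ, this]
  refine ⟨(O₁ ∩ U) ∪ (O₀ ∩ U') ∪ Q, σ, ((isOpen_interior.inter hU).union
    (isOpen_interior.inter hU')).union hQo, ?_, ?_, ?_⟩
  · rintro _ ⟨z, hz | hz, rfl⟩
    · exact Or.inl (Or.inl ⟨hO₁ ⟨z, hz, rfl⟩, hKU ⟨z, hz, rfl⟩⟩)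
    · have hzU' : i z ∈ U' := hK'U ⟨z, hz, rfl⟩
      -- Points of K' in U lie in Q; those outside U lie where χ is locally zero, so that σ is ρ'
      -- nearby.
      by_cases hzU : i z ∈ U
      · right
        have e1 := hr z hzU
        have e2 := hr' z hzU'
        have hzs := hK's hz
        refine ⟨⟨⟨hzU, ?_⟩, hzU', ?_⟩, ?_⟩
        · rw [mem_preimage, e1]; exact hzs
        · rw [mem_preimage, e2]; exact hzs
        · have : c (i z) = ψ z := by
            simp only [hc, e1, e2]
            rw [← add_smul, add_sub_cancel, one_smul]
          rw [mem_preimage, this]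
          exact ψ.map_source hzs
      · exact Or.inl (Or.inr ⟨hO₀ hzU, hzU'⟩)
  · have hsm : ∀ (O : Set M) (τ : M → Z), IsOpen O → (∀ p ∈ O, σ p = τ p) → ∀ p ∈ O,
        ContMDiffAt 𝓘(ℝ, E) 𝓘(ℝ, F) ∞ τ p → ContMDiffAt 𝓘(ℝ, E) 𝓘(ℝ, F) ∞ σ p := by
      intro O τ hO hτ p hp h
      refine h.congr_of_eventuallyEq ?_
      filter_upwards [hO.mem_nhds hp] with q hq using hτ q hq
    intro p hp
    refine ContMDiffAt.contMDiffWithinAt ?_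
    rcases hp with (⟨hp, hpU⟩ | ⟨hp, hpU'⟩) | hp
    · exact hsm O₁ ρ isOpen_interior h₁ p hp (hρ.contMDiffAt (hU.mem_nhds hpU))
    · exact hsm O₀ ρ' isOpen_interior h₀ p hp (hρ'.contMDiffAt (hU'.mem_nhds hpU'))
    · exact hsm Q _ hQo hσQ p hp ((hψ' _ hp.2).comp p (hcs p hp.1))
  · rintro z ((⟨hp, hpU⟩ | ⟨hp, hpU'⟩) | hp)
    · rw [h₁ _ hp, hr z hpU]
    · rw [h₀ _ hp, hr' z hpU']
    · rw [hσQ _ hp]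
      obtain ⟨⟨⟨hpU, hpρ⟩, hpU', hpρ'⟩, hpc⟩ := hp
      have e1 := hr z hpU
      have e2 := hr' z hpU'
      have : c (i z) = ψ z := by
        simp only [hc, e1, e2]
        rw [← add_smul, add_sub_cancel, one_smul]
      rw [this]
      rw [mem_preimage, e1] at hpρ
      exact ψ.left_inv hpρ

/-- Cover Z by finitely many closed sets, each inside a chart domain and the domain of a local
retraction, and glue them in one at a time. -/
theorem exists_retraction [CompactSpace Z] [T2Space Z] [Nonempty Z] {i : Z → M}
    (hi : Manifold.IsSmoothEmbedding 𝓘(ℝ, F) 𝓘(ℝ, E) ∞ i) :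
    ∃ (U : Set M) (ρ : M → Z), IsOpen U ∧ range i ⊆ U ∧ ContMDiffOn 𝓘(ℝ, E) 𝓘(ℝ, F) ∞ ρ U ∧
      ∀ z, ρ (i z) = z := by
  have hic : Continuous i := hi.isEmbedding.continuous
  choose U' ρ' hU' hzU' hρ' hr' using exists_local_retraction hi
  have hK : ∀ s : Z, ∃ K ∈ 𝓝 s, IsClosed K ∧ K ⊆ (chartAt F s).source ∩ i ⁻¹' U' s := fun s =>
    exists_mem_nhds_isClosed_subset (Filter.inter_mem
      ((chartAt F s).open_source.mem_nhds (mem_chart_source F s))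
      (((hU' s).preimage hic).mem_nhds (hzU' s)))
  choose K hKn hKc hKs using hK
  have key : ∀ S : Finset Z, ∃ (V : Set M) (σ : M → Z), IsOpen V ∧ i '' (⋃ s ∈ S, K s) ⊆ V ∧
      ContMDiffOn 𝓘(ℝ, E) 𝓘(ℝ, F) ∞ σ V ∧ ∀ z, i z ∈ V → σ (i z) = z := by
    classical
    intro S
    induction S using Finset.induction_on with
    | empty =>
      refine ⟨∅, fun _ => Classical.arbitrary Z, isOpen_empty, by simp, ?_, by simp⟩
      intro p hp
      exact hp.elim
    | insert s S _ ih =>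
      obtain ⟨V, σ, hV, hVK, hσ, hσr⟩ := ih
      have hc : IsCompact (⋃ s ∈ S, K s) := S.isCompact_biUnion fun s _ => (hKc s).isCompact
      have := exists_glued_retraction hic hc hV (hU' s) hσ (hρ' s) hσr (hr' s) hVK
        (s := s) (K' := K s) (fun z hz => (hKs s hz).1)
        (by rintro _ ⟨z, hz, rfl⟩; exact (hKs s hz).2)
      rw [Finset.set_biUnion_insert, union_comm]
      exact this
  obtain ⟨S, -, hS⟩ := isCompact_univ.elim_nhds_subcover K fun s _ => hKn s
  obtain ⟨V, σ, hV, hVK, hσ, hσr⟩ := key S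
  have hall : range i ⊆ V := by
    rintro _ ⟨z, rfl⟩
    exact hVK ⟨z, hS (mem_univ z), rfl⟩
  exact ⟨V, σ, hV, hall, hσ, fun z => hσr z (hall ⟨z, rfl⟩)⟩

end Retraction

/-! ### Existence of a tubular neighborhood with normal coordinate x -/

section Tube

open Filter Topology

variable {E : Type*} [NormedAddCommGroup E] [NormedSpace ℝ E] [FiniteDimensional ℝ E]
  {M : Type*} [TopologicalSpace M] [ChartedSpace E M] [IsManifold 𝓘(ℝ, E) ∞ M]
  {F : Type*} [NormedAddCommGroup F] [NormedSpace ℝ F] [FiniteDimensional ℝ F]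
  {Z : Type*} [TopologicalSpace Z] [ChartedSpace F Z] [IsManifold 𝓘(ℝ, F) ∞ Z]

/-- A retraction onto the hypersurface and the defining function are local coordinates. -/
theorem exists_local_straightening (hEF : Module.finrank ℝ E = Module.finrank ℝ F + 1)
    {x : M → ℝ} (hx : IsDefiningFunction (E := E) x) {i : Z → M}
    (hi : ContMDiff 𝓘(ℝ, F) 𝓘(ℝ, E) ∞ i) (hxi : ∀ z, x (i z) = 0) {U : Set M} {ρ : M → Z}
    (hU : IsOpen U) (hiU : ∀ z, i z ∈ U) (hρ : ContMDiffOn 𝓘(ℝ, E) 𝓘(ℝ, F) ∞ ρ U)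
    (hr : ∀ z, ρ (i z) = z) (z₀ : Z) :
    ∃ H : OpenPartialHomeomorph M (Z × ℝ), i z₀ ∈ H.source ∧ H.source ⊆ U ∧
      (∀ p ∈ H.source, H p = (ρ p, x p)) ∧
      ContMDiffOn (𝓘(ℝ, F).prod 𝓘(ℝ, ℝ)) 𝓘(ℝ, E) ∞ H.symm H.target := by
  have : CompleteSpace E := FiniteDimensional.complete ℝ E
  have : CompleteSpace F := FiniteDimensional.complete ℝ F
  set p₀ := i z₀ with hp₀
  set φ := chartAt E p₀
  set ψ := chartAt F z₀
  have hφ' : ∀ y ∈ φ.target, ContMDiffAt 𝓘(ℝ, E) 𝓘(ℝ, E) ∞ φ.symm y := fun y hy =>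
    contMDiffOn_chart_symm.contMDiffAt (φ.open_target.mem_nhds hy)
  have hψ : ∀ z ∈ ψ.source, ContMDiffAt 𝓘(ℝ, F) 𝓘(ℝ, F) ∞ ψ z := fun z hz =>
    contMDiffOn_chart.contMDiffAt (ψ.open_source.mem_nhds hz)
  set D := φ.target ∩ φ.symm ⁻¹' (U ∩ ρ ⁻¹' ψ.source) with hD
  have hDo : IsOpen D := φ.symm.continuousOn.isOpen_inter_preimage φ.open_target
    (hρ.continuousOn.isOpen_inter_preimage hU ψ.open_source)
  set f : E → F × ℝ := fun y => (ψ (ρ (φ.symm y)), x (φ.symm y)) with hf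
  have hxs : ∀ y ∈ φ.target, ContDiffAt ℝ ∞ (fun y => x (φ.symm y)) y := fun y hy =>
    (hx.1.contMDiffAt.comp y (hφ' y hy)).contDiffAt
  have hfs : ∀ y ∈ D, ContDiffAt ℝ ∞ f y := by
    rintro y ⟨hy, hyU, hyρ⟩
    refine ContDiffAt.prodMk ?_ (hxs y hy)
    exact (((hψ _ hyρ).comp (φ.symm y) (hρ.contMDiffAt (hU.mem_nhds hyU))).comp y
      (hφ' y hy)).contDiffAt
  set y₀ := φ p₀ with hy₀
  have hp₀s : p₀ ∈ φ.source := mem_chart_source E p₀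
  have hz₀s : z₀ ∈ ψ.source := mem_chart_source F z₀
  have hy₀D : y₀ ∈ D := by
    refine ⟨φ.map_source hp₀s, ?_⟩
    rw [mem_preimage, φ.left_inv hp₀s]
    refine ⟨hiU z₀, ?_⟩
    rw [mem_preimage, hr]
    exact hz₀s
  -- the derivative at the base point is bijective
  have hsurj : Function.Surjective (fderiv ℝ f y₀) := by
    set j : F → E := fun u => φ (i (ψ.symm u)) with hj
    set u₀ := ψ z₀
    have hu₀ : ψ.symm u₀ = z₀ := ψ.left_inv hz₀s
    have hju₀ : j u₀ = y₀ := by simp only [hj, hu₀]; rfl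
    have hjd : ContDiffAt ℝ ∞ j u₀ := by
      have h1 : ContMDiffAt 𝓘(ℝ, F) 𝓘(ℝ, F) ∞ ψ.symm u₀ :=
        contMDiffOn_chart_symm.contMDiffAt (ψ.open_target.mem_nhds (ψ.map_source hz₀s))
      have h2 : ContMDiffAt 𝓘(ℝ, E) 𝓘(ℝ, E) ∞ φ (i (ψ.symm u₀)) := by
        rw [hu₀]
        exact contMDiffOn_chart.contMDiffAt (φ.open_source.mem_nhds hp₀s)
      exact (h2.comp u₀ (hi.contMDiffAt.comp u₀ h1)).contDiffAt
    have hfj : f ∘ j =ᶠ[𝓝 u₀] fun u => (u, 0) := by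
      have hcont : ContinuousAt (fun u => i (ψ.symm u)) u₀ :=
        hi.continuous.continuousAt.comp (ψ.symm.continuousAt (ψ.map_source hz₀s))
      have h1 : ∀ᶠ u in 𝓝 u₀, i (ψ.symm u) ∈ φ.source :=
        hcont.eventually (φ.open_source.mem_nhds (by
          change i (ψ.symm u₀) ∈ φ.source
          rw [hu₀]; exact hp₀s))
      filter_upwards [h1, ψ.open_target.mem_nhds (ψ.map_source hz₀s)] with u h1 h2
      simp only [hf, hj, Function.comp_apply, φ.left_inv h1, hr, hxi, ψ.right_inv h2]
    have hder : (fderiv ℝ f y₀).comp (fderiv ℝ j u₀) = ContinuousLinearMap.inl ℝ F ℝ := by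
      have h1 := fderiv_comp u₀ (g := f) (f := j)
        (by rw [hju₀]; exact (hfs y₀ hy₀D).differentiableAt (by simp))
        (hjd.differentiableAt (by simp))
      rw [hju₀, hfj.fderiv_eq] at h1
      rw [← h1]
      exact (hasFDerivAt_prodMk_left u₀ (0 : ℝ)).fderiv
    have hsnd : ∀ v, (fderiv ℝ f y₀ v).2 = fderiv ℝ (fun y => x (φ.symm y)) y₀ v := by
      intro v
      have h1 : HasFDerivAt f (fderiv ℝ f y₀) y₀ :=
        ((hfs y₀ hy₀D).differentiableAt (by simp)).hasFDerivAt
      exact congrArg (fun l : E →L[ℝ] ℝ => l v) h1.snd.fderiv.symm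
    -- Along Z the derivative of (ρ, x) is the inclusion of F. A vector with dx = 1, which exists
    -- because 0 is a regular value, supplies the missing direction; equality of dimensions then
    -- gives bijectivity.
    obtain ⟨v₀, hv₀⟩ : ∃ v₀, (fderiv ℝ f y₀ v₀).2 = 1 := by
      have h1 : MDifferentiableAt 𝓘(ℝ, E) 𝓘(ℝ, ℝ) x (φ.symm y₀) :=
        hx.1.contMDiffAt.mdifferentiableAt (by simp)
      have h2 : MDifferentiableAt 𝓘(ℝ, E) 𝓘(ℝ, E) φ.symm y₀ :=
        (hφ' y₀ hy₀D.1).mdifferentiableAt (by simp)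
      have h3 := mfderiv_comp y₀ h1 h2
      have hp : φ.symm y₀ = p₀ := φ.left_inv hp₀s
      have h4 : Function.Surjective (mfderiv 𝓘(ℝ, E) 𝓘(ℝ, ℝ) x (φ.symm y₀)) :=
        hx.2 _ (by rw [hp]; exact hxi z₀)
      have h5 : Function.Surjective (mfderiv 𝓘(ℝ, E) 𝓘(ℝ, E) φ.symm y₀) := by
        have h6 : MDifferentiableAt 𝓘(ℝ, E) 𝓘(ℝ, E) φ (φ.symm y₀) := by
          rw [hp]
          exact (contMDiffOn_chart.contMDiffAt (n := ∞)
            (φ.open_source.mem_nhds hp₀s)).mdifferentiableAt (by simp)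
        have h6' : MDifferentiableAt 𝓘(ℝ, E) 𝓘(ℝ, E) φ.symm (φ (φ.symm y₀)) := by
          rw [hp]
          exact h2
        have h7 := mfderiv_comp (φ.symm y₀) h6' h6
        have h8 : φ.symm ∘ φ =ᶠ[𝓝 (φ.symm y₀)] id := by
          rw [hp]
          filter_upwards [φ.open_source.mem_nhds hp₀s] with q hq using φ.left_inv hq
        rw [h8.mfderiv_eq, mfderiv_id] at h7
        have hpy : φ (φ.symm y₀) = y₀ := by rw [hp]
        intro v
        refine ⟨mfderiv 𝓘(ℝ, E) 𝓘(ℝ, E) φ (φ.symm y₀) v, ?_⟩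
        have h9 := congrArg (fun l : E →L[ℝ] E => l v) h7
        have h10 : v = mfderiv 𝓘(ℝ, E) 𝓘(ℝ, E) φ.symm (φ (φ.symm y₀))
          (mfderiv 𝓘(ℝ, E) 𝓘(ℝ, E) φ (φ.symm y₀) v) := h9
        rw [hpy] at h10
        exact h10.symm
      obtain ⟨v₁, hv₁⟩ := h4 (1 : ℝ)
      obtain ⟨v₂, hv₂⟩ := h5 v₁
      refine ⟨v₂, ?_⟩
      refine (hsnd v₂).trans ?_
      rw [← mfderiv_eq_fderiv]
      have h9 := congrArg (fun l : E →L[ℝ] ℝ => l v₂) h3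
      refine h9.trans ?_
      change mfderiv 𝓘(ℝ, E) 𝓘(ℝ, ℝ) x (φ.symm y₀) (mfderiv 𝓘(ℝ, E) 𝓘(ℝ, E) φ.symm y₀ v₂) = 1
      rw [hv₂]
      exact hv₁
    rintro ⟨u, t⟩
    refine ⟨t • v₀ + fderiv ℝ j u₀ (u - t • (fderiv ℝ f y₀ v₀).1), ?_⟩
    have h1 : ∀ u, fderiv ℝ f y₀ (fderiv ℝ j u₀ u) = (u, 0) := fun u =>
      congrArg (fun l : F →L[ℝ] F × ℝ => l u) hder
    rw [map_add, map_smul, h1]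
    ext
    · simp
    · simp [hv₀]
  have hdim : Module.finrank ℝ E = Module.finrank ℝ (F × ℝ) := by simp [hEF]
  have hinj : Function.Injective (fderiv ℝ f y₀) :=
    (LinearMap.injective_iff_surjective_of_finrank_eq_finrank hdim
      (f := (fderiv ℝ f y₀ : E →ₗ[ℝ] F × ℝ))).2 hsurj
  let f' : E ≃L[ℝ] F × ℝ := ContinuousLinearEquiv.ofBijective (fderiv ℝ f y₀)
    (LinearMap.ker_eq_bot.2 hinj) (LinearMap.range_eq_top.2 hsurj)
  have hf' : HasFDerivAt f (f' : E →L[ℝ] F × ℝ) y₀ := by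
    have : (f' : E →L[ℝ] F × ℝ) = fderiv ℝ f y₀ := ContinuousLinearEquiv.coe_ofBijective _ _ _
    rw [this]
    exact ((hfs y₀ hy₀D).differentiableAt (by simp)).hasFDerivAt
  -- Restricting to points with invertible derivative makes the local inverse smooth on its whole
  -- domain, not only at the base point.
  set D₁ := D ∩ fderiv ℝ f ⁻¹' range ContinuousLinearEquiv.toContinuousLinearMap with hD₁
  have hfc : ContinuousOn (fderiv ℝ f) D := by
    have : ContDiffOn ℝ ∞ f D := fun y hy => (hfs y hy).contDiffWithinAt
    exact this.continuousOn_fderiv_of_isOpen hDo (by simp)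
  have hD₁o : IsOpen D₁ := hfc.isOpen_inter_preimage hDo ContinuousLinearEquiv.isOpen
  set e := ((hfs y₀ hy₀D).toOpenPartialHomeomorph f hf' (by simp)).restrOpen D₁ hD₁o with he
  have hec : ∀ y, e y = f y := fun y => rfl
  have hes : e.source ⊆ D₁ := by
    intro y hy
    rw [he, OpenPartialHomeomorph.restrOpen_source] at hy
    exact hy.2
  have hy₀e : y₀ ∈ e.source := by
    rw [he, OpenPartialHomeomorph.restrOpen_source]
    exact ⟨ContDiffAt.mem_toOpenPartialHomeomorph_source _ _ _, hy₀D, ⟨f', hf'.fderiv.symm⟩⟩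
  set B := ψ.prod (OpenPartialHomeomorph.refl ℝ) with hB
  set H := φ.trans (e.trans B.symm) with hH
  have hHs : ∀ p, p ∈ H.source ↔ p ∈ φ.source ∧ φ p ∈ e.source ∧ (f (φ p)).1 ∈ ψ.target := by
    intro p
    simp [hH, hB, hec]
  refine ⟨H, ?_, ?_, ?_, ?_⟩
  · rw [hHs]
    refine ⟨hp₀s, hy₀e, ?_⟩
    change ψ (ρ (φ.symm (φ p₀))) ∈ ψ.target
    rw [φ.left_inv hp₀s, hr]
    exact ψ.map_source hz₀s
  · intro p hp
    obtain ⟨h1, h2, h3⟩ := (hHs p).1 hp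
    have := (hes h2).1.2.1
    rwa [φ.left_inv h1] at this
  · intro p hp
    obtain ⟨h1, h2, h3⟩ := (hHs p).1 hp
    have h4 : (ρ (φ.symm (φ p))) ∈ ψ.source := (hes h2).1.2.2
    change (ψ.symm (ψ (ρ (φ.symm (φ p)))), x (φ.symm (φ p))) = _
    rw [ψ.left_inv h4, φ.left_inv h1]
  · intro q hq
    have hq' : q.1 ∈ ψ.source ∧ (ψ q.1, q.2) ∈ e.target ∧ e.symm (ψ q.1, q.2) ∈ φ.target := by
      simpa [hH, hB, and_assoc] using hq
    obtain ⟨h1, h2, h3⟩ := hq'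
    refine ContMDiffAt.contMDiffWithinAt ?_
    have g1 : ContMDiffAt (𝓘(ℝ, F).prod 𝓘(ℝ, ℝ)) 𝓘(ℝ, F × ℝ) ∞
        (fun q : Z × ℝ => (ψ q.1, q.2)) q :=
      ((hψ _ h1).comp q contMDiffAt_fst).prodMk_space contMDiffAt_snd
    obtain ⟨f₁, hf₁⟩ := (hes (e.map_target h2)).2
    have h4 : ContDiffAt ℝ ∞ f (e.symm (ψ q.1, q.2)) := hfs _ (hes (e.map_target h2)).1
    have g2 : ContDiffAt ℝ ∞ e.symm (ψ q.1, q.2) := by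
      refine e.contDiffAt_symm h2 (f₀' := f₁) ?_ h4
      rw [hf₁]
      exact (h4.differentiableAt (by simp)).hasFDerivAt
    exact ContMDiffAt.comp (g := φ.symm) (f := e.symm ∘ fun q : Z × ℝ => (ψ q.1, q.2)) q
      (hφ' _ h3) (g2.contMDiffAt.comp q g1)

/-- The map (ρ, x) is a local diffeomorphism near Z and injective on the compact set Z, hence
injective on a neighborhood. The tube lemma puts some Z × (-δ, δ) inside its image, and the tube is
the inverse. -/
theorem exists_tube [CompactSpace M] [T2Space M] [Nonempty Z]
    (hEF : Module.finrank ℝ E = Module.finrank ℝ F + 1)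
    {x : M → ℝ} (hx : IsDefiningFunction (E := E) x) {i : Z → M}
    (hi : Manifold.IsSmoothEmbedding 𝓘(ℝ, F) 𝓘(ℝ, E) ∞ i) (hZ : range i = {p | x p = 0}) :
    Nonempty (Tube (E := E) (F := F) i x) := by
  have hxi : ∀ z, x (i z) = 0 := fun z => (hZ ▸ mem_range_self z : i z ∈ {p | x p = 0})
  have hic : Continuous i := hi.isEmbedding.continuous
  have hcl : IsClosed (range i) := by
    rw [hZ]; exact isClosed_eq hx.1.continuous continuous_const
  have : T2Space Z := hi.isEmbedding.t2Space
  have : CompactSpace Z := Topology.IsClosedEmbedding.compactSpace ⟨hi.isEmbedding, hcl⟩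
  have : Nonempty M := ⟨i (Classical.arbitrary Z)⟩
  obtain ⟨U, ρ, hU, hiU, hρ, hr⟩ := exists_retraction (E := E) (F := F) hi
  have hiU' : ∀ z, i z ∈ U := fun z => hiU ⟨z, rfl⟩
  choose H hHz hHU hHe hHs using exists_local_straightening hEF hx hi.contMDiff hxi hU hiU' hρ hr
  set Ψ : M → Z × ℝ := fun p => (ρ p, x p) with hΨ
  have hΨi : ∀ z, Ψ (i z) = (z, 0) := fun z => by simp [hΨ, hr, hxi]
  have hΨs : ContMDiffOn 𝓘(ℝ, E) (𝓘(ℝ, F).prod 𝓘(ℝ, ℝ)) ∞ Ψ U := hρ.prodMk hx.1.contMDiffOn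
  have hinjH : ∀ z, InjOn Ψ (H z).source := fun z p hp q hq h =>
    (H z).injOn hp hq (by rw [hHe z p hp, hHe z q hq]; exact h)
  obtain ⟨N₁, hN₁, hN₁inj⟩ := Set.InjOn.exists_mem_nhdsSet (f := Ψ) (s := range i)
    (by rintro _ ⟨z, rfl⟩ _ ⟨z', rfl⟩ h
        rw [hΨi, hΨi] at h
        rw [(Prod.mk.inj h).1])
    (isCompact_range hic)
    (by rintro _ ⟨z, rfl⟩
        exact (hΨs.contMDiffAt (hU.mem_nhds (hiU' z))).continuousAt)
    (by rintro _ ⟨z, rfl⟩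
        exact ⟨(H z).source, (H z).open_source.mem_nhds (hHz z), hinjH z⟩)
  obtain ⟨N₂, hN₂o, hiN₂, hN₂⟩ := mem_nhdsSet_iff_exists.1 hN₁
  set N := N₂ ∩ ⋃ z, (H z).source with hN
  have hNo : IsOpen N := hN₂o.inter (isOpen_iUnion fun z => (H z).open_source)
  have hiN : ∀ z, i z ∈ N := fun z => ⟨hiN₂ ⟨z, rfl⟩, mem_iUnion.2 ⟨z, hHz z⟩⟩
  have hNinj : InjOn Ψ N := hN₁inj.mono fun p hp => hN₂ hp.1
  have hNU : N ⊆ U := fun p hp => by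
    obtain ⟨z, hz⟩ := mem_iUnion.1 hp.2
    exact hHU z hz
  have hopen : ∀ s : Set M, IsOpen s → s ⊆ N → IsOpen (Ψ '' s) := by
    intro s hs hsN
    have : Ψ '' s = ⋃ z, H z '' (s ∩ (H z).source) := by
      ext q
      simp only [mem_image, mem_iUnion]
      constructor
      · rintro ⟨p, hp, rfl⟩
        obtain ⟨z, hz⟩ := mem_iUnion.1 (hsN hp).2
        exact ⟨z, p, ⟨hp, hz⟩, hHe z p hz⟩
      · rintro ⟨z, p, ⟨hp, hz⟩, rfl⟩
        exact ⟨p, hp, (hHe z p hz).symm⟩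
    rw [this]
    exact isOpen_iUnion fun z => (H z).isOpen_image_of_subset_source (hs.inter (H z).open_source)
      inter_subset_right
  let P : OpenPartialHomeomorph M (Z × ℝ) := OpenPartialHomeomorph.ofContinuousOpenRestrict
    (hNinj.toPartialEquiv Ψ N) (hΨs.continuousOn.mono hNU)
    (by
      intro s hs
      have h1 : (hNinj.toPartialEquiv Ψ N).source.domRestrict (hNinj.toPartialEquiv Ψ N) '' s =
          Ψ '' (Subtype.val '' s) := by
        rw [image_image]; rfl
      rw [h1]
      refine hopen _ (hNo.isOpenMap_subtype_val s hs) ?_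
      rintro _ ⟨p, -, rfl⟩
      exact p.2) hNo
  have hPs : P.source = N := rfl
  have hPc : ∀ p, P p = Ψ p := fun _ => rfl
  have h0t : (univ : Set Z) ×ˢ ({0} : Set ℝ) ⊆ P.target := by
    rintro ⟨z, t⟩ ⟨-, ht⟩
    rw [mem_singleton_iff] at ht
    subst ht
    rw [← hΨi z]
    exact P.map_source (hiN z)
  obtain ⟨u, v, -, hv, hu, h0v, huv⟩ :=
    generalized_tube_lemma isCompact_univ isCompact_singleton P.open_target h0t
  obtain ⟨δ, hδ, hδv⟩ := Metric.isOpen_iff.1 hv 0 (h0v rfl)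
  have hsub : (univ : Set Z) ×ˢ Ioo (-δ) δ ⊆ P.target := by
    rintro ⟨z, t⟩ ⟨-, ht⟩
    refine huv ⟨hu (mem_univ z), hδv ?_⟩
    rw [Metric.mem_ball, dist_zero_right, Real.norm_eq_abs, abs_lt]
    exact ht
  have hSo : IsOpen ((univ : Set Z) ×ˢ Ioo (-δ) δ) := isOpen_univ.prod isOpen_Ioo
  let Φ := P.symm.restrOpen _ hSo
  have hΦs : Φ.source = univ ×ˢ Ioo (-δ) δ := by
    rw [OpenPartialHomeomorph.restrOpen_source]
    exact inter_eq_right.2 hsub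
  have hΦt : Φ.target ⊆ N := by
    intro p hp
    have h1 := P.map_target (hsub (hΦs ▸ Φ.map_target hp))
    have h2 : P.symm (Φ.symm p) = p := Φ.right_inv hp
    rwa [h2] at h1
  have hΨΦ : ∀ q ∈ Φ.source, Ψ (Φ q) = q := fun q hq => P.right_inv (hsub (hΦs ▸ hq))
  refine ⟨⟨δ, hδ, Φ, hΦs, ?_, ?_, ?_, ?_⟩⟩
  · intro q hq
    have hp : Φ q ∈ N := hΦt (Φ.map_source hq)
    obtain ⟨z, hz⟩ := mem_iUnion.1 hp.2
    have hqt : q ∈ (H z).target := by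
      have := (H z).map_source hz
      rw [hHe z _ hz] at this
      rwa [← hΨΦ q hq]
    have hsymm : (H z).symm q = Φ q := by
      conv_lhs => rw [← hΨΦ q hq]
      rw [show Ψ (Φ q) = H z (Φ q) from (hHe z _ hz).symm, (H z).left_inv hz]
    refine ContMDiffAt.contMDiffWithinAt ?_
    refine ((hHs z).contMDiffAt ((H z).open_target.mem_nhds hqt)).congr_of_eventuallyEq ?_
    -- Near q, injectivity of Ψ on N identifies Φ with the smooth local inverse (H z).symm.
    have hN' : ∀ᶠ q' in 𝓝 q, (H z).symm q' ∈ N :=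
      ((H z).symm.continuousAt hqt).eventually (hNo.mem_nhds (by rw [hsymm]; exact hp))
    filter_upwards [Φ.open_source.mem_nhds hq, (H z).open_target.mem_nhds hqt, hN']
      with q' h1 h2 h3
    refine hNinj (hΦt (Φ.map_source h1)) h3 ?_
    rw [hΨΦ q' h1]
    have h4 := hHe z _ ((H z).map_target h2)
    rw [(H z).right_inv h2] at h4
    exact h4
  · exact hΨs.mono fun p hp => hNU (hΦt hp)
  · intro z
    refine hNinj (hΦt (Φ.map_source ?_)) (hiN z) ?_
    · rw [hΦs]; exact ⟨mem_univ _, by simp [hδ]⟩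
    · rw [hΨi, hΨΦ]
      rw [hΦs]; exact ⟨mem_univ _, by simp [hδ]⟩
  · intro z t ht
    have h1 : ((z, t) : Z × ℝ) ∈ Φ.source := by
      rw [hΦs]; exact ⟨mem_univ _, ht⟩
    exact (Prod.mk.inj (hΨΦ _ h1)).2

end Tube

/-! ### Wedge products and differentials in a parametrization -/

section RepAlgebra

open Filter Topology

variable {E : Type*} [NormedAddCommGroup E] [NormedSpace ℝ E]
  {M : Type*} [TopologicalSpace M] [ChartedSpace E M]
  {X : Type*} [NormedAddCommGroup X] [NormedSpace ℝ X]

theorem rep_wedge (g : X → M) (a b : DForm E M 1) (y : X) :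
    rep g (fun p => wedge (a p) (b p)) y = wedge (rep g a y) (rep g b y) :=
  wedge_comp _ _ _

theorem rep_bValue (g : X → M) (m : ℕ) (x : M → ℝ) (a : DForm E M 1) (b : DForm E M 2) (y : X) :
    rep g (bValue m x a b) y =
      wedge (rep g a y) ((x (g y) ^ m)⁻¹ • rep g (dForm (E := E) x) y) + rep g b y := by
  have h := wedge_comp (a (g y)) ((x (g y) ^ m)⁻¹ • dForm (E := E) x (g y))
    (mfderiv 𝓘(ℝ, X) 𝓘(ℝ, E) g y)
  exact congrArg (fun η : X [⋀^Fin 2]→L[ℝ] ℝ => η + rep g b y) h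

theorem rep_congr_form {k : ℕ} {g : X → M} {a a' : DForm E M k} {y : X}
    (h : a (g y) = a' (g y)) : rep g a y = rep g a' y := by
  simp only [rep, pullback]
  rw [h]

theorem rep_dForm {g : X → M} {x : M → ℝ} {y : X}
    (hg : MDifferentiableAt 𝓘(ℝ, X) 𝓘(ℝ, E) g y)
    (hx : MDifferentiableAt 𝓘(ℝ, E) 𝓘(ℝ, ℝ) x (g y)) :
    rep g (dForm (E := E) x) y = covector (fderiv ℝ (x ∘ g) y) := by
  refine ext_single fun u => ?_
  rw [covector_apply, ← mfderiv_eq_fderiv, mfderiv_comp y hx hg]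
  rfl

/-- The derivatives of G and of its inverse cancel, so a form is recovered from its expression;
identities between forms may therefore be checked in coordinates. -/
theorem IsParam.apply_eq_rep {G : OpenPartialHomeomorph X M} (hG : IsParam (E := E) G) {k : ℕ}
    (a : DForm E M k) {y : X} (hy : y ∈ G.source) (v : Fin k → TangentSpace 𝓘(ℝ, E) (G y)) :
    a (G y) v = rep G a y fun l => (mfderiv 𝓘(ℝ, E) 𝓘(ℝ, X) G.symm (G y) (v l) : X) := by
  have h1 : MDifferentiableAt 𝓘(ℝ, E) 𝓘(ℝ, X) G.symm (G y) :=
    (hG.contMDiffOn_symm.contMDiffAt (G.open_target.mem_nhds (G.map_source hy))).mdifferentiableAt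
      (by simp)
  have h2 : MDifferentiableAt 𝓘(ℝ, X) 𝓘(ℝ, E) G (G.symm (G y)) := by
    rw [G.left_inv hy]
    exact (hG.contMDiffOn.contMDiffAt (G.open_source.mem_nhds hy)).mdifferentiableAt (by simp)
  have h3 := mfderiv_comp (G y) h2 h1
  have h4 : G ∘ G.symm =ᶠ[𝓝 (G y)] id := by
    filter_upwards [G.open_target.mem_nhds (G.map_source hy)] with q hq using G.right_inv hq
  rw [h4.mfderiv_eq, mfderiv_id, G.left_inv hy] at h3
  change a (G y) v = a (G y) fun l => mfderiv 𝓘(ℝ, X) 𝓘(ℝ, E) G y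
    (mfderiv 𝓘(ℝ, E) 𝓘(ℝ, X) G.symm (G y) (v l))
  congr 1
  funext l
  exact congrArg (fun L : E →L[ℝ] E => L (v l)) h3

theorem IsParam.form_eq_of_rep_eq {G : OpenPartialHomeomorph X M} (hG : IsParam (E := E) G)
    {k : ℕ} {a b : DForm E M k} {y : X} (hy : y ∈ G.source) (h : rep G a y = rep G b y) :
    a (G y) = b (G y) := by
  ext v
  rw [hG.apply_eq_rep a hy, hG.apply_eq_rep b hy, h]

theorem isParam_chartAt_symm [IsManifold 𝓘(ℝ, E) ∞ M] (p : M) :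
    IsParam (E := E) (X := E) (chartAt E p).symm :=
  ⟨contMDiffOn_chart_symm, contMDiffOn_chart⟩

end RepAlgebra

/-! ### Coordinates (y, t) on the tube, in which x is t and π is the projection -/

section TubeCoordinates

open Filter Topology

variable {E : Type*} [NormedAddCommGroup E] [NormedSpace ℝ E]
  {M : Type*} [TopologicalSpace M] [ChartedSpace E M]
  {F : Type*} [NormedAddCommGroup F] [NormedSpace ℝ F]
  {Z : Type*} [TopologicalSpace Z] [ChartedSpace F Z]
  {i : Z → M} {x : M → ℝ}

namespace Tube

/-- The coordinates on a tubular neighborhood given by a chart of the hypersurface and `x`. -/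
noncomputable def param (T : Tube (E := E) (F := F) i x) (z₀ : Z) :
    OpenPartialHomeomorph (F × ℝ) M :=
  ((chartAt F z₀).symm.prod (OpenPartialHomeomorph.refl ℝ)).trans T.Φ

theorem param_apply (T : Tube (E := E) (F := F) i x) (z₀ : Z) (p : F × ℝ) :
    T.param z₀ p = T.Φ ((chartAt F z₀).symm p.1, p.2) := rfl

theorem param_source (T : Tube (E := E) (F := F) i x) (z₀ : Z) :
    (T.param z₀).source = (chartAt F z₀).target ×ˢ Ioo (-T.δ) T.δ := by
  ext p
  simp only [param, OpenPartialHomeomorph.trans_source, T.source_eq]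
  simp

theorem mem_source (T : Tube (E := E) (F := F) i x) {z : Z} {t : ℝ} (ht : t ∈ Ioo (-T.δ) T.δ) :
    (z, t) ∈ T.Φ.source := by
  rw [T.source_eq]; exact ⟨mem_univ _, ht⟩

theorem zero_mem (T : Tube (E := E) (F := F) i x) : (0 : ℝ) ∈ Ioo (-T.δ) T.δ := by
  simp [T.δ_pos]

theorem param_mem_nbhd (T : Tube (E := E) (F := F) i x) (z₀ : Z) {p : F × ℝ}
    (hp : p ∈ (T.param z₀).source) : T.param z₀ p ∈ T.nbhd := by
  rw [param_source] at hp
  exact T.Φ.map_source (T.mem_source hp.2)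

theorem x_param (T : Tube (E := E) (F := F) i x) (z₀ : Z) {p : F × ℝ}
    (hp : p ∈ (T.param z₀).source) : x (T.param z₀ p) = p.2 := by
  rw [param_source] at hp
  exact T.normal_coord _ _ hp.2

theorem proj_param (T : Tube (E := E) (F := F) i x) (z₀ : Z) {p : F × ℝ}
    (hp : p ∈ (T.param z₀).source) : T.proj (T.param z₀ p) = (chartAt F z₀).symm p.1 := by
  rw [param_source] at hp
  simp only [proj, param_apply]
  rw [T.Φ.left_inv (T.mem_source hp.2)]

theorem mem_param_target (T : Tube (E := E) (F := F) i x) {q : M} (hq : q ∈ T.nbhd) :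
    q ∈ (T.param (T.proj q)).target := by
  have h1 : T.Φ.symm q ∈ T.Φ.source := T.Φ.map_target hq
  have h2 : (chartAt F (T.proj q)) (T.proj q) ∈ (chartAt F (T.proj q)).target :=
    (chartAt F (T.proj q)).map_source (mem_chart_source F _)
  have h3 : ((chartAt F (T.proj q)) (T.proj q), (T.Φ.symm q).2) ∈ (T.param (T.proj q)).source := by
    rw [param_source]
    rw [T.source_eq] at h1
    exact ⟨h2, h1.2⟩
  have h4 : T.param (T.proj q) ((chartAt F (T.proj q)) (T.proj q), (T.Φ.symm q).2) = q := by
    rw [param_apply]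
    simp only
    rw [(chartAt F (T.proj q)).left_inv (mem_chart_source F _)]
    exact T.Φ.right_inv hq
  have h5 := (T.param (T.proj q)).map_source h3
  rwa [h4] at h5

theorem isOpen_nbhd (T : Tube (E := E) (F := F) i x) : IsOpen T.nbhd := T.Φ.open_target

variable [IsManifold 𝓘(ℝ, F) ∞ Z]

theorem isParam_param (T : Tube (E := E) (F := F) i x) (z₀ : Z) :
    IsParam (E := E) (T.param z₀) := by
  constructor
  · intro p hp
    have hp' := hp
    rw [param_source] at hp'
    have h1 : ContMDiffAt 𝓘(ℝ, F × ℝ) 𝓘(ℝ, F) ∞ (fun p : F × ℝ => (chartAt F z₀).symm p.1) p :=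
      (contMDiffOn_chart_symm.contMDiffAt ((chartAt F z₀).open_target.mem_nhds hp'.1)).comp p
        contDiff_fst.contMDiff.contMDiffAt
    have h2 : ContMDiffAt 𝓘(ℝ, F × ℝ) 𝓘(ℝ, ℝ) ∞ (fun p : F × ℝ => p.2) p :=
      contDiff_snd.contMDiff.contMDiffAt
    exact ((T.contMDiffOn.contMDiffAt (T.Φ.open_source.mem_nhds (T.mem_source hp'.2))).comp p
      (h1.prodMk h2)).contMDiffWithinAt
  · intro q hq
    have hq1 : q ∈ T.Φ.target := by
      rw [← (T.param z₀).right_inv hq]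
      exact T.param_mem_nbhd z₀ ((T.param z₀).map_target hq)
    have hq2 : (T.Φ.symm q).1 ∈ (chartAt F z₀).source := by
      have := T.proj_param z₀ ((T.param z₀).map_target hq)
      rw [(T.param z₀).right_inv hq] at this
      rw [show (T.Φ.symm q).1 = T.proj q from rfl, this]
      have h := (T.param z₀).map_target hq
      rw [param_source] at h
      exact (chartAt F z₀).map_target h.1
    have h1 := T.contMDiffOn_symm.contMDiffAt (T.Φ.open_target.mem_nhds hq1)
    have h2 : ContMDiffAt 𝓘(ℝ, E) 𝓘(ℝ, F) ∞ (fun q => chartAt F z₀ (T.Φ.symm q).1) q :=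
      ContMDiffAt.comp (I' := 𝓘(ℝ, F)) q
        (contMDiffOn_chart.contMDiffAt ((chartAt F z₀).open_source.mem_nhds hq2))
        (contMDiffAt_fst.comp q h1)
    have h3 : ContMDiffAt 𝓘(ℝ, E) 𝓘(ℝ, ℝ) ∞ (fun q => (T.Φ.symm q).2) q :=
      contMDiffAt_snd.comp q h1
    exact (h2.prodMk_space h3).contMDiffWithinAt

omit [IsManifold 𝓘(ℝ, F) ∞ Z] in
theorem contMDiffAt_proj (T : Tube (E := E) (F := F) i x) {q : M} (hq : q ∈ T.nbhd) :
    ContMDiffAt 𝓘(ℝ, E) 𝓘(ℝ, F) ∞ T.proj q :=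
  contMDiffAt_fst.comp q (T.contMDiffOn_symm.contMDiffAt (T.Φ.open_target.mem_nhds hq))

theorem rep_dForm_comp (T : Tube (E := E) (F := F) i x) (hx : ContMDiff 𝓘(ℝ, E) 𝓘(ℝ, ℝ) ∞ x)
    (z₀ : Z) {p : F × ℝ} (hp : p ∈ (T.param z₀).source) {h : ℝ → ℝ}
    (hh : DifferentiableAt ℝ h p.2) :
    rep (T.param z₀) (dForm (E := E) fun q => h (x q)) p =
      deriv h p.2 • covector (ContinuousLinearMap.snd ℝ F ℝ) := by
  have hxp := T.x_param z₀ hp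
  rw [rep_dForm (((T.isParam_param z₀).eventually_mdifferentiableAt hp).self_of_nhds)]
  · have h1 : (fun q => h (x q)) ∘ T.param z₀ =ᶠ[𝓝 p] fun p => h p.2 := by
      filter_upwards [(T.param z₀).open_source.mem_nhds hp] with p' hp'
      simp only [Function.comp_apply, T.x_param z₀ hp']
    have h2 : HasFDerivAt (fun p : F × ℝ => h p.2)
        (deriv h p.2 • ContinuousLinearMap.snd ℝ F ℝ) p :=
      hh.hasDerivAt.comp_hasFDerivAt p hasFDerivAt_snd
    rw [h1.fderiv_eq, h2.fderiv]
    exact ext_single fun u => rfl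
  · have h3 : DifferentiableAt ℝ h (x (T.param z₀ p)) := by rw [hxp]; exact hh
    exact h3.mdifferentiableAt.comp _ (hx.contMDiffAt.mdifferentiableAt (by simp))

theorem rep_dForm (T : Tube (E := E) (F := F) i x) (hx : ContMDiff 𝓘(ℝ, E) 𝓘(ℝ, ℝ) ∞ x)
    (z₀ : Z) {p : F × ℝ} (hp : p ∈ (T.param z₀).source) :
    rep (T.param z₀) (dForm (E := E) x) p = covector (ContinuousLinearMap.snd ℝ F ℝ) := by
  have := T.rep_dForm_comp hx z₀ hp (h := id) differentiableAt_id
  simpa using this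

theorem rep_pullback_proj (T : Tube (E := E) (F := F) i x) {k : ℕ} (a : DForm F Z k)
    (z₀ : Z) {p : F × ℝ} (hp : p ∈ (T.param z₀).source) :
    rep (T.param z₀) (pullback (E := E) (F := F) T.proj a) p =
      (chartRep a z₀ p.1).compContinuousLinearMap (ContinuousLinearMap.fst ℝ F ℝ) := by
  have hp' := hp
  rw [param_source] at hp'
  have h1 : MDifferentiableAt 𝓘(ℝ, F × ℝ) 𝓘(ℝ, E) (T.param z₀) p :=
    ((T.isParam_param z₀).eventually_mdifferentiableAt hp).self_of_nhds
  have h2 : MDifferentiableAt 𝓘(ℝ, E) 𝓘(ℝ, F) T.proj (T.param z₀ p) :=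
    (T.contMDiffAt_proj (T.param_mem_nbhd z₀ hp)).mdifferentiableAt (by simp)
  have h3 : T.proj ∘ T.param z₀ =ᶠ[𝓝 p] (extChartAt 𝓘(ℝ, F) z₀).symm ∘ Prod.fst := by
    filter_upwards [(T.param z₀).open_source.mem_nhds hp] with p' hp'
    exact T.proj_param z₀ hp'
  have h4 : MDifferentiableAt 𝓘(ℝ, F) 𝓘(ℝ, F) (extChartAt 𝓘(ℝ, F) z₀).symm p.1 :=
    (contMDiffAt_extChartAt_symm (by simpa using hp'.1)).mdifferentiableAt (by simp)
  refine ((pullback_comp h2 h1 a).symm.trans ?_ :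
    rep (T.param z₀) (pullback (E := E) (F := F) T.proj a) p = _)
  refine (rep_congr h3 a).trans ?_
  rw [rep_comp (θ := Prod.fst) h4 differentiableAt_fst, fderiv_fst]
  rfl

theorem rep_laurentSum (T : Tube (E := E) (F := F) i x) {m : ℕ} (a : Fin m → DForm F Z 1)
    (z₀ : Z) {p : F × ℝ} (hp : p ∈ (T.param z₀).source) :
    rep (T.param z₀) (laurentSum T a) p =
      (∑ j : Fin m, p.2 ^ (j : ℕ) • chartRep (a j) z₀ p.1).compContinuousLinearMap
        (ContinuousLinearMap.fst ℝ F ℝ) := by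
  refine ext_single fun u => ?_
  have h : ∀ j, rep (T.param z₀) (pullback (E := E) (F := F) T.proj (a j)) p ![u] =
      chartRep (a j) z₀ p.1 ![u.1] := by
    intro j
    rw [T.rep_pullback_proj (a j) z₀ hp, comp_single]
    rfl
  rw [comp_single, ContinuousAlternatingMap.sum_apply]
  simp only [ContinuousAlternatingMap.smul_apply, smul_eq_mul]
  simp only [ContinuousLinearMap.coe_fst', ← h]
  have h2 : rep (T.param z₀) (laurentSum T a) p ![u] = ∑ j : Fin m, x (T.param z₀ p) ^ (j : ℕ) *
      rep (T.param z₀) (pullback (E := E) (F := F) T.proj (a j)) p ![u] := by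
    change (∑ j : Fin m, x (T.param z₀ p) ^ (j : ℕ) •
      pullback (E := E) (F := F) T.proj (a j) (T.param z₀ p)) _ = _
    rw [ContinuousAlternatingMap.sum_apply]
    rfl
  rw [h2, T.x_param z₀ hp]

end Tube

end TubeCoordinates

/-! ### Exterior derivatives on F × ℝ -/

section ProductForms

open Filter Topology

variable {F : Type*} [NormedAddCommGroup F] [NormedSpace ℝ F]

theorem extDeriv_smul_dt {h : ℝ → ℝ} {p : F × ℝ} (hh : DifferentiableAt ℝ h p.2) :
    extDeriv (fun p : F × ℝ => h p.2 • covector (ContinuousLinearMap.snd ℝ F ℝ)) p = 0 := by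
  have h1 : HasFDerivAt (fun p : F × ℝ => h p.2)
      (deriv h p.2 • ContinuousLinearMap.snd ℝ F ℝ) p :=
    hh.hasDerivAt.comp_hasFDerivAt p hasFDerivAt_snd
  refine ext_pair fun X Y => ?_
  rw [extDeriv_pair (h1.differentiableAt.smul_const _)]
  have h2 : ∀ U : F × ℝ, fderiv ℝ (fun p : F × ℝ =>
      (h p.2 • covector (ContinuousLinearMap.snd ℝ F ℝ)) ![U]) p =
      U.2 • deriv h p.2 • ContinuousLinearMap.snd ℝ F ℝ := fun U => (h1.mul_const U.2).fderiv
  rw [h2, h2]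
  simp
  ring

/-- Since h(t) dt is closed, d(A ∧ h dt) = h dA ∧ dt, and the part of dA containing dt is killed:
only the horizontal values of dA remain. -/
theorem extDeriv_wedge_dt [FiniteDimensional ℝ F] {A : F × ℝ → (F × ℝ) [⋀^Fin 1]→L[ℝ] ℝ} {h : ℝ → ℝ}
    {p : F × ℝ} (hA : ContDiffAt ℝ 1 A p) (hh : ContDiffAt ℝ 1 h p.2) (X Y T : F × ℝ) :
    extDeriv (fun p => wedge (A p) (h p.2 • covector (ContinuousLinearMap.snd ℝ F ℝ))) p
      ![X, Y, T] =
    h p.2 * (extDeriv A p ![(X.1, 0), (Y.1, 0)] * T.2 - extDeriv A p ![(X.1, 0), (T.1, 0)] * Y.2 +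
      extDeriv A p ![(Y.1, 0), (T.1, 0)] * X.2) := by
  have hc : ContDiffAt ℝ 1 (fun p : F × ℝ => h p.2 • covector (ContinuousLinearMap.snd ℝ F ℝ)) p :=
    (hh.comp p contDiffAt_snd).smul contDiffAt_const
  rw [extDeriv_wedge (hA.differentiableAt (by simp)) (hc.differentiableAt (by simp))
    ((hA.wedge hc).differentiableAt (by simp)), extDeriv_smul_dt (hh.differentiableAt (by simp))]
  have hdt : ∀ U : F × ℝ, (h p.2 • covector (ContinuousLinearMap.snd ℝ F ℝ)) ![U] =
    h p.2 * U.2 := fun U => rfl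
  have hz : ∀ U V : F × ℝ, (0 : (F × ℝ) [⋀^Fin 2]→L[ℝ] ℝ) ![U, V] = 0 := fun _ _ => rfl
  have hB := foldForm_contractLast (extDeriv A p)
  have hB' : ∀ U V : F × ℝ, extDeriv A p ![U, V] =
      U.2 * contractLast (extDeriv A p) ![V.1] - V.2 * contractLast (extDeriv A p) ![U.1] +
        extDeriv A p ![(U.1, 0), (V.1, 0)] := by
    intro U V
    conv_lhs => rw [← hB]
    rw [foldForm_pair, comp_pair]
    rfl
  simp only [hdt, hz]
  rw [hB' X Y, hB' X T, hB' Y T]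
  ring

/-- Horizontal vectors do not see the t-derivative of the powers t^j, so d acts on each coefficient
separately. -/
theorem extDeriv_comp_fst [FiniteDimensional ℝ F] {m : ℕ} {α : Fin m → F → F [⋀^Fin 1]→L[ℝ] ℝ}
    {y : F} (hα : ∀ j, DifferentiableAt ℝ (α j) y) (t : ℝ)
    (hA : DifferentiableAt ℝ (fun p : F × ℝ => (∑ j : Fin m, p.2 ^ (j : ℕ) •
      α j p.1).compContinuousLinearMap (ContinuousLinearMap.fst ℝ F ℝ)) (y, t)) (u v : F) :
    extDeriv (fun p : F × ℝ => (∑ j : Fin m, p.2 ^ (j : ℕ) •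
      α j p.1).compContinuousLinearMap (ContinuousLinearMap.fst ℝ F ℝ)) (y, t) ![(u, 0), (v, 0)] =
    ∑ j : Fin m, t ^ (j : ℕ) * extDeriv (α j) y ![u, v] := by
  have hα' : ∀ j U, DifferentiableAt ℝ (fun y => α j y ![U]) y := fun j U =>
    (ContinuousAlternatingMap.apply ℝ F ℝ ![U]).differentiableAt.comp y (hα j)
  have key : ∀ U V : F, fderiv ℝ (fun p : F × ℝ => (∑ j : Fin m, p.2 ^ (j : ℕ) •
      α j p.1).compContinuousLinearMap (ContinuousLinearMap.fst ℝ F ℝ) ![(U, (0 : ℝ))]) (y, t)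
      (V, 0) = ∑ j : Fin m, t ^ (j : ℕ) * fderiv ℝ (fun y => α j y ![U]) y V := by
    intro U V
    have h1 : ∀ j : Fin m, HasFDerivAt (fun p : F × ℝ => p.2 ^ (j : ℕ) * α j p.1 ![U])
        (t ^ (j : ℕ) • (fderiv ℝ (fun y => α j y ![U]) y).comp (ContinuousLinearMap.fst ℝ F ℝ) +
          α j y ![U] • (((j : ℕ) * t ^ ((j : ℕ) - 1)) • ContinuousLinearMap.snd ℝ F ℝ)) (y, t) := by
      intro j
      have e1 : HasFDerivAt (fun p : F × ℝ => α j p.1 ![U])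
          ((fderiv ℝ (fun y => α j y ![U]) y).comp (ContinuousLinearMap.fst ℝ F ℝ)) (y, t) :=
        HasFDerivAt.comp (y, t) (g := fun y => α j y ![U]) (f := Prod.fst)
          (hα' j U).hasFDerivAt hasFDerivAt_fst
      have e2 : HasFDerivAt (fun p : F × ℝ => p.2 ^ (j : ℕ))
          (((j : ℕ) * t ^ ((j : ℕ) - 1)) • ContinuousLinearMap.snd ℝ F ℝ) (y, t) :=
        HasDerivAt.comp_hasFDerivAt (y, t) (h₂ := fun s : ℝ => s ^ (j : ℕ)) (f := Prod.snd)
          (hasDerivAt_pow (j : ℕ) t) hasFDerivAt_snd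
      exact e2.mul e1
    have h2 : (fun p : F × ℝ => (∑ j : Fin m, p.2 ^ (j : ℕ) •
        α j p.1).compContinuousLinearMap (ContinuousLinearMap.fst ℝ F ℝ) ![(U, (0 : ℝ))]) =
        fun p => ∑ j : Fin m, p.2 ^ (j : ℕ) * α j p.1 ![U] := by
      funext p
      rw [comp_single, ContinuousAlternatingMap.sum_apply]
      rfl
    rw [h2, (HasFDerivAt.fun_sum fun j _ => h1 j).fderiv]
    simp
  rw [extDeriv_pair hA, key, key, ← Finset.sum_sub_distrib]
  refine Finset.sum_congr rfl fun j _ => ?_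
  rw [extDeriv_pair (hα j)]
  ring

theorem single_eq_fst_add_snd (w : (F × ℝ) [⋀^Fin 1]→L[ℝ] ℝ) (X : F × ℝ) :
    w ![X] = w.compContinuousLinearMap (ContinuousLinearMap.inl ℝ F ℝ) ![X.1] +
      X.2 * w ![(0, 1)] := by
  have h : X = (X.1, 0) + X.2 • ((0 : F), (1 : ℝ)) := by ext <;> simp
  conv_lhs => rw [h]
  rw [single_add, single_smul, comp_single]
  rfl

end ProductForms

/-! ### Smoothness of a b^m-form away from the hypersurface -/

section SmoothBSymplectic

open Filter Topology

variable {E : Type*} [NormedAddCommGroup E] [NormedSpace ℝ E] [FiniteDimensional ℝ E]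
  {M : Type*} [TopologicalSpace M] [ChartedSpace E M] [IsManifold 𝓘(ℝ, E) ∞ M]

theorem smoothFormOn_of_eq_bValue {m : ℕ} {x : M → ℝ} (hx : ContMDiff 𝓘(ℝ, E) 𝓘(ℝ, ℝ) ∞ x)
    {w : DForm E M 2} {a : DForm E M 1} {b : DForm E M 2} (ha : SmoothFormOn a univ)
    (hb : SmoothFormOn b univ) (h : ∀ p, x p ≠ 0 → w p = bValue m x a b p) :
    SmoothFormOn w {p | x p ≠ 0} := by
  intro p y hy
  refine ContDiffAt.contDiffWithinAt ?_
  have hS : IsOpen {p | x p ≠ 0} := isOpen_ne_fun hx.continuous continuous_const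
  set φ := extChartAt 𝓘(ℝ, E) p
  have hxφ : ContDiffAt ℝ ∞ (x ∘ φ.symm) y :=
    (hx.contMDiffAt.comp y (contMDiffAt_extChartAt_symm hy.1)).contDiffAt
  have ha' : ContDiffAt ℝ ∞ (rep φ.symm a) y :=
    contDiffAt_rep ha isOpen_univ (contMDiffAt_extChartAt_symm hy.1) (mem_univ _)
  have hb' : ContDiffAt ℝ ∞ (rep φ.symm b) y :=
    contDiffAt_rep hb isOpen_univ (contMDiffAt_extChartAt_symm hy.1) (mem_univ _)
  have hd : ContDiffAt ℝ ∞ (fun y => covector (fderiv ℝ (x ∘ φ.symm) y)) y :=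
    (hxφ.fderiv_right (m := ∞) (by simp)).covector
  have hinv : ContDiffAt ℝ ∞ (fun y => ((x ∘ φ.symm) y ^ m)⁻¹) y :=
    (hxφ.pow m).inv (pow_ne_zero m hy.2)
  refine ((ha'.wedge (hinv.smul hd)).add hb').congr_of_eventuallyEq ?_
  filter_upwards [(isOpen_chartDom hS p).mem_nhds hy] with y' hy'
  have e1 : rep φ.symm w y' = rep φ.symm (bValue m x a b) y' := rep_congr_form (h _ hy'.2)
  refine e1.trans ?_
  rw [rep_bValue, rep_dForm]
  · rfl
  · exact (contMDiffAt_extChartAt_symm hy'.1).mdifferentiableAt (by simp)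
  · exact hx.contMDiffAt.mdifferentiableAt (by simp)

end SmoothBSymplectic

/-! ### The Laurent series -/

section Laurent

open Filter Topology

variable {E : Type*} [NormedAddCommGroup E] [NormedSpace ℝ E] [FiniteDimensional ℝ E]
  {M : Type*} [TopologicalSpace M] [ChartedSpace E M] [IsManifold 𝓘(ℝ, E) ∞ M]
  {F : Type*} [NormedAddCommGroup F] [NormedSpace ℝ F] [FiniteDimensional ℝ F]
  {Z : Type*} [TopologicalSpace Z] [ChartedSpace F Z] [IsManifold 𝓘(ℝ, F) ∞ Z]
  {i : Z → M} {x : M → ℝ}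

omit [FiniteDimensional ℝ F] in
theorem Tube.smoothFormOn_nbhd (T : Tube (E := E) (F := F) i x) {k : ℕ} {a : DForm E M k}
    (h : ∀ z₀, ∀ p ∈ (T.param z₀).source, ContDiffAt ℝ ∞ (rep (T.param z₀) a) p) :
    SmoothFormOn a T.nbhd := by
  intro p y hy
  have hq := T.mem_param_target hy.2
  exact ((T.isParam_param _).contDiffAt_chartRep hy.1 hq
    (h _ _ ((T.param _).map_target hq))).contDiffWithinAt

theorem contDiffAt_chartRep {k : ℕ} {a : DForm F Z k} (ha : SmoothFormOn a univ) (z₀ : Z) {y : F}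
    (hy : y ∈ (chartAt F z₀).target) : ContDiffAt ℝ ∞ (chartRep a z₀) y :=
  contDiffAt_rep ha isOpen_univ (contMDiffAt_extChartAt_symm (by simpa using hy)) (mem_univ _)

theorem contDiffAt_laurent {m : ℕ} {a : Fin m → DForm F Z 1} (ha : ∀ j, SmoothFormOn (a j) univ)
    (z₀ : Z) {p : F × ℝ} (hp : p.1 ∈ (chartAt F z₀).target) :
    ContDiffAt ℝ ∞ (fun p : F × ℝ => ∑ j : Fin m, p.2 ^ (j : ℕ) • chartRep (a j) z₀ p.1) p := by
  refine ContDiffAt.sum fun j _ => (contDiffAt_snd.pow _).smul ?_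
  exact ContDiffAt.comp p (g := chartRep (a j) z₀) (f := Prod.fst)
    (contDiffAt_chartRep (ha j) z₀ hp) contDiffAt_fst

theorem contDiffAt_laurent_fst {m : ℕ} {a : Fin m → DForm F Z 1}
    (ha : ∀ j, SmoothFormOn (a j) univ) (z₀ : Z) {p : F × ℝ} (hp : p.1 ∈ (chartAt F z₀).target) :
    ContDiffAt ℝ ∞ (fun p : F × ℝ => (∑ j : Fin m, p.2 ^ (j : ℕ) •
      chartRep (a j) z₀ p.1).compContinuousLinearMap (ContinuousLinearMap.fst ℝ F ℝ)) p :=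
  (contDiffAt_laurent ha z₀ hp).alternating_comp contDiffAt_const

omit [FiniteDimensional ℝ E] [IsManifold 𝓘(ℝ, E) ∞ M] [FiniteDimensional ℝ F] in
theorem Tube.chartRep_pullback_slice (T : Tube (E := E) (F := F) i x) {k : ℕ} (α : DForm E M k)
    (z₀ : Z)
    {p : F × ℝ} (hp : p ∈ (T.param z₀).source) :
    chartRep (pullback (E := F) (F := E) (fun z => T.Φ (z, p.2)) α) z₀ p.1 =
      (rep (T.param z₀) α p).compContinuousLinearMap (ContinuousLinearMap.inl ℝ F ℝ) := by
  have hp' := hp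
  rw [param_source] at hp'
  have hy : p.1 ∈ (extChartAt 𝓘(ℝ, F) z₀).target := by simpa using hp'.1
  have h1 : MDifferentiableAt 𝓘(ℝ, F) 𝓘(ℝ, F) (extChartAt 𝓘(ℝ, F) z₀).symm p.1 :=
    (contMDiffAt_extChartAt_symm hy).mdifferentiableAt (by simp)
  have h2 : MDifferentiableAt 𝓘(ℝ, F) 𝓘(ℝ, E) (fun z => T.Φ (z, p.2))
      ((extChartAt 𝓘(ℝ, F) z₀).symm p.1) := by
    have h3 : ContMDiffAt 𝓘(ℝ, F) (𝓘(ℝ, F).prod 𝓘(ℝ, ℝ)) ∞ (fun z : Z => (z, p.2))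
        ((extChartAt 𝓘(ℝ, F) z₀).symm p.1) := contMDiffAt_id.prodMk contMDiffAt_const
    exact (ContMDiffAt.comp (g := T.Φ) (f := fun z : Z => (z, p.2))
      ((extChartAt 𝓘(ℝ, F) z₀).symm p.1)
      (T.contMDiffOn.contMDiffAt (T.Φ.open_source.mem_nhds (T.mem_source hp'.2)))
      h3).mdifferentiableAt (by simp)
  have h4 := pullback_comp h2 h1 α
  have h5 : MDifferentiableAt 𝓘(ℝ, F × ℝ) 𝓘(ℝ, E) (T.param z₀) ((fun y => (y, p.2)) p.1) :=
    ((T.isParam_param z₀).eventually_mdifferentiableAt hp).self_of_nhds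
  have h6 := rep_comp (θ := fun y : F => (y, p.2)) h5
    (hasFDerivAt_prodMk_left p.1 p.2).differentiableAt α
  rw [(hasFDerivAt_prodMk_left p.1 p.2).fderiv] at h6
  exact h4.symm.trans h6

/-- The successive coefficients of the expansion in `t` of the restrictions of the one-form `α`
to the slices of a tubular neighborhood. -/
noncomputable def Tube.coeff (T : Tube (E := E) (F := F) i x) (α : DForm E M 1) :
    ℕ → ℝ → DForm F Z 1
  | 0, t => pullback (E := F) (F := E) (fun z => T.Φ (z, t)) α
  | j + 1, t => fun z => dslope (E := F [⋀^Fin 1]→L[ℝ] ℝ) (fun s => T.coeff α j s z) 0 t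

omit [FiniteDimensional ℝ E] [IsManifold 𝓘(ℝ, E) ∞ M] [FiniteDimensional ℝ F] in
theorem Tube.chartRep_coeff_zero (T : Tube (E := E) (F := F) i x) (α : DForm E M 1) (z₀ : Z)
    {p : F × ℝ} (hp : p ∈ (T.param z₀).source) :
    chartRep (T.coeff α 0 p.2) z₀ p.1 =
      (rep (T.param z₀) α p).compContinuousLinearMap (ContinuousLinearMap.inl ℝ F ℝ) :=
  T.chartRep_pullback_slice α z₀ hp

-- The coefficients are defined fiberwise over Z, without charts. Passing to a chart applies a fixed
-- linear map, which commutes with `dslope` once the previous coefficient is differentiable at t =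
-- 0. Hadamard's lemma then gives joint smoothness in (y, t), which is what the next stage needs.
omit [FiniteDimensional ℝ E] in
theorem Tube.contDiffOn_coeff (T : Tube (E := E) (F := F) i x) {α : DForm E M 1}
    (hα : SmoothFormOn α univ) (j : ℕ) : ∀ z₀ : Z,
    ContDiffOn ℝ ∞ (fun p : F × ℝ => chartRep (T.coeff α j p.2) z₀ p.1)
      ((chartAt F z₀).target ×ˢ Ioo (-T.δ) T.δ) ∧
    (∀ p ∈ (chartAt F z₀).target ×ˢ Ioo (-T.δ) T.δ, chartRep (T.coeff α (j + 1) p.2) z₀ p.1 =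
      dslope (fun t => chartRep (T.coeff α j t) z₀ p.1) 0 p.2) := by
  have hstep : ∀ j, (∀ z₀ : Z,
      ContDiffOn ℝ ∞ (fun p : F × ℝ => chartRep (T.coeff α j p.2) z₀ p.1)
        ((chartAt F z₀).target ×ˢ Ioo (-T.δ) T.δ)) → ∀ z₀ : Z,
      ∀ p ∈ (chartAt F z₀).target ×ˢ Ioo (-T.δ) T.δ, chartRep (T.coeff α (j + 1) p.2) z₀ p.1 =
        dslope (fun t => chartRep (T.coeff α j t) z₀ p.1) 0 p.2 := by
    rintro j hj z₀ ⟨y, t⟩ ⟨hy, ht⟩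
    set z := (chartAt F z₀).symm y with hz
    let D : F →L[ℝ] F := mfderiv 𝓘(ℝ, F) 𝓘(ℝ, F) (extChartAt 𝓘(ℝ, F) z₀).symm y
    let D' : F →L[ℝ] F := mfderiv 𝓘(ℝ, F) 𝓘(ℝ, F) (chartAt F z₀) z
    let g : ℝ → F [⋀^Fin 1]→L[ℝ] ℝ := fun s => T.coeff α j s z
    have hgD : ∀ s, chartRep (T.coeff α j s) z₀ y = (g s).compContinuousLinearMap D := fun s => rfl
    -- Inverting the chart derivative transfers differentiability from the chart expression to the
    -- fiberwise function g.
    have hgD' : ∀ s, g s = (chartRep (T.coeff α j s) z₀ y).compContinuousLinearMap D' := by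
      intro s
      ext v
      exact (isParam_chartAt_symm (E := F) z₀).apply_eq_rep (T.coeff α j s) hy v
    have hdiff : DifferentiableAt ℝ g 0 := by
      have h1 : ContDiffAt ℝ ∞ (fun p : F × ℝ => chartRep (T.coeff α j p.2) z₀ p.1) (y, 0) :=
        (hj z₀).contDiffAt (((chartAt F z₀).open_target.prod isOpen_Ioo).mem_nhds
          ⟨hy, T.zero_mem⟩)
      have h2 : ContDiffAt ℝ ∞ (fun s : ℝ => chartRep (T.coeff α j s) z₀ y) 0 :=
        ContDiffAt.comp (f := fun s : ℝ => (y, s)) (0 : ℝ) h1 (by fun_prop)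
      have h3 : g = fun s => (chartRep (T.coeff α j s) z₀ y).compContinuousLinearMap D' :=
        funext hgD'
      rw [h3]
      exact (h2.alternating_comp contDiffAt_const).differentiableAt (by simp)
    have h4 := ContinuousLinearMap.dslope_comp (𝕜 := ℝ)
      (ContinuousAlternatingMap.compContinuousLinearMapCLM D :
        F [⋀^Fin 1]→L[ℝ] ℝ →L[ℝ] F [⋀^Fin 1]→L[ℝ] ℝ) g 0 t (fun _ => hdiff)
    exact h4.symm
  have hsm : ∀ z₀ : Z, ContDiffOn ℝ ∞ (fun p : F × ℝ => chartRep (T.coeff α j p.2) z₀ p.1)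
      ((chartAt F z₀).target ×ˢ Ioo (-T.δ) T.δ) := by
    induction j with
    | zero =>
      intro z₀
      rw [← T.param_source]
      intro p hp
      refine ContDiffAt.contDiffWithinAt ?_
      have h1 : ContDiffAt ℝ ∞ (rep (T.param z₀) α) p :=
        contDiffAt_rep hα isOpen_univ ((T.isParam_param z₀).contMDiffOn.contMDiffAt
          ((T.param z₀).open_source.mem_nhds hp)) (mem_univ _)
      refine (h1.alternating_comp (contDiffAt_const (c := ContinuousLinearMap.inl ℝ F ℝ))).congr_of_eventuallyEq ?_
      filter_upwards [(T.param z₀).open_source.mem_nhds hp] with p' hp'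
      exact T.chartRep_coeff_zero α z₀ hp'
    | succ j ih =>
      intro z₀
      exact (contDiffOn_dslope (chartAt F z₀).open_target (ih z₀)).congr (hstep j ih z₀)
  exact fun z₀ => ⟨hsm z₀, hstep j hsm z₀⟩

-- Taylor expansion by iterating g(t) = g(0) + t · `dslope` g 0 t.
omit [FiniteDimensional ℝ E] in
theorem Tube.coeff_expansion (T : Tube (E := E) (F := F) i x) {α : DForm E M 1}
    (hα : SmoothFormOn α univ) (z₀ : Z) {p : F × ℝ} (hp : p ∈ (T.param z₀).source) (m : ℕ) :
    chartRep (T.coeff α 0 p.2) z₀ p.1 =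
      (∑ j : Fin m, p.2 ^ (j : ℕ) • chartRep (T.coeff α j 0) z₀ p.1) +
        p.2 ^ m • chartRep (T.coeff α m p.2) z₀ p.1 := by
  rw [T.param_source] at hp
  induction m with
  | zero => simp
  | succ m ih =>
    rw [ih, Fin.sum_univ_castSucc, add_assoc]
    congr 1
    simp only [Fin.val_last]
    rw [((T.contDiffOn_coeff hα m z₀).2 p hp), pow_succ, mul_smul]
    have := sub_smul_dslope (fun t => chartRep (T.coeff α m t) z₀ p.1) 0 p.2
    rw [sub_zero] at this
    rw [this, ← smul_add, add_sub_cancel]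

/-- The remainder of the expansion of `α`, as a one-form on the tubular neighborhood. -/
noncomputable def Tube.remainder (T : Tube (E := E) (F := F) i x) (α : DForm E M 1) (m : ℕ) :
    DForm E M 1 := fun p => pullback (E := E) (F := F) T.proj (T.coeff α m (x p)) p

omit [FiniteDimensional ℝ E] [IsManifold 𝓘(ℝ, E) ∞ M] [FiniteDimensional ℝ F] in
theorem Tube.rep_remainder (T : Tube (E := E) (F := F) i x) (α : DForm E M 1) (m : ℕ) (z₀ : Z)
    {p : F × ℝ} (hp : p ∈ (T.param z₀).source) :
    rep (T.param z₀) (T.remainder α m) p =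
      (chartRep (T.coeff α m p.2) z₀ p.1).compContinuousLinearMap
        (ContinuousLinearMap.fst ℝ F ℝ) := by
  rw [← T.rep_pullback_proj (T.coeff α m p.2) z₀ hp]
  refine rep_congr_form ?_
  simp only [remainder, T.x_param z₀ hp]

/-- Expanding α along the slices leaves a remainder t^m ρ_m, and t^m ρ_m ∧ dx / x^m = ρ_m ∧ dx is
smooth, so it may be absorbed into β. This works in any tube. -/
theorem Tube.exists_isLaurentSeries (T : Tube (E := E) (F := F) i x)
    (hx : ContMDiff 𝓘(ℝ, E) 𝓘(ℝ, ℝ) ∞ x) {m : ℕ} {w : DForm E M 2}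
    (hwc : ClosedFormOn w {p | x p ≠ 0}) {α : DForm E M 1} {β : DForm E M 2}
    (hα : SmoothFormOn α univ) (hβ : SmoothFormOn β univ)
    (hw : ∀ p, x p ≠ 0 → w p = bValue m x α β p) :
    ∃ (a : Fin m → DForm F Z 1) (b : DForm E M 2), IsLaurentSeries T w a b := by
  set a : Fin m → DForm F Z 1 := fun j => T.coeff α j 0 with ha
  set b : DForm E M 2 := fun p => wedge (T.remainder α m p) (dForm (E := E) x p) + β p with hb
  have has : ∀ j, SmoothFormOn (a j) univ := by
    intro j z₀ y hy
    have h1 := (T.contDiffOn_coeff hα j z₀).1.contDiffAt (x := (y, 0))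
      (((chartAt F z₀).open_target.prod isOpen_Ioo).mem_nhds
        ⟨by simpa using hy.1, T.zero_mem⟩)
    have h2 : ContDiffAt ℝ ∞ (fun y : F => chartRep (T.coeff α j 0) z₀ y) y :=
      ContDiffAt.comp (f := fun y : F => (y, (0 : ℝ))) y h1 (by fun_prop)
    exact h2.contDiffWithinAt
  have hrb : ∀ z₀, ∀ p ∈ (T.param z₀).source, rep (T.param z₀) b p =
      wedge (rep (T.param z₀) (T.remainder α m) p) (covector (ContinuousLinearMap.snd ℝ F ℝ)) +
        rep (T.param z₀) β p := by
    intro z₀ p hp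
    rw [← T.rep_dForm hx z₀ hp, ← rep_wedge]
    rfl
  have hbs : ∀ z₀, ∀ p ∈ (T.param z₀).source, ContDiffAt ℝ ∞ (rep (T.param z₀) b) p := by
    intro z₀ p hp
    have h1 : ContDiffAt ℝ ∞ (rep (T.param z₀) β) p :=
      contDiffAt_rep hβ isOpen_univ ((T.isParam_param z₀).contMDiffOn.contMDiffAt
        ((T.param z₀).open_source.mem_nhds hp)) (mem_univ _)
    have hp' := hp
    rw [T.param_source] at hp'
    have h2 := (T.contDiffOn_coeff hα m z₀).1.contDiffAt
      (((chartAt F z₀).open_target.prod isOpen_Ioo).mem_nhds hp')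
    refine (((h2.alternating_comp (contDiffAt_const (c := ContinuousLinearMap.fst ℝ F ℝ))).wedge
      (contDiffAt_const (c := covector (ContinuousLinearMap.snd ℝ F ℝ)))).add h1).congr_of_eventuallyEq ?_
    filter_upwards [(T.param z₀).open_source.mem_nhds hp] with p' hp'
    rw [hrb z₀ p' hp', T.rep_remainder α m z₀ hp']
  have hid : ∀ p ∈ T.nbhd, x p ≠ 0 → w p = bValue m x (laurentSum T a) b p := by
    intro q hq hxq
    rw [hw q hxq]
    set G := T.param (T.proj q)
    have hqG := T.mem_param_target hq
    set p := G.symm q with hp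
    have hpG : p ∈ G.source := G.map_target hqG
    have hGp : G p = q := G.right_inv hqG
    rw [← hGp] at hxq ⊢
    have hxp : x (G p) = p.2 := T.x_param _ hpG
    refine (T.isParam_param _).form_eq_of_rep_eq hpG ?_
    refine (rep_bValue G m x α β p).trans (Eq.trans ?_ (rep_bValue G m x (laurentSum T a) b p).symm)
    rw [hrb _ p hpG, T.rep_dForm hx _ hpG, T.rep_laurentSum a _ hpG, T.rep_remainder α m _ hpG, hxp]
    have hexp := T.coeff_expansion hα (T.proj q) hpG m
    rw [T.chartRep_coeff_zero α _ hpG] at hexp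
    rw [hxp] at hxq
    refine ext_pair fun X Y => ?_
    simp only [ContinuousAlternatingMap.add_apply, wedge_pair, comp_single,
      ContinuousAlternatingMap.smul_apply, covector_apply, smul_eq_mul]
    -- Split α into its slice part and its dt-component; the latter cancels in the wedge with dt.
    rw [single_eq_fst_add_snd (rep G α p) X, single_eq_fst_add_snd (rep G α p) Y, hexp]
    simp only [ContinuousAlternatingMap.add_apply, ContinuousAlternatingMap.smul_apply, smul_eq_mul]
    simp
    field_simp
    ring
  refine ⟨a, b, fun j => ⟨has j, ?_⟩, T.smoothFormOn_nbhd hbs, hid⟩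
  -- closedness of the coefficients
  intro z₀ y hy
  have hyt : y ∈ (chartAt F z₀).target := by simpa using hy.1
  set G := T.param z₀
  have hG := T.isParam_param z₀
  have hS : IsOpen {p | x p ≠ 0} := isOpen_ne_fun hx.continuous continuous_const
  have hws : SmoothFormOn w {p | x p ≠ 0} := smoothFormOn_of_eq_bValue hx hα hβ hw
  have hmem : ∀ t ∈ Ioo (-T.δ) T.δ, ((y, t) : F × ℝ) ∈ G.source := fun t ht => by
    rw [T.param_source]; exact ⟨hyt, ht⟩
  have had : ∀ j, DifferentiableAt ℝ (chartRep (a j) z₀) y := fun j =>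
    (contDiffAt_chartRep (has j) z₀ hyt).differentiableAt (by simp)
  refine ext_pair fun u v => ?_
  -- The component of dω = 0 on (u, v, ∂/∂t), multiplied by t^m. As db is continuous up to t = 0,
  -- the right side is t^m times a function with a limit, so all coefficients on the left vanish.
  have key : ∀ t ∈ Ioo (-T.δ) T.δ, t ≠ 0 →
      ∑ j : Fin m, t ^ (j : ℕ) * extDeriv (chartRep (a j) z₀) y ![u, v] =
      t ^ m * -(extDeriv (rep G b) (y, t) ![(u, 0), (v, 0), (0, 1)]) := by
    intro t ht ht0
    have hpG := hmem t ht
    have hxG : x (G (y, t)) = t := T.x_param z₀ hpG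
    have hd : extDeriv (rep G w) (y, t) = 0 :=
      extDeriv_rep_eq_zero hws hwc hS (hG.contMDiffOn.contMDiffAt (G.open_source.mem_nhds hpG))
        (by rw [mem_ofPred_eq, hxG]; exact ht0)
    have hA := (contDiffAt_laurent_fst has z₀ (p := (y, t)) hyt)
    have hinv : ContDiffAt ℝ ∞ (fun s : ℝ => (s ^ m)⁻¹) t :=
      (contDiffAt_id.pow m).inv (pow_ne_zero m ht0)
    have hc : ContDiffAt ℝ ∞ (fun p : F × ℝ => (p.2 ^ m)⁻¹ •
        covector (ContinuousLinearMap.snd ℝ F ℝ)) (y, t) :=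
      (ContDiffAt.comp (y, t) (g := fun s : ℝ => (s ^ m)⁻¹) (f := Prod.snd) hinv
        contDiffAt_snd).smul contDiffAt_const
    have hwe : rep G w =ᶠ[𝓝 (y, t)] (fun p : F × ℝ => wedge ((∑ j : Fin m, p.2 ^ (j : ℕ) •
        chartRep (a j) z₀ p.1).compContinuousLinearMap (ContinuousLinearMap.fst ℝ F ℝ))
        ((p.2 ^ m)⁻¹ • covector (ContinuousLinearMap.snd ℝ F ℝ))) + rep G b := by
      have hne : ∀ᶠ p : F × ℝ in 𝓝 (y, t), p.2 ≠ 0 :=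
        (continuous_snd.continuousAt (x := (y, t))).eventually_ne ht0
      filter_upwards [G.open_source.mem_nhds hpG, hne] with p hp hp0
      have h1 : rep G w p = rep G (bValue m x (laurentSum T a) b) p :=
        rep_congr_form (hid _ (T.param_mem_nbhd z₀ hp) (by rw [T.x_param z₀ hp]; exact hp0))
      rw [h1, rep_bValue, T.rep_dForm hx z₀ hp, T.rep_laurentSum a z₀ hp, T.x_param z₀ hp]
      rfl
    rw [hwe.extDeriv_eq, extDeriv_add ((hA.wedge hc).differentiableAt (by simp))
      ((hbs z₀ _ hpG).differentiableAt (by simp))] at hd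
    have h2 := congrArg (fun η : (F × ℝ) [⋀^Fin 3]→L[ℝ] ℝ => η ![(u, 0), (v, 0), (0, 1)]) hd
    simp only [ContinuousAlternatingMap.add_apply] at h2
    rw [extDeriv_wedge_dt (h := fun s => (s ^ m)⁻¹) (hA.of_le (by simp)) (hinv.of_le (by simp)),
      extDeriv_comp_fst had t (hA.differentiableAt (by simp))] at h2
    have hz : ∀ v, (0 : (F × ℝ) [⋀^Fin 3]→L[ℝ] ℝ) v = 0 := fun _ => rfl
    simp only [mul_zero, sub_zero, mul_one, add_zero, hz] at h2
    have h3 : t ^ m ≠ 0 := pow_ne_zero m ht0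
    field_simp at h2
    linarith
  have hlim : Tendsto (fun t : ℝ => -(extDeriv (rep G b) (y, t) ![(u, 0), (v, 0), (0, 1)]))
      (𝓝[≠] 0) (𝓝 (-(extDeriv (rep G b) (y, 0) ![(u, 0), (v, 0), (0, 1)]))) := by
    have h1 : ContinuousAt (extDeriv (rep G b)) (y, 0) :=
      (ContinuousAlternatingMap.alternatizeUncurryFinCLM ℝ (F × ℝ) ℝ).continuous.continuousAt.comp
        ((hbs z₀ _ (hmem 0 T.zero_mem)).fderiv_right (m := 0) (by simp)).continuousAt
    have h2 : ContinuousAt (fun t : ℝ => extDeriv (rep G b) (y, t)) 0 :=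
      ContinuousAt.comp (f := fun t : ℝ => (y, t)) h1 (by fun_prop)
    have h3 : ContinuousAt (fun t : ℝ => extDeriv (rep G b) (y, t)
        ![(u, 0), (v, 0), (0, 1)]) 0 :=
      (ContinuousAlternatingMap.apply ℝ (F × ℝ) ℝ ![(u, 0), (v, 0), (0, 1)]).continuous.continuousAt.comp h2
    exact (h3.neg).tendsto.mono_left nhdsWithin_le_nhds
  have h0 := coeff_eq_zero_of_eventually_eq m (fun j => extDeriv (chartRep (a j) z₀) y ![u, v])
    _ _ hlim (by
      filter_upwards [mem_nhdsWithin_of_mem_nhds (isOpen_Ioo.mem_nhds T.zero_mem),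
        self_mem_nhdsWithin] with t ht ht0
      exact key t ht ht0) j
  exact h0

end Laurent

/-! ### Derivatives of the profile f and of its rescalings -/

section Profile

open Filter Topology

variable {k : ℕ} {r R : ℝ} {f : ℝ → ℝ}

theorem IsFoldingProfile.differentiable (hf : IsFoldingProfile k r R f) : Differentiable ℝ f :=
  hf.smooth.differentiable (by simp)

theorem IsFoldingProfile.continuous_deriv (hf : IsFoldingProfile k r R f) :
    Continuous (deriv f) :=
  hf.smooth.continuous_deriv (by simp)

theorem IsFoldingProfile.deriv_neg (hf : IsFoldingProfile k r R f) (t : ℝ) :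
    deriv f (-t) = -deriv f t := by
  have h := deriv_comp_neg f t
  rw [show (fun x => f (-x)) = f from funext hf.even] at h
  linarith

theorem IsFoldingProfile.deriv_ne_zero (hf : IsFoldingProfile k r R f) {t : ℝ} (ht : t ≠ 0) :
    deriv f t ≠ 0 := by
  rcases lt_or_gt_of_ne ht with h | h
  · exact (hf.deriv_pos t h).ne'
  · have h1 := hf.deriv_pos (-t) (by linarith)
    rw [hf.deriv_neg] at h1
    linarith

theorem IsFoldingProfile.deriv_inner (hf : IsFoldingProfile k r R f) {t : ℝ} (ht : |t| < r) :
    deriv f t = -2 * t := by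
  have h : f =ᶠ[𝓝 t] fun t => -t ^ 2 + 2 := by
    filter_upwards [(isOpen_lt continuous_abs continuous_const).mem_nhds ht] with s hs
    exact hf.inner s (le_of_lt hs)
  rw [h.deriv_eq]
  have h1 : HasDerivAt (fun t : ℝ => -t ^ 2 + 2) (-((2 : ℕ) * t ^ (2 - 1))) t :=
    ((hasDerivAt_pow 2 t).neg).add_const 2
  rw [h1.deriv]
  norm_num

/-- The logarithm for k = 0 and the power for k > 0 are both primitives of -t^-(2k+1) on t > 0,
continued evenly. Equality |t| = R is included so that ω_ε = ω on the closed set |x| ≥ Rε. -/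
theorem IsFoldingProfile.deriv_outer (hf : IsFoldingProfile k r R f) (hR : 0 < R) {t : ℝ}
    (ht : R ≤ |t|) : deriv f t = -(t ^ (2 * k + 1))⁻¹ := by
  have main : ∀ t, R < |t| → deriv f t = -(t ^ (2 * k + 1))⁻¹ := by
    intro t ht
    have ht0 : t ≠ 0 := abs_pos.1 (hR.trans ht)
    have hev : ∀ᶠ s in 𝓝 t, R < |s| := (isOpen_lt continuous_const continuous_abs).mem_nhds ht
    rcases Nat.eq_zero_or_pos k with hk | hk
    · have h : f =ᶠ[𝓝 t] fun t => -Real.log t := by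
        filter_upwards [hev] with s hs
        rw [hf.outer_zero hk s hs, Real.log_abs]
      rw [h.deriv_eq, (Real.hasDerivAt_log ht0).fun_neg.deriv, hk]
      simp
    · have h : f =ᶠ[𝓝 t] fun t => (2 * k : ℝ)⁻¹ * (t ^ (2 * k))⁻¹ := by
        filter_upwards [hev] with s hs
        rw [hf.outer_pos hk s hs, one_div, mul_inv]
      have h1 : HasDerivAt (fun t : ℝ => (2 * k : ℝ)⁻¹ * (t ^ (2 * k))⁻¹)
          ((2 * k : ℝ)⁻¹ * (-(((2 * k : ℕ) : ℝ) * t ^ (2 * k - 1)) / (t ^ (2 * k)) ^ 2)) t :=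
        ((hasDerivAt_pow (2 * k) t).fun_inv (pow_ne_zero _ ht0)).const_mul _
      rw [h.deriv_eq, h1.deriv]
      have hk' : (k : ℝ) ≠ 0 := by exact_mod_cast hk.ne'
      obtain ⟨l, rfl⟩ : ∃ l, k = l + 1 := ⟨k - 1, by omega⟩
      rw [show 2 * (l + 1) - 1 = 2 * l + 1 by omega]
      push_cast at hk' ⊢
      field_simp
      ring
  have ht0 : t ≠ 0 := abs_pos.1 (hR.trans_le ht)
  -- The boundary |t| = R is reached by continuity of f', from t s with s ↓ 1.
  have hc : Tendsto (fun s : ℝ => t * s) (𝓝[>] 1) (𝓝 t) := by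
    have : ContinuousAt (fun s : ℝ => t * s) 1 := by fun_prop
    simpa [ContinuousAt] using this.mono_left (nhdsWithin_le_nhds (s := Ioi (1 : ℝ)))
  have hcont : ContinuousAt (fun t : ℝ => -(t ^ (2 * k + 1))⁻¹) t :=
    ((continuousAt_id.pow _).inv₀ (pow_ne_zero _ ht0)).neg
  refine tendsto_nhds_unique_of_eventuallyEq
    ((hf.continuous_deriv.continuousAt (x := t)).tendsto.comp hc) (hcont.tendsto.comp hc) ?_
  filter_upwards [self_mem_nhdsWithin] with s (hs : 1 < s)
  refine main _ ?_
  rw [abs_mul, abs_of_pos (zero_lt_one.trans hs)]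
  nlinarith

/-- The derivative vanishes only at 0, and r ≤ |t| ≤ R is compact. -/
theorem IsFoldingProfile.exists_le_abs_deriv (hf : IsFoldingProfile k r R f) (hr : 0 < r) :
    ∃ c, 0 < c ∧ ∀ t, r ≤ |t| → |t| ≤ R → c ≤ |deriv f t| := by
  have hcpt : IsCompact ({t : ℝ | r ≤ |t|} ∩ {t | |t| ≤ R}) := by
    refine IsCompact.inter_left ?_ (isClosed_le continuous_const continuous_abs)
    have : {t : ℝ | |t| ≤ R} = Icc (-R) R := by ext; simp [abs_le]
    rw [this]; exact isCompact_Icc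
  obtain ⟨c, hc, h⟩ := hcpt.exists_forall_le' (f := fun t => |deriv f t|) (a := 0)
    hf.continuous_deriv.abs.continuousOn
    (fun t ht => abs_pos.2 (hf.deriv_ne_zero (abs_pos.1 (hr.trans_le ht.1))))
  exact ⟨c, hc, fun t h1 h2 => h t ⟨h1, h2⟩⟩

theorem IsFoldingProfile.contDiff_rescale (hf : IsFoldingProfile k r R f) (ε : ℝ) :
    ContDiff ℝ ∞ (rescale k f ε) :=
  contDiff_const.mul (hf.smooth.comp (contDiff_id.div_const ε))

theorem IsFoldingProfile.deriv_rescale (hf : IsFoldingProfile k r R f) {ε : ℝ} (t : ℝ) :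
    deriv (rescale k f ε) t = (ε ^ (2 * k + 1))⁻¹ * deriv f (t / ε) := by
  have h1 : HasDerivAt (fun t => f (t / ε)) (deriv f (t / ε) * (1 / ε)) t :=
    HasDerivAt.comp t (h := fun t : ℝ => t / ε) (hf.differentiable _).hasDerivAt
      ((hasDerivAt_id t).div_const ε)
  have h2 : HasDerivAt (rescale k f ε) _ t := h1.const_mul _
  rw [h2.deriv, pow_succ, mul_inv]
  ring

/-- The outer derivative is homogeneous of degree -(2k+1), which is exactly compensated by ε^-2k and
the factor ε⁻¹ of the chain rule. -/
theorem IsFoldingProfile.deriv_rescale_outer (hf : IsFoldingProfile k r R f) (hR : 0 < R) {ε : ℝ}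
    (hε : 0 < ε) {t : ℝ} (ht : R * ε ≤ |t|) :
    deriv (rescale k f ε) t = -(t ^ (2 * k + 1))⁻¹ := by
  have h : R ≤ |t / ε| := by
    rw [abs_div, abs_of_pos hε, le_div_iff₀ hε]; exact ht
  rw [hf.deriv_rescale, hf.deriv_outer hR h, div_pow]
  have := (pow_pos hε (2 * k + 1)).ne'
  field_simp

theorem IsFoldingProfile.deriv_rescale_inner (hf : IsFoldingProfile k r R f) {ε : ℝ}
    (hε : 0 < ε) {t : ℝ} (ht : |t| < r * ε) :
    deriv (rescale k f ε) t = -2 * (ε ^ (2 * k + 2))⁻¹ * t := by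
  have h : |t / ε| < r := by
    rw [abs_div, abs_of_pos hε, div_lt_iff₀ hε]; exact ht
  rw [hf.deriv_rescale, hf.deriv_inner h, pow_succ ε (2 * k + 1)]
  have := (pow_pos hε (2 * k + 1)).ne'
  field_simp

theorem IsFoldingProfile.deriv_deriv_rescale_inner (hf : IsFoldingProfile k r R f) {ε : ℝ}
    (hε : 0 < ε) {t : ℝ} (ht : |t| < r * ε) :
    deriv (deriv (rescale k f ε)) t = -2 * (ε ^ (2 * k + 2))⁻¹ := by
  have h : deriv (rescale k f ε) =ᶠ[𝓝 t] fun t => -2 * (ε ^ (2 * k + 2))⁻¹ * t := by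
    filter_upwards [(isOpen_lt continuous_abs continuous_const).mem_nhds ht] with s hs
    exact hf.deriv_rescale_inner hε hs
  rw [h.deriv_eq]
  simp

theorem IsFoldingProfile.contDiff_deriv_rescale (hf : IsFoldingProfile k r R f) (ε : ℝ) :
    ContDiff ℝ ∞ (deriv (rescale k f ε)) := by
  have := (hf.contDiff_rescale ε)
  rw [contDiff_infty_iff_deriv] at this
  exact this.2

end Profile

/-! ### The quantitative folding criterion near a point -/

section LocalFold

open Filter Topology

variable {F : Type*} [NormedAddCommGroup F] [NormedSpace ℝ F] [FiniteDimensional ℝ F]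

theorem eq_zero_of_apply_basis {ι X : Type*} [Fintype ι] [DecidableEq ι] [NormedAddCommGroup X]
    [NormedSpace ℝ X] (e : Module.Basis ι ℝ X) {η : X [⋀^ι]→L[ℝ] ℝ} (h : η e = 0) : η = 0 := by
  have h1 : η.toAlternatingMap = 0 := (AlternatingMap.map_basis_eq_zero_iff e _).1 h
  ext v
  exact congrArg (fun ζ : X [⋀^ι]→ₗ[ℝ] ℝ => ζ v) h1

omit [FiniteDimensional ℝ F] in
/-- The form `s dt ∧ A + w` on the graph of a linear functional `L`. -/
theorem smul_wedge_add_comp_graph (s : ℝ) (A : F [⋀^Fin 1]→L[ℝ] ℝ)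
    (w : (F × ℝ) [⋀^Fin 2]→L[ℝ] ℝ) (L : F →L[ℝ] ℝ) :
    (s • wedge (covector (ContinuousLinearMap.snd ℝ F ℝ))
      (A.compContinuousLinearMap (ContinuousLinearMap.fst ℝ F ℝ)) + w).compContinuousLinearMap
      ((ContinuousLinearMap.id ℝ F).prod L) =
      wedge (covector (s • L)) A +
        w.compContinuousLinearMap ((ContinuousLinearMap.id ℝ F).prod L) := by
  refine ext_pair fun u v => ?_
  simp only [comp_pair, ContinuousAlternatingMap.add_apply, ContinuousAlternatingMap.smul_apply,
    wedge_pair, comp_single, covector_apply, smul_eq_mul]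
  simp
  ring

/-- If `A` and `β` satisfy the nondegeneracy condition at `p₀`, then the form
`h(t) dt ∧ A + β` folds along the zero set of its top power at all points near `p₀` at which
`h` or its derivative is large. -/
theorem eventually_folded {n : ℕ} (hF : Module.finrank ℝ F + 1 = 2 * n)
    {A : F × ℝ → F [⋀^Fin 1]→L[ℝ] ℝ} {β : F × ℝ → (F × ℝ) [⋀^Fin 2]→L[ℝ] ℝ} {p₀ : F × ℝ}
    (hA : ∀ᶠ p in 𝓝 p₀, ContDiffAt ℝ ∞ A p) (hβ : ∀ᶠ p in 𝓝 p₀, ContDiffAt ℝ ∞ β p)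
    (hnd : Nondeg fun X Y : F × ℝ => foldForm (A p₀)
      ((β p₀).compContinuousLinearMap (ContinuousLinearMap.inl ℝ F ℝ)) ![X, Y]) :
    ∃ K : ℝ, ∀ᶠ p in 𝓝 p₀, ∀ h : ℝ → ℝ, ContDiff ℝ ∞ h → (K ≤ |h p.2| ∨ K ≤ |deriv h p.2|) →
      ∀ W : F × ℝ → (F × ℝ) [⋀^Fin 2]→L[ℝ] ℝ,
      (W =ᶠ[𝓝 p] fun p => h p.2 • wedge (covector (ContinuousLinearMap.snd ℝ F ℝ))
        ((A p).compContinuousLinearMap (ContinuousLinearMap.fst ℝ F ℝ)) + β p) →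
      wedgePow n (W p) = 0 →
      Function.Surjective (fderiv ℝ (fun p => wedgePow n (W p)) p) ∧
      ∃ j : F →L[ℝ] F × ℝ, (∀ u, fderiv ℝ (fun p => wedgePow n (W p)) p (j u) = 0) ∧
        wedgePow (n - 1) ((W p).compContinuousLinearMap j) ≠ 0 := by
  obtain ⟨e, j₀, hej, hel⟩ := exists_adapted_basis (F := F) n hF
  let βF : F × ℝ → F [⋀^Fin 2]→L[ℝ] ℝ := fun p =>
    (β p).compContinuousLinearMap (ContinuousLinearMap.inl ℝ F ℝ)
  -- On the adapted basis the top power of s dt ∧ A + β is s C + D, and C is nonzero at p₀ by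
  -- nondegeneracy.
  let C : F × ℝ → ℝ := fun p => wedgePow n (foldForm (A p) (βF p)) e
  let D : F × ℝ → ℝ := fun p => wedgePow n (β p) e
  have hlin : ∀ (s : ℝ) p, wedgePow n (s • wedge (covector (ContinuousLinearMap.snd ℝ F ℝ))
        ((A p).compContinuousLinearMap (ContinuousLinearMap.fst ℝ F ℝ)) + β p) e =
      s * C p + D p := by
    intro s p
    rw [smul_wedge_add_eq_foldForm, wedgePow_foldForm_linear e j₀ hej hel, foldForm_contractLast]
  have hCs : ∀ p, ContDiffAt ℝ ∞ A p → ContDiffAt ℝ ∞ β p → ContDiffAt ℝ ∞ C p := by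
    intro p h1 h2
    refine ContDiffAt.wedgePow_apply ?_ _
    exact (contDiffAt_const.wedge (h1.alternating_comp contDiffAt_const)).add
      ((h2.alternating_comp contDiffAt_const).alternating_comp contDiffAt_const)
  have hDs : ∀ p, ContDiffAt ℝ ∞ β p → ContDiffAt ℝ ∞ D p := fun p h => h.wedgePow_apply _
  have hA0 := hA.self_of_nhds
  have hβ0 := hβ.self_of_nhds
  have hC0 : C p₀ ≠ 0 := fun h =>
    wedgePow_foldForm_ne_zero hF _ _ hnd (eq_zero_of_apply_basis e h)
  -- the restriction to graphs
  let Ψ : (F × ℝ) × (F →L[ℝ] ℝ) × (F →L[ℝ] ℝ) → F [⋀^(Fin (n - 1) × Fin 2)]→L[ℝ] ℝ := fun q =>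
    wedgePow (n - 1) (wedge (covector q.2.2) (A q.1) +
      (β q.1).compContinuousLinearMap ((ContinuousLinearMap.id ℝ F).prod q.2.1))
  have hΨ : ContinuousAt Ψ (p₀, 0, 0) := by
    have h1 : ContDiffAt ℝ ∞ (fun q : (F × ℝ) × (F →L[ℝ] ℝ) × (F →L[ℝ] ℝ) => A q.1) (p₀, 0, 0) :=
      ContDiffAt.comp (p₀, 0, 0) (g := A) (f := Prod.fst) hA0 contDiffAt_fst
    have h2 : ContDiffAt ℝ ∞ (fun q : (F × ℝ) × (F →L[ℝ] ℝ) × (F →L[ℝ] ℝ) => β q.1) (p₀, 0, 0) :=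
      ContDiffAt.comp (p₀, 0, 0) (g := β) (f := Prod.fst) hβ0 contDiffAt_fst
    have h3 : ContDiff ℝ ∞ (fun q : (F × ℝ) × (F →L[ℝ] ℝ) × (F →L[ℝ] ℝ) =>
        (ContinuousLinearMap.id ℝ F).prod q.2.1) :=
      (ContinuousLinearMap.prodₗᵢ ℝ :
        (F →L[ℝ] F) × (F →L[ℝ] ℝ) ≃ₗᵢ[ℝ] (F →L[ℝ] F × ℝ)).contDiff.comp
        (contDiff_const.prodMk contDiff_snd.fst)
    have h4 : ContDiff ℝ ∞ (fun q : (F × ℝ) × (F →L[ℝ] ℝ) × (F →L[ℝ] ℝ) => q.2.2) := by fun_prop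
    exact (((h4.contDiffAt.covector.wedge h1).add
      (h2.alternating_comp h3.contDiffAt)).wedgePow).continuousAt
  have hΨ0 : Ψ (p₀, 0, 0) ≠ 0 := by
    have h1 : Ψ (p₀, 0, 0) = wedgePow (n - 1) (βF p₀) := by
      refine congrArg (wedgePow (n - 1)) (ext_pair fun u v => ?_)
      have h2 : (ContinuousLinearMap.id ℝ F).prod (0 : F →L[ℝ] ℝ) =
        ContinuousLinearMap.inl ℝ F ℝ := rfl
      simp [wedge_pair, covector_apply, βF, h2]
    rw [h1]
    exact wedgePow_pred_ne_zero_of_foldForm hF _ _ hnd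
  -- In Ψ the two functionals stand for the slope L of the tangent space of the fold and for h L,
  -- treated as independent. At (p₀, 0, 0) only the slice part of β is left; so η bounds how large L
  -- and h L may be.
  have hΨev : ∀ᶠ q in 𝓝 p₀ ×ˢ 𝓝 (0 : (F →L[ℝ] ℝ) × (F →L[ℝ] ℝ)), Ψ q ≠ 0 := by
    rw [← nhds_prod_eq]; exact hΨ.eventually_ne hΨ0
  obtain ⟨Pa, hPa, Pb, hPb, hΨab⟩ := eventually_prod_iff.1 hΨev
  obtain ⟨η, hη, hηb⟩ := Metric.eventually_nhds_iff.1 hPb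
  -- bounds
  set c₀ : ℝ := |C p₀| / 2 with hc₀
  have hc₀pos : 0 < c₀ := half_pos (abs_pos.2 hC0)
  set K₀ : ℝ := |D p₀| + ‖fderiv ℝ C p₀‖ + ‖fderiv ℝ D p₀‖ + 1 with hK₀
  have hC := hCs p₀ hA0 hβ0
  have hD := hDs p₀ hβ0
  have b1 : ∀ᶠ p in 𝓝 p₀, c₀ < |C p| :=
    hC.continuousAt.abs.eventually_const_lt (half_lt_self (abs_pos.2 hC0))
  have b2 : ∀ᶠ p in 𝓝 p₀, |D p| < K₀ := hD.continuousAt.abs.eventually_lt_const (by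
    have := norm_nonneg (fderiv ℝ C p₀); have := norm_nonneg (fderiv ℝ D p₀); linarith)
  have b3 : ∀ᶠ p in 𝓝 p₀, ‖fderiv ℝ C p‖ < K₀ :=
    (hC.fderiv_right (m := 0) (by simp)).continuousAt.norm.eventually_lt_const (by
      have := abs_nonneg (D p₀); have := norm_nonneg (fderiv ℝ D p₀); linarith)
  have b4 : ∀ᶠ p in 𝓝 p₀, ‖fderiv ℝ D p‖ < K₀ :=
    (hD.fderiv_right (m := 0) (by simp)).continuousAt.norm.eventually_lt_const (by
      have := abs_nonneg (D p₀); have := norm_nonneg (fderiv ℝ C p₀); linarith)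
  have hK₀pos : 0 < K₀ := by positivity
  -- At a zero of h C + D, S bounds |h|; K₂ then bounds Q = h dC + dD; and K₃ is a lower bound for
  -- the t-derivative that forces ‖L‖ (1 + S) < η.
  set S : ℝ := K₀ / c₀ with hS
  have hSpos : 0 < S := div_pos hK₀pos hc₀pos
  set K₂ : ℝ := S * K₀ + K₀ with hK₂
  have hK₂pos : 0 < K₂ := by positivity
  set K₃ : ℝ := (1 + S) * K₂ / η + 1 with hK₃
  have hK₃pos : 0 < K₃ := by positivity
  -- If |h| exceeds the first entry there is no zero; if |h'| exceeds the second, then |h' C| ≥ K₂ +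
  -- K₃, which leaves at least K₃ after subtracting the contribution of Q.
  refine ⟨max (S + 1) ((K₂ + K₃) / c₀), ?_⟩
  filter_upwards [hA, hβ, hPa, b1, b2, b3, b4] with p hAp hβp hPap hb1 hb2 hb3 hb4 h hh hK W hW hz
  have hWp : W p = h p.2 • wedge (covector (ContinuousLinearMap.snd ℝ F ℝ))
      ((A p).compContinuousLinearMap (ContinuousLinearMap.fst ℝ F ℝ)) + β p := hW.self_of_nhds
  have hCp := hCs p hAp hβp
  have hDp := hDs p hβp
  have hzero : h p.2 * C p + D p = 0 := by
    rw [← hlin, ← hWp, hz]; rfl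
  have hs : |h p.2| < S := by
    have h1 : |h p.2| * |C p| = |D p| := by
      rw [← abs_mul, show h p.2 * C p = -D p by linarith, abs_neg]
    rw [hS, lt_div_iff₀ hc₀pos]
    have := mul_le_mul_of_nonneg_left hb1.le (abs_nonneg (h p.2))
    linarith
  have hσ : (K₂ + K₃) / c₀ ≤ |deriv h p.2| := by
    rcases hK with h1 | h1
    · have := (le_max_left _ _).trans h1; linarith
    · exact (le_max_right _ _).trans h1
  set σ := deriv h p.2
  set Q : F × ℝ →L[ℝ] ℝ := h p.2 • fderiv ℝ C p + fderiv ℝ D p with hQ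
  have hQn : ‖Q‖ ≤ K₂ := by
    refine (norm_add_le _ _).trans ?_
    rw [norm_smul, Real.norm_eq_abs]
    have := mul_le_mul hs.le hb3.le (norm_nonneg _) hSpos.le
    linarith
  set P : F × ℝ → (F × ℝ) [⋀^(Fin n × Fin 2)]→L[ℝ] ℝ := fun p => wedgePow n (W p) with hP
  have hPd : DifferentiableAt ℝ P p := by
    have h1 : ContDiffAt ℝ ∞ W p := by
      refine ContDiffAt.congr_of_eventuallyEq ?_ hW
      exact ((hh.contDiffAt.comp p contDiffAt_snd).smul
        (contDiffAt_const.wedge (hAp.alternating_comp contDiffAt_const))).add hβp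
    exact h1.wedgePow.differentiableAt (by simp)
  have hder : ∀ v : F × ℝ, fderiv ℝ P p v e = σ * C p * v.2 + Q v := by
    intro v
    have h1 : HasFDerivAt (fun p => P p e)
        ((ContinuousAlternatingMap.apply ℝ (F × ℝ) ℝ e).comp (fderiv ℝ P p)) p :=
      (ContinuousAlternatingMap.apply ℝ (F × ℝ) ℝ e).hasFDerivAt.comp p hPd.hasFDerivAt
    have h2 : HasFDerivAt (fun p : F × ℝ => h p.2) (σ • ContinuousLinearMap.snd ℝ F ℝ) p :=
      (hh.differentiable (by simp) p.2).hasDerivAt.comp_hasFDerivAt p hasFDerivAt_snd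
    have h3 := (h2.mul (hCp.differentiableAt (by simp)).hasFDerivAt).add
      (hDp.differentiableAt (by simp)).hasFDerivAt
    have h4 : (fun p => P p e) =ᶠ[𝓝 p] fun p => h p.2 * C p + D p := by
      filter_upwards [hW] with p' hp'
      rw [← hlin, ← hp']
    have h5 := congrArg (fun l : F × ℝ →L[ℝ] ℝ => l v) (h1.unique (h3.congr_of_eventuallyEq h4))
    refine h5.trans ?_
    simp [hQ]
    ring
  set a : ℝ := σ * C p + Q (0, 1) with ha
  have haK : K₃ ≤ |a| := by
    have h1 : |Q (0, 1)| ≤ K₂ := by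
      have := Q.le_opNorm (0, 1)
      simp only [Prod.norm_def, norm_zero, norm_one, Real.norm_eq_abs] at this
      simp at this
      linarith
    have h2 : K₂ + K₃ ≤ |σ * C p| := by
      rw [abs_mul]
      rw [div_le_iff₀ hc₀pos] at hσ
      have := mul_le_mul_of_nonneg_left hb1.le (abs_nonneg σ)
      linarith
    have h3 := abs_sub_abs_le_abs_sub (σ * C p) (-Q (0, 1))
    rw [abs_neg, sub_neg_eq_add] at h3
    linarith
  have ha0 : a ≠ 0 := abs_pos.1 (hK₃pos.trans_le haK)
  -- Implicit differentiation: a is the t-derivative of the top coefficient, and the graph of L lies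
  -- in the kernel of its differential.
  set L : F →L[ℝ] ℝ := -(a⁻¹ • Q.comp (ContinuousLinearMap.inl ℝ F ℝ)) with hL
  have hLn : ‖L‖ * (1 + S) < η := by
    have h1 : ‖L‖ ≤ |a|⁻¹ * K₂ := by
      rw [hL, norm_neg, norm_smul, norm_inv, Real.norm_eq_abs]
      refine mul_le_mul_of_nonneg_left ?_ (by positivity)
      refine (Q.opNorm_comp_le _).trans ?_
      have := mul_le_mul_of_nonneg_left (ContinuousLinearMap.norm_inl_le_one ℝ F ℝ) (norm_nonneg Q)
      linarith
    have h2 : (1 + S) * K₂ / η < |a| := by linarith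
    rw [div_lt_iff₀ hη] at h2
    have h3 : |a|⁻¹ * K₂ * (1 + S) < η := by
      rw [mul_assoc, inv_mul_lt_iff₀ (hK₃pos.trans_le haK)]
      linarith
    exact (mul_le_mul_of_nonneg_right h1 (by linarith)).trans_lt h3
  refine ⟨fun ζ => ⟨(0, a⁻¹ * ζ e), ?_⟩, (ContinuousLinearMap.id ℝ F).prod L, fun u => ?_, ?_⟩
  · refine sub_eq_zero.1 (eq_zero_of_apply_basis e ?_)
    rw [ContinuousAlternatingMap.sub_apply, hder]
    have h1 : ((0 : F), a⁻¹ * ζ e) = (a⁻¹ * ζ e) • ((0 : F), (1 : ℝ)) := by ext <;> simp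
    have h2 : σ * C p * (a⁻¹ * ζ e) + (a⁻¹ * ζ e) * Q (0, 1) = ζ e := by
      rw [show σ * C p * (a⁻¹ * ζ e) + (a⁻¹ * ζ e) * Q (0, 1) = a * a⁻¹ * ζ e by rw [ha]; ring,
        mul_inv_cancel₀ ha0, one_mul]
    rw [h1, map_smul, smul_eq_mul]
    simp only [Prod.smul_snd, smul_eq_mul, mul_one]
    linarith
  · refine eq_zero_of_apply_basis e ?_
    rw [hder]
    have h1 : ((ContinuousLinearMap.id ℝ F).prod L) u = (u, 0) + L u • ((0 : F), (1 : ℝ)) := by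
      ext <;> simp
    rw [h1, map_add, map_smul, smul_eq_mul]
    have h2 : L u = -(a⁻¹ * Q (u, 0)) := rfl
    simp only [Prod.snd_add, Prod.smul_snd, smul_eq_mul, mul_one, zero_add]
    rw [show σ * C p * L u + (Q (u, 0) + L u * Q (0, 1)) = a * L u + Q (u, 0) by rw [ha]; ring, h2]
    field_simp
    ring
  · rw [hWp, smul_wedge_add_comp_graph]
    have hL0 : 0 ≤ ‖L‖ := norm_nonneg L
    have hLS : 0 ≤ ‖L‖ * S := mul_nonneg hL0 hSpos.le
    have hsL : |h p.2| * ‖L‖ ≤ S * ‖L‖ := mul_le_mul_of_nonneg_right hs.le hL0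
    rw [mul_add, mul_one] at hLn
    have h1 : Pb (L, h p.2 • L) := by
      refine hηb ?_
      rw [dist_zero_right, Prod.norm_def, norm_smul, Real.norm_eq_abs]
      exact max_lt (by linarith) (by linarith)
    have h2 : Ψ (p, L, h p.2 • L) ≠ 0 := hΨab hPap h1
    clear_value L
    intro h3
    exact h2 h3

end LocalFold

/-! ### Restricting and patching smooth and closed forms -/

section FormLocality

open Filter Topology

variable {E : Type*} [NormedAddCommGroup E] [NormedSpace ℝ E]
  {M : Type*} [TopologicalSpace M] [ChartedSpace E M]
  {X : Type*} [NormedAddCommGroup X] [NormedSpace ℝ X]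

theorem SmoothFormOn.mono {k : ℕ} {a : DForm E M k} {S S' : Set M} (h : SmoothFormOn a S)
    (hS : S' ⊆ S) : SmoothFormOn a S' := fun p =>
  (h p).mono fun _ hy => ⟨hy.1, hS hy.2⟩

theorem chartRep_congr {k : ℕ} {a b : DForm E M k} {S : Set M}
    (hab : ∀ p ∈ S, a p = b p) {p : M} {y : E} (hy : y ∈ chartDom S p) :
    chartRep a p y = chartRep b p y :=
  rep_congr_form (hab _ hy.2)

theorem SmoothFormOn.congr {k : ℕ} {a b : DForm E M k} {S : Set M} (h : SmoothFormOn a S)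
    (hab : ∀ p ∈ S, b p = a p) : SmoothFormOn b S := fun p =>
  (h p).congr fun _ hy => chartRep_congr hab hy

theorem ClosedFormOn.mono {k : ℕ} {a : DForm E M k} {S S' : Set M} (h : ClosedFormOn a S)
    (hS : S' ⊆ S) : ClosedFormOn a S' := fun p y hy => h p y ⟨hy.1, hS hy.2⟩

theorem ClosedFormOn.congr {k : ℕ} {a b : DForm E M k} {S : Set M} (h : ClosedFormOn a S)
    (hS : IsOpen S) (hab : ∀ p ∈ S, b p = a p) : ClosedFormOn b S := by
  intro p y hy
  have h1 : chartRep b p =ᶠ[𝓝 y] chartRep a p := by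
    filter_upwards [(isOpen_chartDom hS p).mem_nhds hy] with y' hy'
    exact chartRep_congr hab hy'
  rw [h1.extDeriv_eq]
  exact h p y hy

theorem SmoothFormOn.union {k : ℕ} {a : DForm E M k} {S S' : Set M} (h : SmoothFormOn a S)
    (h' : SmoothFormOn a S') (hS : IsOpen S) (hS' : IsOpen S') : SmoothFormOn a (S ∪ S') := by
  rintro p y ⟨hy, hyS | hyS⟩
  · exact ((h p).contDiffAt ((isOpen_chartDom hS p).mem_nhds ⟨hy, hyS⟩)).contDiffWithinAt
  · exact ((h' p).contDiffAt ((isOpen_chartDom hS' p).mem_nhds ⟨hy, hyS⟩)).contDiffWithinAt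

theorem ClosedFormOn.union {k : ℕ} {a : DForm E M k} {S S' : Set M} (h : ClosedFormOn a S)
    (h' : ClosedFormOn a S') : ClosedFormOn a (S ∪ S') := by
  rintro p y ⟨hy, hyS | hyS⟩
  · exact h p y ⟨hy, hyS⟩
  · exact h' p y ⟨hy, hyS⟩

theorem IsParam.mfderiv_symm_mfderiv {G : OpenPartialHomeomorph X M} (hG : IsParam (E := E) G)
    {y : X} (hy : y ∈ G.source) (v : X) :
    mfderiv 𝓘(ℝ, E) 𝓘(ℝ, X) G.symm (G y) (mfderiv 𝓘(ℝ, X) 𝓘(ℝ, E) G y v) = v := by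
  have h1 : MDifferentiableAt 𝓘(ℝ, E) 𝓘(ℝ, X) G.symm (G y) :=
    (hG.contMDiffOn_symm.contMDiffAt (G.open_target.mem_nhds (G.map_source hy))).mdifferentiableAt
      (by simp)
  have h2 : MDifferentiableAt 𝓘(ℝ, X) 𝓘(ℝ, E) G y :=
    (hG.contMDiffOn.contMDiffAt (G.open_source.mem_nhds hy)).mdifferentiableAt (by simp)
  have h3 := mfderiv_comp y h1 h2
  have h4 : G.symm ∘ G =ᶠ[𝓝 y] id := by
    filter_upwards [G.open_source.mem_nhds hy] with q hq using G.left_inv hq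
  rw [h4.mfderiv_eq, mfderiv_id] at h3
  exact (congrArg (fun L : X →L[ℝ] X => L v) h3).symm

end FormLocality

/-! ### The desingularized form in tube coordinates -/

section Desingularization

open Filter Topology

variable {E : Type*} [NormedAddCommGroup E] [NormedSpace ℝ E]
  {M : Type*} [TopologicalSpace M] [ChartedSpace E M]
  {F : Type*} [NormedAddCommGroup F] [NormedSpace ℝ F]
  {Z : Type*} [TopologicalSpace Z] [ChartedSpace F Z] [IsManifold 𝓘(ℝ, F) ∞ Z]
  {i : Z → M} {x : M → ℝ}

theorem IsLaurentSeries.rep_eq {m : ℕ} {T : Tube (E := E) (F := F) i x} {w : DForm E M 2}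
    {a : Fin m → DForm F Z 1} {b : DForm E M 2} (h : IsLaurentSeries T w a b)
    (hx : ContMDiff 𝓘(ℝ, E) 𝓘(ℝ, ℝ) ∞ x) (z₀ : Z) {p : F × ℝ} (hp : p ∈ (T.param z₀).source)
    (hp0 : p.2 ≠ 0) :
    rep (T.param z₀) w p = wedge ((∑ j : Fin m, p.2 ^ (j : ℕ) •
      chartRep (a j) z₀ p.1).compContinuousLinearMap (ContinuousLinearMap.fst ℝ F ℝ))
      ((p.2 ^ m)⁻¹ • covector (ContinuousLinearMap.snd ℝ F ℝ)) + rep (T.param z₀) b p := by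
  have h1 : rep (T.param z₀) w p = rep (T.param z₀) (bValue m x (laurentSum T a) b) p :=
    rep_congr_form (h.2.2 _ (T.param_mem_nbhd z₀ hp) (by rw [T.x_param z₀ hp]; exact hp0))
  rw [h1, rep_bValue, T.rep_dForm hx z₀ hp, T.rep_laurentSum a z₀ hp, T.x_param z₀ hp]

variable {k : ℕ} {r R : ℝ} {f : ℝ → ℝ}

theorem rep_desing (hx : ContMDiff 𝓘(ℝ, E) 𝓘(ℝ, ℝ) ∞ x) (T : Tube (E := E) (F := F) i x)
    (w : DForm E M 2) (a : Fin (2 * k + 1) → DForm F Z 1) (b : DForm E M 2)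
    (hf : IsFoldingProfile k r R f) (ε : ℝ) (z₀ : Z) {p : F × ℝ}
    (hp : p ∈ (T.param z₀).source) :
    rep (T.param z₀) (desing k T w a b f ε) p = deriv (rescale k f ε) p.2 •
      wedge (covector (ContinuousLinearMap.snd ℝ F ℝ)) ((∑ j : Fin (2 * k + 1), p.2 ^ (j : ℕ) •
        chartRep (a j) z₀ p.1).compContinuousLinearMap (ContinuousLinearMap.fst ℝ F ℝ)) +
      rep (T.param z₀) b p := by
  have h1 : rep (T.param z₀) (desing k T w a b f ε) p = rep (T.param z₀) (fun p =>
      wedge (dForm (fun q => rescale k f ε (x q)) p) (laurentSum T a p) + b p) p :=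
    rep_congr_form (if_pos (T.param_mem_nbhd z₀ hp))
  have h2 : rep (T.param z₀) (fun p =>
      wedge (dForm (fun q => rescale k f ε (x q)) p) (laurentSum T a p) + b p) p =
      rep (T.param z₀) (fun p =>
      wedge (dForm (fun q => rescale k f ε (x q)) p) (laurentSum T a p)) p +
      rep (T.param z₀) b p := rfl
  rw [h1, h2, rep_wedge, T.rep_laurentSum a z₀ hp,
    T.rep_dForm_comp hx z₀ hp ((hf.contDiff_rescale ε).differentiable (by simp) _)]
  congr 1
  refine ext_pair fun X Y => ?_
  simp only [wedge_pair, ContinuousAlternatingMap.smul_apply, smul_eq_mul]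
  ring

/-- There f_ε' = -t^-(2k+1), and the sign is that of the swap: -t^-(2k+1) dt ∧ A = A ∧ dt /
t^(2k+1). Off the tube the two forms agree by definition. -/
theorem desing_eq_of_le_abs (hx : ContMDiff 𝓘(ℝ, E) 𝓘(ℝ, ℝ) ∞ x) {T : Tube (E := E) (F := F) i x}
    {w : DForm E M 2} {a : Fin (2 * k + 1) → DForm F Z 1} {b : DForm E M 2}
    (h : IsLaurentSeries T w a b) (hf : IsFoldingProfile k r R f) (hR : 0 < R) {ε : ℝ}
    (hε : 0 < ε) {p : M} (hp : R * ε ≤ |x p|) : desing k T w a b f ε p = w p := by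
  by_cases hpU : p ∈ T.nbhd
  · have hpG := T.mem_param_target hpU
    set q := (T.param (T.proj p)).symm p with hq
    have hqG : q ∈ (T.param (T.proj p)).source := (T.param (T.proj p)).map_target hpG
    have hGq : T.param (T.proj p) q = p := (T.param (T.proj p)).right_inv hpG
    have hxq : x p = q.2 := by rw [← hGq]; exact T.x_param _ hqG
    have hq0 : q.2 ≠ 0 := by
      rw [← hxq]; exact abs_pos.1 ((mul_pos hR hε).trans_le hp)
    have key : rep (T.param (T.proj p)) (desing k T w a b f ε) q =
        rep (T.param (T.proj p)) w q := by
      rw [rep_desing hx T w a b hf ε _ hqG, h.rep_eq hx _ hqG hq0,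
        hf.deriv_rescale_outer hR hε (hxq ▸ hp)]
      congr 1
      refine ext_pair fun X Y => ?_
      simp only [wedge_pair, ContinuousAlternatingMap.smul_apply, smul_eq_mul]
      ring
    have := (T.isParam_param (T.proj p)).form_eq_of_rep_eq hqG key
    rwa [hGq] at this
  · exact if_neg hpU

theorem Tube.contDiffAt_rep [FiniteDimensional ℝ F] [IsManifold 𝓘(ℝ, E) ∞ M]
    (T : Tube (E := E) (F := F) i x)
    {k : ℕ} {b : DForm E M k} (hb : SmoothFormOn b T.nbhd) (z₀ : Z) {p : F × ℝ}
    (hp : p ∈ (T.param z₀).source) : ContDiffAt ℝ ∞ (rep (T.param z₀) b) p :=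
  BSymplectic.contDiffAt_rep hb T.isOpen_nbhd ((T.isParam_param z₀).contMDiffOn.contMDiffAt
    ((T.param z₀).open_source.mem_nhds hp)) (T.param_mem_nbhd z₀ hp)

end Desingularization

/-! ### Closedness of the desingularized form and nondegeneracy along Z -/

section Desingularization

open Filter Topology

variable {E : Type*} [NormedAddCommGroup E] [NormedSpace ℝ E]
  {M : Type*} [TopologicalSpace M] [ChartedSpace E M] [IsManifold 𝓘(ℝ, E) ∞ M]
  {F : Type*} [NormedAddCommGroup F] [NormedSpace ℝ F] [FiniteDimensional ℝ F]
  {Z : Type*} [TopologicalSpace Z] [ChartedSpace F Z] [IsManifold 𝓘(ℝ, F) ∞ Z]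
  {i : Z → M} {x : M → ℝ}

/-- The coefficients are closed and differentiating t^j produces a factor dt, so A ∧ h(t) dt is
closed whatever h is. The case h = t^-m gives closedness of b, and h = -f_ε' that of ω_ε. -/
theorem extDeriv_wedge_laurent_dt {m : ℕ} {a : Fin m → DForm F Z 1}
    (ha : ∀ j, SmoothFormOn (a j) univ ∧ ClosedFormOn (a j) univ) (z₀ : Z) {p : F × ℝ}
    (hp : p.1 ∈ (chartAt F z₀).target) {h : ℝ → ℝ} (hh : ContDiffAt ℝ 1 h p.2) :
    extDeriv (fun p : F × ℝ => wedge ((∑ j : Fin m, p.2 ^ (j : ℕ) •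
      chartRep (a j) z₀ p.1).compContinuousLinearMap (ContinuousLinearMap.fst ℝ F ℝ))
      (h p.2 • covector (ContinuousLinearMap.snd ℝ F ℝ))) p = 0 := by
  have hA := contDiffAt_laurent_fst (fun j => (ha j).1) z₀ hp
  have had : ∀ j, DifferentiableAt ℝ (chartRep (a j) z₀) p.1 := fun j =>
    (contDiffAt_chartRep (ha j).1 z₀ hp).differentiableAt (by simp)
  have hz : ∀ j, extDeriv (chartRep (a j) z₀) p.1 = 0 := fun j =>
    (ha j).2 z₀ p.1 ⟨by simpa using hp, mem_univ _⟩
  have key : ∀ u v : F, extDeriv (fun p : F × ℝ => (∑ j : Fin m, p.2 ^ (j : ℕ) •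
      chartRep (a j) z₀ p.1).compContinuousLinearMap (ContinuousLinearMap.fst ℝ F ℝ)) p
      ![(u, 0), (v, 0)] = 0 := by
    intro u v
    have := extDeriv_comp_fst (y := p.1) had p.2 (hA.differentiableAt (by simp)) u v
    refine this.trans (Finset.sum_eq_zero fun j _ => ?_)
    rw [hz j]
    exact mul_zero _
  refine ext_triple fun X Y U => ?_
  rw [extDeriv_wedge_dt (hA.of_le (by simp)) hh, key, key, key]
  simp

/-- Off Z, b is the difference of two closed forms; on Z, db vanishes by continuity, as t ≠ 0 is
dense. -/
theorem IsLaurentSeries.extDeriv_rep_remainder {m : ℕ} {T : Tube (E := E) (F := F) i x}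
    {w : DForm E M 2} {a : Fin m → DForm F Z 1} {b : DForm E M 2} (h : IsLaurentSeries T w a b)
    (hx : ContMDiff 𝓘(ℝ, E) 𝓘(ℝ, ℝ) ∞ x) (hws : SmoothFormOn w {p | x p ≠ 0})
    (hwc : ClosedFormOn w {p | x p ≠ 0}) (z₀ : Z) {p : F × ℝ} (hp : p ∈ (T.param z₀).source) :
    extDeriv (rep (T.param z₀) b) p = 0 := by
  have hS : IsOpen {p | x p ≠ 0} := isOpen_ne_fun hx.continuous continuous_const
  have hsrc := T.param_source z₀
  have main : ∀ p ∈ (T.param z₀).source, p.2 ≠ 0 → extDeriv (rep (T.param z₀) b) p = 0 := by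
    intro p hp hp0
    have hy : p.1 ∈ (chartAt F z₀).target := by
      rw [hsrc] at hp; exact hp.1
    have hd : extDeriv (rep (T.param z₀) w) p = 0 :=
      extDeriv_rep_eq_zero hws hwc hS ((T.isParam_param z₀).contMDiffOn.contMDiffAt
        ((T.param z₀).open_source.mem_nhds hp))
        (by rw [mem_ofPred_eq, T.x_param z₀ hp]; exact hp0)
    have hinv : ContDiffAt ℝ ∞ (fun s : ℝ => (s ^ m)⁻¹) p.2 :=
      (contDiffAt_id.pow m).inv (pow_ne_zero m hp0)
    have hc : ContDiffAt ℝ ∞ (fun p : F × ℝ => (p.2 ^ m)⁻¹ •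
        covector (ContinuousLinearMap.snd ℝ F ℝ)) p :=
      (ContDiffAt.comp p (g := fun s : ℝ => (s ^ m)⁻¹) (f := Prod.snd) hinv
        contDiffAt_snd).smul contDiffAt_const
    have hA := contDiffAt_laurent_fst (fun j => (h.1 j).1) z₀ hy
    have hwe : rep (T.param z₀) w =ᶠ[𝓝 p] (fun p : F × ℝ => wedge ((∑ j : Fin m, p.2 ^ (j : ℕ) •
        chartRep (a j) z₀ p.1).compContinuousLinearMap (ContinuousLinearMap.fst ℝ F ℝ))
        ((p.2 ^ m)⁻¹ • covector (ContinuousLinearMap.snd ℝ F ℝ))) + rep (T.param z₀) b := by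
      have hne : ∀ᶠ p : F × ℝ in 𝓝 p, p.2 ≠ 0 := continuous_snd.continuousAt.eventually_ne hp0
      filter_upwards [(T.param z₀).open_source.mem_nhds hp, hne] with p' hp' hp0'
      exact h.rep_eq hx z₀ hp' hp0'
    rw [hwe.extDeriv_eq, extDeriv_add ((hA.wedge hc).differentiableAt (by simp))
      ((T.contDiffAt_rep h.2.1 z₀ hp).differentiableAt (by simp)),
      extDeriv_wedge_laurent_dt h.1 z₀ hy (h := fun s => (s ^ m)⁻¹) (hinv.of_le (by simp)),
      zero_add] at hd
    exact hd
  by_cases hp0 : p.2 = 0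
  · have hcont : ContinuousAt (extDeriv (rep (T.param z₀) b)) p :=
      (ContinuousAlternatingMap.alternatizeUncurryFinCLM ℝ (F × ℝ) ℝ).continuous.continuousAt.comp
        ((T.contDiffAt_rep h.2.1 z₀ hp).fderiv_right (m := 0) (by simp)).continuousAt
    have hl : Tendsto (fun t : ℝ => (p.1, t)) (𝓝[≠] 0) (𝓝 p) := by
      have : ContinuousAt (fun t : ℝ => (p.1, t)) 0 := by fun_prop
      have h2 := this.tendsto.mono_left (nhdsWithin_le_nhds (s := {(0 : ℝ)}ᶜ))
      rwa [← hp0] at h2 ⊢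
    refine tendsto_nhds_unique_of_eventuallyEq (hcont.tendsto.comp hl)
      (tendsto_const_nhds (x := (0 : (F × ℝ) [⋀^Fin 3]→L[ℝ] ℝ))) ?_
    filter_upwards [hl.eventually ((T.param z₀).open_source.mem_nhds hp), self_mem_nhdsWithin]
      with t ht ht0
    exact main _ ht ht0
  · exact main p hp hp0

variable {k : ℕ} {r R : ℝ} {f : ℝ → ℝ}

theorem contDiffAt_rep_desing (hx : ContMDiff 𝓘(ℝ, E) 𝓘(ℝ, ℝ) ∞ x)
    {T : Tube (E := E) (F := F) i x}
    {w : DForm E M 2} {a : Fin (2 * k + 1) → DForm F Z 1} {b : DForm E M 2}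
    (h : IsLaurentSeries T w a b) (hf : IsFoldingProfile k r R f) (ε : ℝ) (z₀ : Z) {p : F × ℝ}
    (hp : p ∈ (T.param z₀).source) :
    ContDiffAt ℝ ∞ (rep (T.param z₀) (desing k T w a b f ε)) p := by
  have hy : p.1 ∈ (chartAt F z₀).target := by
    have hp' := hp
    rw [T.param_source] at hp'; exact hp'.1
  refine ((((hf.contDiff_deriv_rescale ε).contDiffAt.comp p contDiffAt_snd).smul
    ((contDiffAt_const (c := covector (ContinuousLinearMap.snd ℝ F ℝ))).wedge
      (contDiffAt_laurent_fst (fun j => (h.1 j).1) z₀ hy))).add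
    (T.contDiffAt_rep h.2.1 z₀ hp)).congr_of_eventuallyEq ?_
  filter_upwards [(T.param z₀).open_source.mem_nhds hp] with p' hp'
  exact rep_desing hx T w a b hf ε z₀ hp'

theorem closedFormOn_desing_nbhd (hx : ContMDiff 𝓘(ℝ, E) 𝓘(ℝ, ℝ) ∞ x)
    {T : Tube (E := E) (F := F) i x}
    {w : DForm E M 2} {a : Fin (2 * k + 1) → DForm F Z 1} {b : DForm E M 2}
    (h : IsLaurentSeries T w a b) (hws : SmoothFormOn w {p | x p ≠ 0})
    (hwc : ClosedFormOn w {p | x p ≠ 0}) (hf : IsFoldingProfile k r R f) (ε : ℝ) :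
    ClosedFormOn (desing k T w a b f ε) T.nbhd := by
  intro p y hy
  set z₀ := T.proj ((extChartAt 𝓘(ℝ, E) p).symm y)
  have hq := T.mem_param_target hy.2
  have hqs := (T.param z₀).map_target hq
  refine (T.isParam_param z₀).extDeriv_chartRep hy.1 hq
    ((contDiffAt_rep_desing hx h hf ε z₀ hqs).differentiableAt (by simp)) ?_
  set q := (T.param z₀).symm ((extChartAt 𝓘(ℝ, E) p).symm y)
  have hyq : q.1 ∈ (chartAt F z₀).target := by
    have hq' := hqs
    rw [T.param_source] at hq'; exact hq'.1
  have hs : ContDiff ℝ ∞ fun t => -deriv (rescale k f ε) t := (hf.contDiff_deriv_rescale ε).neg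
  have hA := contDiffAt_laurent_fst (fun j => (h.1 j).1) z₀ hyq
  have hc : ContDiffAt ℝ ∞ (fun p : F × ℝ => (-deriv (rescale k f ε) p.2) •
      covector (ContinuousLinearMap.snd ℝ F ℝ)) q :=
    (ContDiffAt.comp q (g := fun t => -deriv (rescale k f ε) t) (f := Prod.snd) hs.contDiffAt
      contDiffAt_snd).smul contDiffAt_const
  have he : rep (T.param z₀) (desing k T w a b f ε) =ᶠ[𝓝 q] (fun p : F × ℝ =>
      wedge ((∑ j : Fin (2 * k + 1), p.2 ^ (j : ℕ) •
        chartRep (a j) z₀ p.1).compContinuousLinearMap (ContinuousLinearMap.fst ℝ F ℝ))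
        ((-deriv (rescale k f ε) p.2) • covector (ContinuousLinearMap.snd ℝ F ℝ))) +
      rep (T.param z₀) b := by
    filter_upwards [(T.param z₀).open_source.mem_nhds hqs] with p' hp'
    rw [rep_desing hx T w a b hf ε z₀ hp']
    refine ext_pair fun X Y => ?_
    simp only [Pi.add_apply, ContinuousAlternatingMap.add_apply, wedge_pair,
      ContinuousAlternatingMap.smul_apply, smul_eq_mul]
    ring
  rw [he.extDeriv_eq, extDeriv_add ((hA.wedge hc).differentiableAt (by simp))
      ((T.contDiffAt_rep h.2.1 z₀ hqs).differentiableAt (by simp)),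
      extDeriv_wedge_laurent_dt h.1 z₀ hyq (h := fun t => -deriv (rescale k f ε) t)
        (hs.contDiffAt.of_le (by simp)), h.extDeriv_rep_remainder hx hws hwc z₀ hqs, add_zero]

/-- The forms `A` and `β` of a Laurent series `A ∧ dx / x ^ m + β` of a `b^m`-symplectic form
satisfy on the hypersurface the nondegeneracy condition of folded forms. -/
theorem IsLaurentSeries.nondeg {m : ℕ} (hm : m ≠ 0) {T : Tube (E := E) (F := F) i x}
    {w : DForm E M 2} {a : Fin m → DForm F Z 1} {b : DForm E M 2} (h : IsLaurentSeries T w a b)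
    (hx : ContMDiff 𝓘(ℝ, E) 𝓘(ℝ, ℝ) ∞ x) (hw : IsBSymplectic m x w) (z₀ : Z) {p : F × ℝ}
    (hp : p ∈ (T.param z₀).source) (hp0 : p.2 = 0) :
    Nondeg fun X Y : F × ℝ => foldForm (∑ j : Fin m, p.2 ^ (j : ℕ) • chartRep (a j) z₀ p.1)
      ((rep (T.param z₀) b p).compContinuousLinearMap (ContinuousLinearMap.inl ℝ F ℝ)) ![X, Y] := by
  obtain ⟨-, -, α, β, hα, hβ, hwe, hnd⟩ := hw
  set G := T.param z₀ with hGdef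
  have hG : IsParam (E := E) G := T.isParam_param z₀
  have hGs : ContMDiffAt 𝓘(ℝ, F × ℝ) 𝓘(ℝ, E) ∞ G p :=
    hG.contMDiffOn.contMDiffAt (G.open_source.mem_nhds hp)
  have hαs : ContDiffAt ℝ ∞ (rep G α) p := contDiffAt_rep hα isOpen_univ hGs (mem_univ _)
  have hβs : ContDiffAt ℝ ∞ (rep G β) p := contDiffAt_rep hβ isOpen_univ hGs (mem_univ _)
  have hbs : ContDiffAt ℝ ∞ (rep G b) p := T.contDiffAt_rep h.2.1 z₀ hp
  have hy : p.1 ∈ (chartAt F z₀).target := by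
    have hp' := hp
    rw [hGdef, T.param_source] at hp'; exact hp'.1
  set A : F × ℝ → F [⋀^Fin 1]→L[ℝ] ℝ := fun p => ∑ j : Fin m, p.2 ^ (j : ℕ) •
    chartRep (a j) z₀ p.1 with hA
  have hAs : ContDiffAt ℝ ∞ A p := contDiffAt_laurent (fun j => (h.1 j).1) z₀ hy
  have hl : Tendsto (fun t : ℝ => (p.1, t)) (𝓝[≠] 0) (𝓝 p) := by
    have : ContinuousAt (fun t : ℝ => (p.1, t)) 0 := by fun_prop
    have h2 := this.tendsto.mono_left (nhdsWithin_le_nhds (s := {(0 : ℝ)}ᶜ))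
    rwa [← hp0] at h2 ⊢
  have heq : ∀ᶠ t : ℝ in 𝓝[≠] 0, wedge (rep G α (p.1, t))
      ((t ^ m)⁻¹ • covector (ContinuousLinearMap.snd ℝ F ℝ)) + rep G β (p.1, t) =
      wedge ((A (p.1, t)).compContinuousLinearMap (ContinuousLinearMap.fst ℝ F ℝ))
      ((t ^ m)⁻¹ • covector (ContinuousLinearMap.snd ℝ F ℝ)) + rep G b (p.1, t) := by
    filter_upwards [hl.eventually (G.open_source.mem_nhds hp), self_mem_nhdsWithin] with t ht ht0
    rw [← h.rep_eq hx z₀ ht ht0, ← T.rep_dForm hx z₀ ht]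
    have h1 : rep G w (p.1, t) = rep G (bValue m x α β) (p.1, t) :=
      rep_congr_form (hwe _ (by rw [hGdef, T.x_param z₀ ht]; exact ht0))
    rw [h1, rep_bValue, hGdef, T.x_param z₀ ht]
  -- The decomposition of w into a one-form and a two-form is not unique, so the given α and β are
  -- compared with A and b only along Z. Horizontal pairs do not see dx, so β and b agree on them
  -- off Z, and on Z in the limit.
  have hβb : ∀ u v : F, rep G β p ![(u, 0), (v, 0)] = rep G b p ![(u, 0), (v, 0)] := by
    intro u v
    refine tendsto_nhds_unique_of_eventuallyEq
      ((hβs.alternating_apply ![(u, 0), (v, 0)]).continuousAt.tendsto.comp hl)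
      ((hbs.alternating_apply ![(u, 0), (v, 0)]).continuousAt.tendsto.comp hl) ?_
    filter_upwards [heq] with t ht
    have := congrArg (fun η : (F × ℝ) [⋀^Fin 2]→L[ℝ] ℝ => η ![(u, 0), (v, 0)]) ht
    simpa [wedge_pair, covector_apply] using this
  -- Multiply the (u, ∂/∂t) component by t^m and let t → 0: the two-forms drop out because m ≠ 0.
  have hαA : ∀ u : F, rep G α p ![(u, 0)] = A p ![u] := by
    intro u
    have htm : Tendsto (fun t : ℝ => t ^ m) (𝓝[≠] 0) (𝓝 0) := by
      have : Tendsto (fun t : ℝ => t) (𝓝[≠] 0) (𝓝 0) := nhdsWithin_le_nhds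
      simpa [hm] using this.pow m
    have e1 := ((hαs.alternating_apply ![(u, 0)]).continuousAt.tendsto.comp hl).add
      (htm.mul ((hβs.alternating_apply ![(u, 0), (0, 1)]).continuousAt.tendsto.comp hl))
    have e2 := ((hAs.alternating_apply ![u]).continuousAt.tendsto.comp hl).add
      (htm.mul ((hbs.alternating_apply ![(u, 0), (0, 1)]).continuousAt.tendsto.comp hl))
    have e3 := tendsto_nhds_unique_of_eventuallyEq e1 e2 (by
      filter_upwards [heq, self_mem_nhdsWithin] with t ht ht0
      have h1 := congrArg (fun η : (F × ℝ) [⋀^Fin 2]→L[ℝ] ℝ => η ![(u, 0), (0, 1)]) ht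
      have ht0' : t ^ m ≠ 0 := pow_ne_zero m ht0
      simp only [ContinuousAlternatingMap.add_apply, wedge_pair, comp_single,
        ContinuousAlternatingMap.smul_apply, covector_apply, smul_eq_mul] at h1
      simp at h1
      field_simp at h1
      simp only [Function.comp_apply]
      linarith)
    simpa using e3
  intro X hX
  have hxp : x (G p) = 0 := by rw [hGdef, T.x_param z₀ hp, hp0]
  let dκ : E →L[ℝ] F × ℝ := mfderiv 𝓘(ℝ, E) 𝓘(ℝ, F × ℝ) G.symm (G p)
  let dG : F × ℝ →L[ℝ] E := mfderiv 𝓘(ℝ, F × ℝ) 𝓘(ℝ, E) G p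
  have hdd : ∀ v, dκ (dG v) = v := hG.mfderiv_symm_mfderiv hp
  have hdx : ∀ V : E, mfderiv 𝓘(ℝ, E) 𝓘(ℝ, ℝ) x (G p) V = (dκ V).2 := by
    intro V
    have h1 := hG.apply_eq_rep (dForm (E := E) x) hp ![V]
    rw [T.rep_dForm hx z₀ hp] at h1
    exact h1
  have h1 : ∀ (η : DForm E M 1) (V : E), η (G p) ![V] = rep G η p ![dκ V] := by
    intro η V
    rw [hG.apply_eq_rep η hp]
    congr 1
    funext l
    fin_cases l
    rfl
  have h2 : ∀ (η : DForm E M 2) (U V : E), η (G p) ![U, V] = rep G η p ![dκ U, dκ V] := by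
    intro η U V
    rw [hG.apply_eq_rep η hp]
    congr 1
    funext l
    fin_cases l <;> rfl
  have hU : dG (X.1, 0) ∈ (mfderiv 𝓘(ℝ, E) 𝓘(ℝ, ℝ) x (G p)).ker := by
    exact (hdx _).trans (congrArg Prod.snd (hdd (X.1, 0)))
  -- The sign in -X.2 converts A ∧ dx / x^m into dt ∧ A: the vector u + s x^m ∂/∂x corresponds to
  -- (u, -s).
  have key := hnd (G p) hxp (⟨dG (X.1, 0), hU⟩, -X.2) (by
    rintro ⟨⟨V, hV⟩, τ⟩
    have hV1 : dκ V = ((dκ V).1, 0) := Prod.ext rfl ((hdx V).symm.trans hV)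
    have h3 := hX ((dκ V).1, -τ)
    simp only [foldForm_pair, comp_pair] at h3
    simp only [bValueOnZ]
    refine (congrArg₂ (· + ·) (congrArg₂ (· - ·) (congrArg (· * τ) (h1 α _))
      (congrArg (· * (-X.2)) (h1 α _))) (h2 β _ _)).trans ?_
    rw [hdd, hV1, hαA, hαA, hβb]
    refine Eq.trans ?_ h3
    simp only [ContinuousLinearMap.inl_apply]
    ring)
  have k1 : dG (X.1, 0) = 0 := congrArg Subtype.val (congrArg Prod.fst key)
  have k2 : -X.2 = 0 := congrArg Prod.snd key
  have k3 := hdd (X.1, 0)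
  rw [k1, map_zero] at k3
  exact Prod.ext (congrArg Prod.fst k3).symm (by simpa using k2)

end Desingularization

/-! ### Uniformity over Z and the global conclusion -/

section Folding

open Filter Topology

variable {E : Type*} [NormedAddCommGroup E] [NormedSpace ℝ E]
  {M : Type*} [TopologicalSpace M] [ChartedSpace E M] [IsManifold 𝓘(ℝ, E) ∞ M]
  {F : Type*} [NormedAddCommGroup F] [NormedSpace ℝ F] [FiniteDimensional ℝ F]
  {Z : Type*} [TopologicalSpace Z] [ChartedSpace F Z] [IsManifold 𝓘(ℝ, F) ∞ Z]
  {i : Z → M} {x : M → ℝ}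
  {k : ℕ} {r R : ℝ} {f : ℝ → ℝ}

omit [IsManifold 𝓘(ℝ, E) ∞ M] [IsManifold 𝓘(ℝ, F) ∞ Z] [FiniteDimensional ℝ F] in
theorem Tube.chartAt_mem_source (T : Tube (E := E) (F := F) i x) {z₀ z : Z} {t : ℝ}
    (hz : z ∈ (chartAt F z₀).source) (ht : t ∈ Ioo (-T.δ) T.δ) :
    (chartAt F z₀ z, t) ∈ (T.param z₀).source := by
  rw [T.param_source]
  exact ⟨(chartAt F z₀).map_source hz, ht⟩

omit [IsManifold 𝓘(ℝ, E) ∞ M] [IsManifold 𝓘(ℝ, F) ∞ Z] [FiniteDimensional ℝ F] in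
theorem Tube.param_chartAt (T : Tube (E := E) (F := F) i x) {z₀ z : Z} (t : ℝ)
    (hz : z ∈ (chartAt F z₀).source) : T.param z₀ (chartAt F z₀ z, t) = T.Φ (z, t) := by
  rw [T.param_apply]
  simp only
  rw [(chartAt F z₀).left_inv hz]

/-- Since f_ε'(0) = 0, the pullback to Z is that of β alone, whose (n-1)-st power is nonzero. No
smallness of ε enters. -/
theorem wedgePow_pullback_desing_ne_zero {n : ℕ} (hF : Module.finrank ℝ F + 1 = 2 * n)
    (hx : ContMDiff 𝓘(ℝ, E) 𝓘(ℝ, ℝ) ∞ x) {T : Tube (E := E) (F := F) i x}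
    {w : DForm E M 2} {a : Fin (2 * k + 1) → DForm F Z 1} {b : DForm E M 2}
    (h : IsLaurentSeries T w a b) (hw : IsBSymplectic (2 * k + 1) x w)
    (hf : IsFoldingProfile k r R f) (hr : 0 < r) {ε : ℝ} (hε : 0 < ε) (z : Z) :
    wedgePow (n - 1) (pullback (E := F) (F := E) i (desing k T w a b f ε) z) ≠ 0 := by
  have hz := mem_chart_source F z
  have hp := T.chartAt_mem_source hz T.zero_mem
  have hnd := h.nondeg (Nat.succ_ne_zero _) hx hw z hp rfl
  have hne := wedgePow_pred_ne_zero_of_foldForm hF _ _ hnd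
  have hi : i = fun z => T.Φ (z, 0) := funext fun z => (T.apply_zero z).symm
  have h1 := T.chartRep_pullback_slice (desing k T w a b f ε) z hp
  rw [rep_desing hx T w a b hf ε z hp, hf.deriv_rescale_inner hε (by simpa using mul_pos hr hε),
    mul_zero, zero_smul, zero_add] at h1
  intro h0
  refine hne ?_
  rw [← h1, ← hi]
  have h2 : chartRep (pullback (E := F) (F := E) i (desing k T w a b f ε)) z (chartAt F z z) =
      (pullback (E := F) (F := E) i (desing k T w a b f ε)
        ((chartAt F z).symm (chartAt F z z))).compContinuousLinearMap
        (mfderiv 𝓘(ℝ, F) 𝓘(ℝ, F) (extChartAt 𝓘(ℝ, F) z).symm (chartAt F z z)) := rfl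
  refine (congrArg (wedgePow (n - 1)) h2).trans ((wedgePow_comp _ _ _).trans ?_)
  rw [(chartAt F z).left_inv hz, h0]
  rfl

omit [FiniteDimensional ℝ F] [NormedSpace ℝ F] in
theorem exists_box_of_eventually {P : F × ℝ → Prop} {y₀ : F} (h : ∀ᶠ p in 𝓝 (y₀, (0 : ℝ)), P p) :
    ∃ V ∈ 𝓝 y₀, ∃ ρ : ℝ, 0 < ρ ∧ ∀ y ∈ V, ∀ t, |t| < ρ → P (y, t) := by
  rw [nhds_prod_eq] at h
  obtain ⟨Pa, hPa, Pb, hPb, hab⟩ := eventually_prod_iff.1 h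
  obtain ⟨ρ, hρ, hρb⟩ := Metric.eventually_nhds_iff.1 hPb
  exact ⟨{y | Pa y}, hPa, ρ, hρ, fun y hy t ht => hab hy (hρb (by simpa using ht))⟩

/-- The folding conditions for the form `w` at the point `p`. -/
def FoldedAt (n : ℕ) (w : DForm E M 2) (p : M) : Prop :=
  wedgePow n (w p) = 0 →
    Function.Surjective (fderiv ℝ (topRep n w p) (extChartAt 𝓘(ℝ, E) p p)) ∧
    wedgePow (n - 1) ((chartRep w p (extChartAt 𝓘(ℝ, E) p p)).compContinuousLinearMap
      (fderiv ℝ (topRep n w p) (extChartAt 𝓘(ℝ, E) p p)).ker.subtypeL) ≠ 0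

/-- For rε ≤ |t| < Rε the first derivative of f_ε is at least c ε^-(2k+1) in size; for |t| < rε the
second is 2 ε^-(2k+2) in size. For small ε each passes the threshold K of `eventually_folded`.
Stating this near (0, z₀) jointly in ε and z prepares the compactness argument over Z. -/
theorem eventually_foldedAt_desing [FiniteDimensional ℝ E] {n : ℕ}
    (hF : Module.finrank ℝ F + 1 = 2 * n)
    (hx : ContMDiff 𝓘(ℝ, E) 𝓘(ℝ, ℝ) ∞ x) {T : Tube (E := E) (F := F) i x}
    {w : DForm E M 2} {a : Fin (2 * k + 1) → DForm F Z 1} {b : DForm E M 2}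
    (h : IsLaurentSeries T w a b) (hw : IsBSymplectic (2 * k + 1) x w)
    (hf : IsFoldingProfile k r R f) (hr : 0 < r) (z₀ : Z) :
    ∀ᶠ q : ℝ × Z in 𝓝 (0, z₀), 0 < q.1 → ∀ t, |t| < R * q.1 →
      FoldedAt n (desing k T w a b f q.1) (T.Φ (q.2, t)) := by
  have hz₀ := mem_chart_source F z₀
  set G := T.param z₀ with hG
  set p₀ : F × ℝ := (chartAt F z₀ z₀, 0) with hp₀
  have hp : p₀ ∈ G.source := T.chartAt_mem_source hz₀ T.zero_mem
  have hA : ∀ᶠ p in 𝓝 p₀, ContDiffAt ℝ ∞ (fun p : F × ℝ => ∑ j : Fin (2 * k + 1),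
      p.2 ^ (j : ℕ) • chartRep (a j) z₀ p.1) p := by
    filter_upwards [G.open_source.mem_nhds hp] with p hp'
    rw [hG, T.param_source] at hp'
    exact contDiffAt_laurent (fun j => (h.1 j).1) z₀ hp'.1
  have hb : ∀ᶠ p in 𝓝 p₀, ContDiffAt ℝ ∞ (rep G b) p := by
    filter_upwards [G.open_source.mem_nhds hp] with p hp'
    exact T.contDiffAt_rep h.2.1 z₀ hp'
  obtain ⟨K, hK⟩ := eventually_folded hF hA hb
    (h.nondeg (Nat.succ_ne_zero _) hx hw z₀ hp rfl)
  obtain ⟨V, hV, ρ, hρ, hVρ⟩ := exists_box_of_eventually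
    (Filter.Eventually.and (G.open_source.eventually_mem hp) hK)
  obtain ⟨c, hc, hcf⟩ := hf.exists_le_abs_deriv hr
  have hpow : ∀ j : ℕ, j ≠ 0 → ∀ B : ℝ, ∀ᶠ ε : ℝ in 𝓝 0, 0 < ε → B ≤ (ε ^ j)⁻¹ := by
    intro j hj B
    have h1 : Tendsto (fun ε : ℝ => (ε ^ j)⁻¹) (𝓝[>] 0) atTop := by
      refine tendsto_inv_nhdsGT_zero.comp (tendsto_nhdsWithin_iff.2 ⟨?_, ?_⟩)
      · have : Tendsto (fun ε : ℝ => ε) (𝓝[>] 0) (𝓝 0) := nhdsWithin_le_nhds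
        simpa [hj] using this.pow j
      · filter_upwards [self_mem_nhdsWithin] with ε (hε : 0 < ε) using pow_pos hε j
    exact eventually_nhdsWithin_iff.1 (h1.eventually_ge_atTop B)
  have hRρ : ∀ᶠ ε : ℝ in 𝓝 0, R * ε < ρ := by
    have : ContinuousAt (fun ε : ℝ => R * ε) 0 := by fun_prop
    exact this.eventually_lt_const (by simpa using hρ)
  have hzV : ∀ᶠ z in 𝓝 z₀, z ∈ (chartAt F z₀).source ∧ chartAt F z₀ z ∈ V :=
    ((chartAt F z₀).open_source.eventually_mem hz₀).and
      (((chartAt F z₀).continuousAt hz₀).eventually hV)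
  refine (((hpow (2 * k + 1) (by omega) (K / c)).and
    ((hpow (2 * k + 2) (by omega) (K / 2)).and hRρ)).prod_nhds hzV).mono ?_
  rintro ⟨ε, z⟩ ⟨⟨h1, h2, h3⟩, hzs, hzV⟩ hε t ht
  simp only at h1 h2 h3 hzs hzV hε ht ⊢
  obtain ⟨hsrc, hfold⟩ := hVρ _ hzV t (ht.trans h3)
  rw [← T.param_chartAt t hzs]
  intro hzero
  refine (T.isParam_param z₀).folded hsrc (contDiffAt_rep_desing hx h hf ε z₀ hsrc) hzero
    (hfold _ (hf.contDiff_deriv_rescale ε) ?_ _ ?_)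
  · simp only
    by_cases htr : |t| < r * ε
    · right
      rw [hf.deriv_deriv_rescale_inner hε htr, abs_mul, abs_neg, abs_two,
        abs_of_pos (inv_pos.2 (pow_pos hε _))]
      have := h2 hε
      linarith
    · left
      rw [hf.deriv_rescale, abs_mul, abs_of_pos (inv_pos.2 (pow_pos hε _))]
      have e1 : |t / ε| = |t| / ε := by rw [abs_div, abs_of_pos hε]
      have e2 : c ≤ |deriv f (t / ε)| := hcf _ (by rw [e1, le_div_iff₀ hε]; linarith)
        (by rw [e1, div_le_iff₀ hε]; exact ht.le)
      have e3 := h1 hε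
      rw [div_le_iff₀ hc] at e3
      exact e3.trans (mul_le_mul_of_nonneg_left e2 (inv_pos.2 (pow_pos hε _)).le)
  · filter_upwards [G.open_source.mem_nhds hsrc] with p hp'
    exact rep_desing hx T w a b hf ε z₀ hp'

-- The complement of the tube is compact and misses Z, so |x| is bounded below on it.
omit [IsManifold 𝓘(ℝ, E) ∞ M] [IsManifold 𝓘(ℝ, F) ∞ Z] [FiniteDimensional ℝ F] in
theorem Tube.exists_lt_abs [CompactSpace M] (hx : Continuous x) (hZ : range i = {p | x p = 0})
    (T : Tube (E := E) (F := F) i x) : ∃ c, 0 < c ∧ ∀ p, |x p| < c → p ∈ T.nbhd := by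
  have hcpt : IsCompact T.nbhdᶜ := T.isOpen_nbhd.isClosed_compl.isCompact
  obtain ⟨c, hc, h⟩ := hcpt.exists_forall_le' (f := fun p => |x p|) (a := 0)
    hx.abs.continuousOn (by
      intro p hp
      refine abs_pos.2 fun h0 => hp ?_
      obtain ⟨z, rfl⟩ : p ∈ range i := hZ ▸ h0
      rw [← T.apply_zero z]
      exact T.Φ.map_source (T.mem_source T.zero_mem))
  refine ⟨c, hc, fun p hp => ?_⟩
  by_contra hpU
  exact absurd (h p hpU) (not_le.2 hp)

/-- The desingularization theorem for `b^{2k+1}`-symplectic forms. -/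
theorem exists_forall_isFoldedSymplectic_desing [FiniteDimensional ℝ E] [CompactSpace M]
    [CompactSpace Z] {n : ℕ}
    (hE : Module.finrank ℝ E = 2 * n) (hF : Module.finrank ℝ F + 1 = 2 * n)
    (hx : ContMDiff 𝓘(ℝ, E) 𝓘(ℝ, ℝ) ∞ x) (hZ : range i = {p | x p = 0})
    {T : Tube (E := E) (F := F) i x}
    {w : DForm E M 2} {a : Fin (2 * k + 1) → DForm F Z 1} {b : DForm E M 2}
    (h : IsLaurentSeries T w a b) (hw : IsBSymplectic (2 * k + 1) x w)
    (hf : IsFoldingProfile k r R f) (hr : 0 < r) (hR : 0 < R) :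
    ∃ ε₀ : ℝ, 0 < ε₀ ∧ ∀ ε : ℝ, 0 < ε → ε < ε₀ →
      IsFoldedSymplectic n (desing k T w a b f ε) := by
  obtain ⟨c, hc, hcU⟩ := T.exists_lt_abs hx.continuous hZ
  have hev : ∀ᶠ ε : ℝ in 𝓝 0, ∀ z ∈ (univ : Set Z), 0 < ε → ∀ t, |t| < R * ε →
      FoldedAt n (desing k T w a b f ε) (T.Φ (z, t)) :=
    isCompact_univ.eventually_forall_of_forall_eventually fun z _ =>
      eventually_foldedAt_desing hF hx h hw hf hr z
  have hRc : ∀ᶠ ε : ℝ in 𝓝 0, R * ε < c := by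
    have : ContinuousAt (fun ε : ℝ => R * ε) 0 := by fun_prop
    exact this.eventually_lt_const (by simpa using hc)
  obtain ⟨ε₀, hε₀, hε₀'⟩ := Metric.eventually_nhds_iff.1 (hev.and hRc)
  refine ⟨ε₀, hε₀, fun ε hε hεε₀ => ?_⟩
  obtain ⟨hfold, hRε⟩ := hε₀' (y := ε) (by simpa [abs_of_pos hε] using hεε₀)
  have hout : ∀ p, R * ε ≤ |x p| → desing k T w a b f ε p = w p := fun p hp =>
    desing_eq_of_le_abs hx h hf hR hε hp
  have hws : SmoothFormOn w {p | x p ≠ 0} := by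
    obtain ⟨-, -, α, β, hα, hβ, hwe, -⟩ := hw
    exact smoothFormOn_of_eq_bValue hx hα hβ hwe
  have hV : IsOpen {p | R * ε < |x p|} := isOpen_lt continuous_const hx.continuous.abs
  have hV0 : {p | R * ε < |x p|} ⊆ {p | x p ≠ 0} := fun p hp =>
    abs_pos.1 ((mul_pos hR hε).trans hp)
  -- Smoothness and closedness are local: the tube is handled in its coordinates, and on R ε < |x|
  -- the form is w.
  have hcover : T.nbhd ∪ {p | R * ε < |x p|} = univ := by
    refine eq_univ_of_forall fun p => ?_
    by_cases hp : |x p| < c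
    · exact Or.inl (hcU p hp)
    · exact Or.inr (hRε.trans_le (not_lt.1 hp))
  have hall : ∀ p, FoldedAt n (desing k T w a b f ε) p := by
    intro p
    by_cases hp : |x p| < R * ε
    · have hpU := hcU p (hp.trans hRε)
      have h1 := hfold (T.Φ.symm p).1 (mem_univ _) hε (T.Φ.symm p).2 (by
        have h2 : T.Φ.symm p ∈ T.Φ.source := T.Φ.map_target hpU
        rw [T.source_eq] at h2
        have h3 := T.normal_coord (T.Φ.symm p).1 _ h2.2
        rw [Prod.mk.eta, T.Φ.right_inv hpU] at h3
        rwa [← h3])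
      rwa [Prod.mk.eta, T.Φ.right_inv hpU] at h1
    -- Here the form is w at a point off Z, which is nondegenerate, so its top power cannot vanish.
    · intro h0
      have hle := not_lt.1 hp
      rw [hout p hle] at h0
      let η : E [⋀^Fin 2]→L[ℝ] ℝ := w p
      have hη : Nondeg fun u v : E => η ![u, v] :=
        hw.2.1 p (abs_pos.1 ((mul_pos hR hε).trans_le hle))
      exact absurd h0 (wedgePow_ne_zero η hη hE.ge)
  refine ⟨?_, ?_, fun p hp => (hall p hp).1, fun p hp => (hall p hp).2⟩
  · rw [← hcover]
    exact (T.smoothFormOn_nbhd fun z₀ p hp => contDiffAt_rep_desing hx h hf ε z₀ hp).union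
      ((hws.mono hV0).congr fun p hp => hout p (le_of_lt hp)) T.isOpen_nbhd hV
  · rw [← hcover]
    exact (closedFormOn_desing_nbhd hx h hws hw.1 hf ε).union
      ((hw.1.mono hV0).congr hV fun p hp => hout p (le_of_lt hp))

end Folding

end BSymplectic

theorem mainTheorem2
    {E : Type*} [NormedAddCommGroup E] [NormedSpace ℝ E] [FiniteDimensional ℝ E]
    {F : Type*} [NormedAddCommGroup F] [NormedSpace ℝ F] [FiniteDimensional ℝ F]
    {M : Type*} [TopologicalSpace M] [ChartedSpace E M] [IsManifold 𝓘(ℝ, E) ∞ M]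
    [CompactSpace M] [T2Space M]
    {Z : Type*} [TopologicalSpace Z] [ChartedSpace F Z] [IsManifold 𝓘(ℝ, F) ∞ Z]
    [Nonempty Z]
    (n k : ℕ) (hE : Module.finrank ℝ E = 2 * n) (hF : Module.finrank ℝ F + 1 = 2 * n)
    (x : M → ℝ) (hx : BSymplectic.IsDefiningFunction (E := E) x)
    (i : Z → M) (hi : Manifold.IsSmoothEmbedding 𝓘(ℝ, F) 𝓘(ℝ, E) ∞ i)
    (hZ : Set.range i = {p | x p = 0})
    (w : BSymplectic.DForm E M 2) (hw : BSymplectic.IsBSymplectic (2 * k + 1) x w) :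
    (∃ (T : BSymplectic.Tube (E := E) (F := F) i x)
      (a : Fin (2 * k + 1) → BSymplectic.DForm F Z 1) (b : BSymplectic.DForm E M 2),
      BSymplectic.IsLaurentSeries T w a b) ∧
    ∀ (T : BSymplectic.Tube (E := E) (F := F) i x)
      (a : Fin (2 * k + 1) → BSymplectic.DForm F Z 1) (b : BSymplectic.DForm E M 2),
      BSymplectic.IsLaurentSeries T w a b →
    ∀ (r R : ℝ) (f : ℝ → ℝ), 0 < r → r < R → BSymplectic.IsFoldingProfile k r R f →
    ∃ ε₀ : ℝ, 0 < ε₀ ∧ ∀ ε : ℝ, 0 < ε → ε < ε₀ →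
      BSymplectic.IsFoldedSymplectic n (BSymplectic.desing k T w a b f ε) ∧
      (∀ z : Z, BSymplectic.wedgePow (n - 1)
        (BSymplectic.pullback (E := F) (F := E) i (BSymplectic.desing k T w a b f ε) z) ≠ 0) ∧
      ∀ p : M, R * ε ≤ |x p| → BSymplectic.desing k T w a b f ε p = w p := by
  have hEF : Module.finrank ℝ E = Module.finrank ℝ F + 1 := hE.trans hF.symm
  refine ⟨?_, fun T a b hL r R f hr hrR hf => ?_⟩
  · obtain ⟨T⟩ := BSymplectic.exists_tube hEF hx hi hZ
    obtain ⟨hwc, -, α, β, hα, hβ, hwe, -⟩ := hw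
    exact ⟨T, T.exists_isLaurentSeries hx.1 hwc hα hβ hwe⟩
  · have hcl : IsClosed (Set.range i) := by
      rw [hZ]; exact isClosed_eq hx.1.continuous continuous_const
    have : CompactSpace Z := Topology.IsClosedEmbedding.compactSpace ⟨hi.isEmbedding, hcl⟩
    have hR : 0 < R := hr.trans hrR
    obtain ⟨ε₀, hε₀, h⟩ := BSymplectic.exists_forall_isFoldedSymplectic_desing hE hF hx.1 hZ hL hw
      hf hr hR
    exact ⟨ε₀, hε₀, fun ε hε hεε₀ => ⟨h ε hε hεε₀,
      BSymplectic.wedgePow_pullback_desing_ne_zero hF hx.1 hL hw hf hr hε,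
      fun p hp => BSymplectic.desing_eq_of_le_abs hx.1 hL hf hR hε hp⟩⟩
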